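/- Let $k$ be a field of characteristic zero and let $Y$ be a smooth scheme over $k$. Let $X=\mathrm{T}^*[-1]Y=\mathrm{Spec}_Y\,\mathrm{Sym}_{\mathcal O_Y}(\mathrm{T}_Y[1])$ be the $(-1)$-shifted cotangent bundle of $Y$, with projection $\pi\colon X\to Y$; its functions over an affine open subset $U=\mathrm{Spec}\,A$ of $Y$ are the polyvector fields $\mathrm{Sym}_A(\mathrm{T}_A[1])=\bigwedge_A \mathrm{Der}_k(A)$, where $\bigwedge^j$ has cohomological degree $-j$. Let $\omega=\mathrm{d}_{\mathrm{dR}}\lambda$ be the standard $(-1)$-shifted symplectic structure on $X$, where $\lambda$ is the Liouville one-form; in étale coordinates $x_i$ on $Y$, with dual fibre coordinates $p_i$, one has $\omega=\sum_i \mathrm{d}_{\mathrm{dR}}p_i\,\mathrm{d}_{\mathrm{dR}}x_i$. For a graded commutative $k$-algebra $B$ let $\mathrm{DR}(B)=\mathrm{Sym}_B(\Omega_B[-1])$, with $\mathrm{d}_{\mathrm{dR}}$ and the weight grading by form degree. Over an affine open $U=\mathrm{Spec}\,A$ put $$\Omega(U)=\Big(\prod_{w\ge 0}\mathrm{DR}(A)(w),\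 \mathrm{d}_{\mathrm{dR}}\Big),\qquad \Omega_\omega(\mathrm{T}^*[-1]U)=\Big(\prod_{w\ge 0}\mathrm{DR}\big(\mathrm{Sym}_A(\mathrm{T}_A[1])\big)(w),\ \mathrm{d}_{\mathrm{dR}}+\omega\wedge(-)\Big),$$ and let $\Omega(Y)$ and $\Omega_\omega(\mathrm{T}^*[-1]Y)$ be the complexes of derived global sections over $Y$ of these presheaves of complexes, that is, their homotopy limits over the partially ordered set of affine open subsets of $Y$. 1. There is a morphism $\Omega_\omega(\mathrm{T}^*[-1]U)\to\Omega(U)$ of complexes of $k$-vector spaces, natural in the affine open subset $U\subseteq Y$, which is a quasi-isomorphism for every $U$ and induces on derived global sections a quasi-isomorphism $$\Omega_\omega(\mathrm{T}^*[-1]Y)\xrightarrow{\ \sim\ }\Omega(Y).$$ 2. Suppose that $Y$ has pure dimension $n$ and let $K_Y=\bigwedge^n\Omega^1_Y$. There is exactly one family of $k$-linear operators $\Delta$ (the BV Laplacian) on $\Gamma(\mathrm{T}^*[-1]U,\pi^*K_Y)[-n]=\mathrm{Sym}_A(\mathrm{T}_A[1])\otimes_A K_A[-n]$, for $U=\mathrm{Spec}\,A$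 affine open in $Y$, which has cohomological degree $1$, is compatible with restriction, and in any étale coordinates $x_1,\dots,x_n$ on an affine open subset, with dual fibre coordinates $p_1,\dots,p_n$, is given by $$\Delta\big(g(p,x)\,\mathrm{d}x_1\wedge\dots\wedge\mathrm{d}x_n\big)=\sum_{i=1}^n\frac{\partial^2 g}{\partial p_i\,\partial x_i}\,\mathrm{d}x_1\wedge\dots\wedge\mathrm{d}x_n .$$ It satisfies $\Delta^2=0$, and there is a morphism of complexes $(\Gamma(\mathrm{T}^*[-1]U,\pi^*K_Y)[-n],\Delta)\to\Omega(U)$, natural in the affine open subset $U\subseteq Y$, which is a quasi-isomorphism for every $U$ and induces on derived global sections a quasi-isomorphism $$(\Gamma(\mathrm{T}^*[-1]Y,\pi^*K_Y)[-n],\Delta)\xrightarrow{\ \sim\ }\Omega(Y).$$ In particular $\Omega_\omega(\mathrm{T}^*[-1]Y)$ and $(\Gamma(\mathrm{T}^*[-1]Y,\pi^*K_Y)[-n],\Delta)$ are quasi-isomorphic. -/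

import Mathlib

universe u

open CategoryTheory AlgebraicGeometry TensorProduct Opposite
open scoped KaehlerDifferential

set_option linter.unusedSectionVars false
set_option linter.style.haveILetI false

noncomputable section

namespace BVQuantization

section DeRhamAlgebra

variable {k : Type*} [CommRing k] {B : Type*} [Ring B] [Algebra k B]

/-- Graded commutativity. Throughout, `ℬ i` is the component of *cohomological* degree `-i`
of a graded algebra concentrated in nonpositive degrees. -/
class GradedCommutative (ℬ : ℕ → Submodule k B) : Prop where
  comm : ∀ {i j : ℕ} {b c : B}, b ∈ ℬ i → c ∈ ℬ j → b * c = (-1 : k) ^ (i * j) • (c * b)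

/-- The relations defining the algebra of differential forms of a graded algebra `B`. The free
generators are symbols `b` (`Sum.inl b`) and `d b` (`Sum.inr b`) for `b` in `B`. The symbols `b`
multiply as in `B`, the map `b ↦ d b` is a graded derivation, and the result is graded commutative;
for `b` of cohomological degree `-i` the symbol `d b` has cohomological degree `1 - i`. -/
inductive DR.Rel (ℬ : ℕ → Submodule k B) :
    FreeAlgebra k (B ⊕ B) → FreeAlgebra k (B ⊕ B) → Prop
  | fun_one : DR.Rel ℬ (FreeAlgebra.ι k (Sum.inl 1)) 1
  | fun_smul (r : k) (b : B) :
      DR.Rel ℬ (FreeAlgebra.ι k (Sum.inl (r • b))) (r • FreeAlgebra.ι k (Sum.inl b))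
  | fun_add (b c : B) : DR.Rel ℬ (FreeAlgebra.ι k (Sum.inl (b + c)))
      (FreeAlgebra.ι k (Sum.inl b) + FreeAlgebra.ι k (Sum.inl c))
  | fun_mul (b c : B) : DR.Rel ℬ (FreeAlgebra.ι k (Sum.inl (b * c)))
      (FreeAlgebra.ι k (Sum.inl b) * FreeAlgebra.ι k (Sum.inl c))
  | d_smul (r : k) (b : B) :
      DR.Rel ℬ (FreeAlgebra.ι k (Sum.inr (r • b))) (r • FreeAlgebra.ι k (Sum.inr b))
  | d_add (b c : B) : DR.Rel ℬ (FreeAlgebra.ι k (Sum.inr (b + c)))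
      (FreeAlgebra.ι k (Sum.inr b) + FreeAlgebra.ι k (Sum.inr c))
  | d_mul {i : ℕ} {b : B} (hb : b ∈ ℬ i) (c : B) :
      DR.Rel ℬ (FreeAlgebra.ι k (Sum.inr (b * c)))
        (FreeAlgebra.ι k (Sum.inr b) * FreeAlgebra.ι k (Sum.inl c) +
          (-1 : k) ^ i • (FreeAlgebra.ι k (Sum.inl b) * FreeAlgebra.ι k (Sum.inr c)))
  | d_fun_comm {i j : ℕ} {b c : B} (hb : b ∈ ℬ i) (hc : c ∈ ℬ j) :
      DR.Rel ℬ (FreeAlgebra.ι k (Sum.inr b) * FreeAlgebra.ι k (Sum.inl c))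
        ((-1 : k) ^ ((i + 1) * j) • (FreeAlgebra.ι k (Sum.inl c) * FreeAlgebra.ι k (Sum.inr b)))
  | d_d_comm {i j : ℕ} {b c : B} (hb : b ∈ ℬ i) (hc : c ∈ ℬ j) :
      DR.Rel ℬ (FreeAlgebra.ι k (Sum.inr b) * FreeAlgebra.ι k (Sum.inr c))
        ((-1 : k) ^ ((i + 1) * (j + 1)) •
          (FreeAlgebra.ι k (Sum.inr c) * FreeAlgebra.ι k (Sum.inr b)))

/-- The algebra of differential forms `Sym_B (Ω_B[-1])` of a graded commutative algebra `B`, with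
`Ω_B` the module of graded Kähler differentials, presented by generators and relations. -/
def DR (ℬ : ℕ → Submodule k B) : Type _ := RingQuot (DR.Rel ℬ)

namespace DR

variable (ℬ : ℕ → Submodule k B)

instance : Ring (DR ℬ) := inferInstanceAs (Ring (RingQuot (DR.Rel ℬ)))
instance : Algebra k (DR ℬ) := inferInstanceAs (Algebra k (RingQuot (DR.Rel ℬ)))

/-- The quotient map. -/
def mk : FreeAlgebra k (B ⊕ B) →ₐ[k] DR ℬ := RingQuot.mkAlgHom k (DR.Rel ℬ)

variable {ℬ} in
theorem mk_eq {x y : FreeAlgebra k (B ⊕ B)} (h : DR.Rel ℬ x y) : mk ℬ x = mk ℬ y :=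
  RingQuot.mkAlgHom_rel k h

/-- Functions as forms of weight zero. -/
def ofFun : B →ₐ[k] DR ℬ :=
  AlgHom.ofLinearMap
    { toFun := fun b => mk ℬ (FreeAlgebra.ι k (Sum.inl b))
      map_add' := fun b c => by rw [mk_eq (Rel.fun_add b c), map_add]
      map_smul' := fun r b => by rw [mk_eq (Rel.fun_smul r b), map_smul, RingHom.id_apply] }
    (by simpa using mk_eq (ℬ := ℬ) Rel.fun_one)
    (fun b c => by simpa using mk_eq (ℬ := ℬ) (Rel.fun_mul b c))

/-- The symbols `d b`. -/
def dFun : B →ₗ[k] DR ℬ where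
  toFun b := mk ℬ (FreeAlgebra.ι k (Sum.inr b))
  map_add' b c := by rw [mk_eq (Rel.d_add b c), map_add]
  map_smul' r b := by rw [mk_eq (Rel.d_smul r b), map_smul, RingHom.id_apply]

theorem mk_inl (b : B) : mk ℬ (FreeAlgebra.ι k (Sum.inl b)) = ofFun ℬ b := rfl
theorem mk_inr (b : B) : mk ℬ (FreeAlgebra.ι k (Sum.inr b)) = dFun ℬ b := rfl

variable {ℬ}

theorem dFun_mul {i : ℕ} {b : B} (hb : b ∈ ℬ i) (c : B) :
    dFun ℬ (b * c) = dFun ℬ b * ofFun ℬ c + (-1 : k) ^ i • (ofFun ℬ b * dFun ℬ c) := by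
  simpa [mk_inl, mk_inr] using mk_eq (Rel.d_mul hb c)

theorem dFun_mul_ofFun {i j : ℕ} {b c : B} (hb : b ∈ ℬ i) (hc : c ∈ ℬ j) :
    dFun ℬ b * ofFun ℬ c = (-1 : k) ^ ((i + 1) * j) • (ofFun ℬ c * dFun ℬ b) := by
  simpa only [mk_inl, mk_inr, map_mul, map_smul] using mk_eq (Rel.d_fun_comm hb hc)

theorem dFun_mul_dFun {i j : ℕ} {b c : B} (hb : b ∈ ℬ i) (hc : c ∈ ℬ j) :
    dFun ℬ b * dFun ℬ c = (-1 : k) ^ ((i + 1) * (j + 1)) • (dFun ℬ c * dFun ℬ b) := by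
  simpa only [mk_inl, mk_inr, map_mul, map_smul] using mk_eq (Rel.d_d_comm hb hc)

/-- The universal property of `DR`. -/
def lift {C : Type*} [Ring C] [Algebra k C] (f : B →ₐ[k] C) (g : B →ₗ[k] C)
    (h₁ : ∀ (i : ℕ) (b : B), b ∈ ℬ i → ∀ c : B,
      g (b * c) = g b * f c + (-1 : k) ^ i • (f b * g c))
    (h₂ : ∀ (i j : ℕ) (b c : B), b ∈ ℬ i → c ∈ ℬ j →
      g b * f c = (-1 : k) ^ ((i + 1) * j) • (f c * g b))
    (h₃ : ∀ (i j : ℕ) (b c : B), b ∈ ℬ i → c ∈ ℬ j →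
      g b * g c = (-1 : k) ^ ((i + 1) * (j + 1)) • (g c * g b)) : DR ℬ →ₐ[k] C :=
  RingQuot.liftAlgHom k ⟨FreeAlgebra.lift k (Sum.elim f g), by
    intro x y h
    cases h with
    | fun_one => simp
    | fun_smul r b => simp
    | fun_add b c => simp
    | fun_mul b c => simp
    | d_smul r b => simp
    | d_add b c => simp
    | d_mul hb c => simpa using h₁ _ _ hb c
    | d_fun_comm hb hc => simpa using h₂ _ _ _ _ hb hc
    | d_d_comm hb hc => simpa using h₃ _ _ _ _ hb hc⟩

section lift
variable {C : Type*} [Ring C] [Algebra k C] (f : B →ₐ[k] C) (g : B →ₗ[k] C)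
    (h₁ : ∀ (i : ℕ) (b : B), b ∈ ℬ i → ∀ c : B,
      g (b * c) = g b * f c + (-1 : k) ^ i • (f b * g c))
    (h₂ : ∀ (i j : ℕ) (b c : B), b ∈ ℬ i → c ∈ ℬ j →
      g b * f c = (-1 : k) ^ ((i + 1) * j) • (f c * g b))
    (h₃ : ∀ (i j : ℕ) (b c : B), b ∈ ℬ i → c ∈ ℬ j →
      g b * g c = (-1 : k) ^ ((i + 1) * (j + 1)) • (g c * g b))

@[simp] theorem lift_ofFun (b : B) : lift f g h₁ h₂ h₃ (ofFun ℬ b) = f b := by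
  rw [← mk_inl, lift, mk]
  exact (RingQuot.liftAlgHom_mkAlgHom_apply k _ _ _).trans (by simp)

@[simp] theorem lift_dFun (b : B) : lift f g h₁ h₂ h₃ (dFun ℬ b) = g b := by
  rw [← mk_inr, lift, mk]
  exact (RingQuot.liftAlgHom_mkAlgHom_apply k _ _ _).trans (by simp)
end lift

theorem algHom_ext {C : Type*} [Ring C] [Algebra k C] {F G : DR ℬ →ₐ[k] C}
    (h₀ : ∀ b, F (ofFun ℬ b) = G (ofFun ℬ b)) (h₁ : ∀ b, F (dFun ℬ b) = G (dFun ℬ b)) : F = G := by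
  apply RingQuot.ringQuot_ext' k
  apply FreeAlgebra.hom_ext
  ext (b | b)
  · exact h₀ b
  · exact h₁ b

/-! ### The de Rham differential -/
variable (ℬ) in
/-- The sign automorphism of `B`: multiplication by `(-1)^i` on `ℬ i`. -/
def sgn [GradedAlgebra ℬ] : B →ₗ[k] B :=
  DirectSum.toModule k ℕ B (fun i => (-1 : k) ^ i • (ℬ i).subtype) ∘ₗ
    (DirectSum.decomposeLinearEquiv ℬ).toLinearMap

theorem sgn_of_mem [GradedAlgebra ℬ] {i : ℕ} {b : B} (hb : b ∈ ℬ i) :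
    sgn ℬ b = (-1 : k) ^ i • b := by
  simp only [sgn, LinearMap.coe_comp, LinearEquiv.coe_coe, Function.comp_apply,
    DirectSum.decomposeLinearEquiv_apply, DirectSum.decompose_of_mem ℬ hb]
  exact (DirectSum.toModule_lof k (M := fun i => ℬ i) i (⟨b, hb⟩ : ℬ i)).trans rfl

theorem sgn_mul [GradedAlgebra ℬ] (b c : B) : sgn ℬ (b * c) = sgn ℬ b * sgn ℬ c := by
  induction b using DirectSum.Decomposition.inductionOn ℬ with
  | zero => simp
  | add x y hx hy => simp [add_mul, hx, hy]
  | homogeneous x =>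
    induction c using DirectSum.Decomposition.inductionOn ℬ with
    | zero => simp
    | add x y hx hy => simp [mul_add, hx, hy]
    | homogeneous y =>
      rw [sgn_of_mem x.2, sgn_of_mem y.2, sgn_of_mem (SetLike.mul_mem_graded x.2 y.2),
        smul_mul_smul_comm, pow_add]

variable (ℬ) in
/-- The sign automorphism of `B` as an algebra homomorphism. -/
def sgnHom [GradedAlgebra ℬ] : B →ₐ[k] B :=
  AlgHom.ofLinearMap (sgn ℬ)
    (by rw [sgn_of_mem (i := 0) (SetLike.one_mem_graded ℬ)]; simp) sgn_mul


theorem dFun_mul' [GradedAlgebra ℬ] (b c : B) :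
    dFun ℬ (b * c) = dFun ℬ b * ofFun ℬ c + ofFun ℬ (sgn ℬ b) * dFun ℬ c := by
  induction b using DirectSum.Decomposition.inductionOn ℬ with
  | zero => simp
  | add x y hx hy => simp only [add_mul, map_add, hx, hy]; abel
  | homogeneous x => rw [dFun_mul x.2, sgn_of_mem x.2, map_smul, smul_mul_assoc]

theorem induction {p : DR ℬ → Prop} (hf : ∀ b, p (ofFun ℬ b)) (hd : ∀ b, p (dFun ℬ b))
    (hadd : ∀ x y, p x → p y → p (x + y)) (hmul : ∀ x y, p x → p y → p (x * y)) (x : DR ℬ) :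
    p x := by
  obtain ⟨x, rfl⟩ : ∃ y, mk ℬ y = x := RingQuot.mkAlgHom_surjective k _ x
  induction x using FreeAlgebra.induction with
  | grade0 r =>
    have := hf (algebraMap k B r)
    rwa [AlgHom.commutes, ← (mk ℬ).commutes] at this
  | grade1 b =>
    rcases b with b | b
    · exact hf b
    · exact hd b
  | mul x y hx hy => rw [map_mul]; exact hmul _ _ hx hy
  | add x y hx hy => rw [map_add]; exact hadd _ _ hx hy

/-- Upper triangular two by two matrices. -/
def upper {R : Type*} [Ring R] (a b c : R) : Matrix (Fin 2) (Fin 2) R := !![a, b; 0, c]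

theorem upper_mul {R : Type*} [Ring R] (a b c a' b' c' : R) :
    upper a b c * upper a' b' c' = upper (a * a') (a * b' + b * c') (c * c') := by
  simp [upper]

theorem upper_add {R : Type*} [Ring R] (a b c a' b' c' : R) :
    upper a b c + upper a' b' c' = upper (a + a') (b + b') (c + c') := by
  simp [upper]

theorem upper_smul {R : Type*} [Ring R] [Algebra k R] (r : k) (a b c : R) :
    r • upper a b c = upper (r • a) (r • b) (r • c) := by
  simp [upper]

theorem one_eq_upper {R : Type*} [Ring R] : (1 : Matrix (Fin 2) (Fin 2) R) = upper 1 0 1 := by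
  simp [upper, Matrix.one_fin_two]

variable (ℬ) in
/-- Auxiliary: the graded derivation `d` is the upper right entry of the algebra homomorphism
`x ↦ !![τ x, d x; 0, x]`, where `τ` is the sign automorphism. -/
def dMatrix [GradedAlgebra ℬ] : DR ℬ →ₐ[k] Matrix (Fin 2) (Fin 2) (DR ℬ) :=
  lift (AlgHom.ofLinearMap
      { toFun := fun b => upper (ofFun ℬ (sgn ℬ b)) (dFun ℬ b) (ofFun ℬ b)
        map_add' := fun b c => by simp only [map_add, upper_add]
        map_smul' := fun r b => by simp only [map_smul, upper_smul, RingHom.id_apply] }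
      (by
        have h1 : dFun ℬ (1 : B) = 0 := by
          have := dFun_mul (ℬ := ℬ) (SetLike.one_mem_graded ℬ) (1 : B)
          simpa using this
        have h2 : sgn ℬ (1 : B) = 1 := (sgnHom ℬ).map_one
        simp only [LinearMap.coe_mk, AddHom.coe_mk, h1, h2, map_one, one_eq_upper])
      (fun b c => by
        simp only [LinearMap.coe_mk, AddHom.coe_mk, upper_mul, sgn_mul, map_mul, dFun_mul']
        rw [add_comm]))
    { toFun := fun b => upper (-dFun ℬ (sgn ℬ b)) 0 (dFun ℬ b)
      map_add' := fun b c => by simp only [map_add, upper_add, neg_add, add_zero]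
      map_smul' := fun r b => by
        simp only [map_smul, upper_smul, RingHom.id_apply, smul_neg, smul_zero] }
    (fun i b hb c => by
      simp only [AlgHom.ofLinearMap_apply, LinearMap.coe_mk, AddHom.coe_mk, upper_mul, upper_smul,
        upper_add, sgn_mul, dFun_mul hb, sgn_of_mem hb, map_smul, smul_mul_assoc, smul_add]
      congr 1
      · simp only [neg_add, neg_mul, mul_neg, smul_neg, smul_mul_assoc]
      · simp)
    (fun i j b c hb hc => by
      have hs : (-1 : k) ^ ((i + 1) * j) * (-1 : k) ^ ((j + 1) * (i + 1)) = -(-1 : k) ^ i := by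
        rw [← pow_add, show (i + 1) * j + (j + 1) * (i + 1) = 2 * ((i + 1) * j) + (i + 1) by ring,
          pow_add, pow_mul]
        simp [pow_succ]
      simp only [AlgHom.ofLinearMap_apply, LinearMap.coe_mk, AddHom.coe_mk, upper_mul, upper_smul,
        sgn_of_mem hb, sgn_of_mem hc, map_smul]
      congr 1
      · simp only [neg_mul, mul_neg, smul_mul_smul_comm, dFun_mul_ofFun hb hc, smul_smul, smul_neg]
        congr 2; ring
      · simp only [mul_zero, zero_mul, zero_add, add_zero]
        rw [dFun_mul_dFun hc hb, smul_smul, hs]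
        simp
      · exact dFun_mul_ofFun hb hc)
    (fun i j b c hb hc => by
      simp only [LinearMap.coe_mk, AddHom.coe_mk, upper_mul, upper_smul,
        sgn_of_mem hb, sgn_of_mem hc, map_smul]
      congr 1
      · simp only [neg_mul, mul_neg, neg_neg, smul_mul_smul_comm, dFun_mul_dFun hb hc, smul_smul]
        congr 1; ring
      · simp
      · exact dFun_mul_dFun hb hc)

theorem dMatrix_ofFun [GradedAlgebra ℬ] (b : B) :
    dMatrix ℬ (ofFun ℬ b) = upper (ofFun ℬ (sgn ℬ b)) (dFun ℬ b) (ofFun ℬ b) :=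
  lift_ofFun _ _ _ _ _ b

theorem dMatrix_dFun [GradedAlgebra ℬ] (b : B) :
    dMatrix ℬ (dFun ℬ b) = upper (-dFun ℬ (sgn ℬ b)) 0 (dFun ℬ b) :=
  lift_dFun _ _ _ _ _ b

variable (ℬ) in
/-- The de Rham differential: the graded derivation with `b ↦ d b` and `d b ↦ 0`. -/
def d [GradedAlgebra ℬ] : DR ℬ →ₗ[k] DR ℬ :=
  Matrix.entryLinearMap k (DR ℬ) 0 1 ∘ₗ (dMatrix ℬ).toLinearMap

variable (ℬ) in
/-- Auxiliary: the sign automorphism. -/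
def tau [GradedAlgebra ℬ] : DR ℬ →ₗ[k] DR ℬ :=
  Matrix.entryLinearMap k (DR ℬ) 0 0 ∘ₗ (dMatrix ℬ).toLinearMap

theorem dMatrix_eq [GradedAlgebra ℬ] (x : DR ℬ) : dMatrix ℬ x = upper (tau ℬ x) (d ℬ x) x := by
  suffices h : ∃ a b, dMatrix ℬ x = upper a b x by
    obtain ⟨a, b, h⟩ := h
    have h1 : tau ℬ x = a := by
      change dMatrix ℬ x 0 0 = a
      rw [h]; rfl
    have h2 : d ℬ x = b := by
      change dMatrix ℬ x 0 1 = b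
      rw [h]; rfl
    rw [h1, h2, h]
  induction x using induction with
  | hf b => exact ⟨_, _, dMatrix_ofFun b⟩
  | hd b => exact ⟨_, _, dMatrix_dFun b⟩
  | hadd x y hx hy =>
    obtain ⟨a, b, hx⟩ := hx
    obtain ⟨a', b', hy⟩ := hy
    exact ⟨_, _, by rw [map_add, hx, hy, upper_add]⟩
  | hmul x y hx hy =>
    obtain ⟨a, b, hx⟩ := hx
    obtain ⟨a', b', hy⟩ := hy
    exact ⟨_, _, by rw [map_mul, hx, hy, upper_mul]⟩

theorem upper_inj {R : Type*} [Ring R] {a b c a' b' c' : R}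
    (h : upper a b c = upper a' b' c') : a = a' ∧ b = b' :=
  ⟨congrFun (congrFun h 0) 0, congrFun (congrFun h 0) 1⟩

section
variable [GradedAlgebra ℬ]

@[simp] theorem d_ofFun (b : B) : d ℬ (ofFun ℬ b) = dFun ℬ b :=
  (upper_inj ((dMatrix_eq _).symm.trans (dMatrix_ofFun b))).2

@[simp] theorem d_dFun (b : B) : d ℬ (dFun ℬ b) = 0 :=
  (upper_inj ((dMatrix_eq _).symm.trans (dMatrix_dFun b))).2

theorem tau_ofFun (b : B) : tau ℬ (ofFun ℬ b) = ofFun ℬ (sgn ℬ b) :=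
  (upper_inj ((dMatrix_eq _).symm.trans (dMatrix_ofFun b))).1

theorem tau_dFun (b : B) : tau ℬ (dFun ℬ b) = -dFun ℬ (sgn ℬ b) :=
  (upper_inj ((dMatrix_eq _).symm.trans (dMatrix_dFun b))).1

theorem tau_mul (x y : DR ℬ) : tau ℬ (x * y) = tau ℬ x * tau ℬ y := by
  have := dMatrix_eq (x * y)
  rw [map_mul, dMatrix_eq, dMatrix_eq y, upper_mul] at this
  exact (upper_inj this).1.symm

theorem d_mul (x y : DR ℬ) : d ℬ (x * y) = d ℬ x * y + tau ℬ x * d ℬ y := by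
  have := dMatrix_eq (x * y)
  rw [map_mul, dMatrix_eq, dMatrix_eq y, upper_mul] at this
  rw [← (upper_inj this).2, add_comm]

theorem d_tau (x : DR ℬ) : d ℬ (tau ℬ x) = -tau ℬ (d ℬ x) := by
  induction x using induction with
  | hf b => simp [tau_ofFun, tau_dFun]
  | hd b => simp [tau_dFun]
  | hadd x y hx hy => simp only [map_add, hx, hy, neg_add]
  | hmul x y hx hy =>
    simp only [d_mul, tau_mul, map_add, hx, hy]
    simp [add_comm]

theorem d_d (x : DR ℬ) : d ℬ (d ℬ x) = 0 := by
  induction x using induction with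
  | hf b => simp
  | hd b => simp
  | hadd x y hx hy => simp [hx, hy]
  | hmul x y hx hy => simp [d_mul, hx, hy, d_tau]

end

/-! ### Weights and degrees -/

/-- The sign `(-1)^m`, for an integer `m`. -/
def sg (k : Type*) [CommRing k] (m : ℤ) : k := ((m.negOnePow : ℤˣ) : ℤ)

theorem sg_add (m n : ℤ) : sg k (m + n) = sg k m * sg k n := by
  simp [sg, Int.negOnePow_add]

theorem sg_one : sg k 1 = -1 := by simp [sg]

theorem sg_neg (m : ℤ) : sg k (-m) = sg k m := by simp [sg, Int.negOnePow_neg]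

theorem sg_natCast (i : ℕ) : sg k i = (-1) ^ i := by
  induction i with
  | zero => simp [sg]
  | succ i ih => rw [Nat.cast_succ, sg_add, ih, sg_one, pow_succ]

variable (ℬ) in
/-- The forms of weight `w` and (total) cohomological degree `m`, spanned by the products
`b * d b₁ * ... * d b_w` of homogeneous elements. -/
def piece : ℕ → ℤ → Submodule k (DR ℬ)
  | 0, m => Submodule.span k {z | ∃ (i : ℕ) (b : B), b ∈ ℬ i ∧ m = -(i : ℤ) ∧ z = ofFun ℬ b}
  | w + 1, m => Submodule.span k {z | ∃ (l : ℤ) (x : DR ℬ) (i : ℕ) (b : B),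
      x ∈ piece w l ∧ b ∈ ℬ i ∧ m = l + (1 - (i : ℤ)) ∧ z = x * dFun ℬ b}

theorem ofFun_mem {i : ℕ} {b : B} (hb : b ∈ ℬ i) : ofFun ℬ b ∈ piece ℬ 0 (-(i : ℤ)) :=
  Submodule.subset_span ⟨i, b, hb, rfl, rfl⟩

theorem mul_dFun_mem {w : ℕ} {l : ℤ} {x : DR ℬ} {i : ℕ} {b : B} (hx : x ∈ piece ℬ w l)
    (hb : b ∈ ℬ i) : x * dFun ℬ b ∈ piece ℬ (w + 1) (l + (1 - (i : ℤ))) :=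
  Submodule.subset_span ⟨l, x, i, b, hx, hb, rfl, rfl⟩

theorem piece_induction {p : ∀ (w : ℕ) (m : ℤ) (x : DR ℬ), x ∈ piece ℬ w m → Prop}
    (hf : ∀ (i : ℕ) (b : B) (hb : b ∈ ℬ i), p 0 (-(i : ℤ)) (ofFun ℬ b) (ofFun_mem hb))
    (hd : ∀ (w : ℕ) (l : ℤ) (x : DR ℬ) (i : ℕ) (b : B) (hx : x ∈ piece ℬ w l) (hb : b ∈ ℬ i),
      p w l x hx → p (w + 1) (l + (1 - (i : ℤ))) (x * dFun ℬ b) (mul_dFun_mem hx hb))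
    (hadd : ∀ w m x y hx hy, p w m x hx → p w m y hy → p w m (x + y) (add_mem hx hy))
    (hsmul : ∀ w m (r : k) x hx, p w m x hx → p w m (r • x) (Submodule.smul_mem _ r hx))
    (hzero : ∀ w m, p w m 0 (zero_mem _))
    {w : ℕ} {m : ℤ} {x : DR ℬ} (hx : x ∈ piece ℬ w m) : p w m x hx := by
  induction w generalizing m x with
  | zero =>
    refine Submodule.span_induction (p := fun x hx => p 0 m x hx) ?_ (hzero _ _)
      (fun x y hx hy h h' => hadd _ _ _ _ hx hy h h') (fun r x hx h => hsmul _ _ _ _ hx h) hx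
    rintro z ⟨i, b, hb, rfl, rfl⟩
    exact hf i b hb
  | succ w ih =>
    refine Submodule.span_induction (p := fun x hx => p (w + 1) m x hx) ?_ (hzero _ _)
      (fun x y hx hy h h' => hadd _ _ _ _ hx hy h h') (fun r x hx h => hsmul _ _ _ _ hx h) hx
    rintro z ⟨l, y, i, b, hy, hb, rfl, rfl⟩
    exact hd w l y i b hy hb (ih hy)

theorem tau_of_mem [GradedAlgebra ℬ] {w : ℕ} {m : ℤ} {x : DR ℬ} (hx : x ∈ piece ℬ w m) :
    tau ℬ x = sg k m • x := by
  induction hx using piece_induction with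
  | hf i b hb => rw [tau_ofFun, sgn_of_mem hb, map_smul, sg_neg, sg_natCast]
  | hd w l x i b hx hb ih =>
    rw [tau_mul, tau_dFun, sgn_of_mem hb, ih, map_smul, sg_add, sub_eq_add_neg, sg_add, sg_one,
      sg_neg, sg_natCast, ← neg_smul, smul_mul_smul_comm]
    simp
  | hadd w m x y _ _ hx hy => rw [map_add, hx, hy, smul_add]
  | hsmul w m r x _ hx => rw [map_smul, hx, smul_comm]
  | hzero => simp

theorem d_mem [GradedAlgebra ℬ] {w : ℕ} {m : ℤ} {x : DR ℬ} (hx : x ∈ piece ℬ w m) :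
    d ℬ x ∈ piece ℬ (w + 1) (m + 1) := by
  induction hx using piece_induction with
  | hf i b hb =>
    have := mul_dFun_mem (ofFun_mem (SetLike.one_mem_graded ℬ)) hb
    rw [map_one, one_mul] at this
    rw [d_ofFun]
    convert this using 2
    push_cast; ring
  | hd w l x i b hx hb ih =>
    rw [d_mul, d_dFun, mul_zero, add_zero]
    convert mul_dFun_mem ih hb using 2
    ring
  | hadd w m x y _ _ hx hy => rw [map_add]; exact add_mem hx hy
  | hsmul w m r x _ hx => rw [map_smul]; exact Submodule.smul_mem _ _ hx
  | hzero => simp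

theorem mul_ofFun_mem [GradedAlgebra ℬ] {w : ℕ} {m : ℤ} {x : DR ℬ} {j : ℕ} {c : B}
    (hx : x ∈ piece ℬ w m) (hc : c ∈ ℬ j) : x * ofFun ℬ c ∈ piece ℬ w (m - (j : ℤ)) := by
  induction hx using piece_induction with
  | hf i b hb =>
    rw [← map_mul]
    convert ofFun_mem (SetLike.mul_mem_graded hb hc) using 2
    push_cast; ring
  | hd w l x i b hx hb ih =>
    rw [mul_assoc, dFun_mul_ofFun hb hc, mul_smul_comm, ← mul_assoc]
    refine Submodule.smul_mem _ _ ?_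
    convert mul_dFun_mem ih hb using 2
    ring
  | hadd w m x y _ _ hx hy => rw [add_mul]; exact add_mem hx hy
  | hsmul w m r x _ hx => rw [smul_mul_assoc]; exact Submodule.smul_mem _ _ hx
  | hzero => simp

theorem mul_mem [GradedAlgebra ℬ] {v w : ℕ} {l m : ℤ} {x y : DR ℬ}
    (hx : x ∈ piece ℬ v l) (hy : y ∈ piece ℬ w m) : x * y ∈ piece ℬ (v + w) (l + m) := by
  induction hy using piece_induction with
  | hf i b hb => exact mul_ofFun_mem hx hb
  | hd w m y i b hy hb ih =>
    rw [← mul_assoc]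
    convert mul_dFun_mem ih hb using 2
    all_goals ring
  | hadd w m x y _ _ hx hy => rw [mul_add]; exact add_mem hx hy
  | hsmul w m r x _ hx => rw [mul_smul_comm]; exact Submodule.smul_mem _ _ hx
  | hzero => simp

theorem sg_mul_self (m : ℤ) : sg k m * sg k m = 1 := by
  rw [← sg_add]; simp [sg, ← two_mul]

theorem sg_natCast' (i : ℕ) : (-1 : k) ^ i = sg k i := (sg_natCast i).symm

theorem mul_comm_ofFun [GradedAlgebra ℬ] [GradedCommutative ℬ] {w : ℕ} {m : ℤ} {x : DR ℬ} {j : ℕ}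
    {c : B} (hx : x ∈ piece ℬ w m) (hc : c ∈ ℬ j) :
    x * ofFun ℬ c = sg k (m * j) • (ofFun ℬ c * x) := by
  induction hx using piece_induction with
  | hf i b hb =>
    rw [← map_mul, GradedCommutative.comm hb hc, map_smul, map_mul, sg_natCast', neg_mul, sg_neg]
    push_cast; rfl
  | hd w l x i b hx hb ih =>
    rw [mul_assoc, dFun_mul_ofFun hb hc, mul_smul_comm, ← mul_assoc, ih, smul_mul_assoc, smul_smul,
      mul_assoc, sg_natCast', ← sg_add]
    congr 1
    push_cast
    rw [show ((i : ℤ) + 1) * j + l * j = (l + (1 - i)) * j + (i * j + i * j) by ring,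
      sg_add _ (_ + _), sg_add (_ * _) (_ * _), sg_mul_self, mul_one]
  | hadd w m x y _ _ hx hy => rw [add_mul, hx, hy, mul_add, smul_add]
  | hsmul w m r x _ hx => rw [smul_mul_assoc, hx, mul_smul_comm, smul_comm]
  | hzero => simp

theorem mul_comm_dFun [GradedAlgebra ℬ] {w : ℕ} {m : ℤ} {x : DR ℬ} {j : ℕ}
    {c : B} (hx : x ∈ piece ℬ w m) (hc : c ∈ ℬ j) :
    x * dFun ℬ c = sg k (m * (1 - j)) • (dFun ℬ c * x) := by
  induction hx using piece_induction with
  | hf i b hb =>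
    rw [dFun_mul_ofFun hc hb, smul_smul, sg_natCast', ← sg_add]
    push_cast
    rw [show -(i : ℤ) * (1 - j) + (j + 1) * i = i * j + i * j by ring, sg_add, sg_mul_self, one_smul]
  | hd w l x i b hx hb ih =>
    rw [mul_assoc, dFun_mul_dFun hb hc, mul_smul_comm, ← mul_assoc, ih, smul_mul_assoc, smul_smul,
      mul_assoc, sg_natCast', ← sg_add]
    congr 1
    push_cast
    rw [show ((i : ℤ) + 1) * (j + 1) + l * (1 - j) = (l + (1 - i)) * (1 - j) + (2 * (i + j)) by ring,
      two_mul, sg_add, sg_add (_ + _) (_ + _), sg_mul_self, mul_one]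
  | hadd w m x y _ _ hx hy => rw [add_mul, hx, hy, mul_add, smul_add]
  | hsmul w m r x _ hx => rw [smul_mul_assoc, hx, mul_smul_comm, smul_comm]
  | hzero => simp

theorem mul_comm_of_mem [GradedAlgebra ℬ] [GradedCommutative ℬ] {v w : ℕ} {l m : ℤ} {x y : DR ℬ}
    (hx : x ∈ piece ℬ v l) (hy : y ∈ piece ℬ w m) : x * y = sg k (l * m) • (y * x) := by
  induction hy using piece_induction with
  | hf i b hb => rw [mul_comm_ofFun hx hb, mul_neg, sg_neg]
  | hd w m y i b hy hb ih =>
    rw [← mul_assoc, ih, smul_mul_assoc, mul_assoc, mul_comm_dFun hx hb, mul_smul_comm, smul_smul,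
      mul_assoc, ← sg_add]
    congr 2
    ring
  | hadd w m y z _ _ hy hz => rw [add_mul, mul_add, hy, hz, smul_add]
  | hsmul w m r y _ hy => rw [smul_mul_assoc, mul_smul_comm, hy, smul_comm]
  | hzero => simp

end DR
end DeRhamAlgebra

namespace DR
section map
variable {k : Type*} [CommRing k] {B C E : Type*} [Ring B] [Algebra k B] [Ring C] [Algebra k C]
  [Ring E] [Algebra k E]
  {ℬ : ℕ → Submodule k B} {𝒞 : ℕ → Submodule k C} {ℰ : ℕ → Submodule k E}

/-- A homomorphism of graded algebras acts on differential forms. -/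
def map (f : B →ₐ[k] C) (hf : ∀ i, ∀ b ∈ ℬ i, f b ∈ 𝒞 i) : DR ℬ →ₐ[k] DR 𝒞 :=
  lift ((ofFun 𝒞).comp f) (dFun 𝒞 ∘ₗ f.toLinearMap)
    (fun i b hb c => by simpa using dFun_mul (hf i b hb) (f c))
    (fun i j b c hb hc => by simpa using dFun_mul_ofFun (hf i b hb) (hf j c hc))
    (fun i j b c hb hc => by simpa using dFun_mul_dFun (hf i b hb) (hf j c hc))

variable (f : B →ₐ[k] C) (hf : ∀ i, ∀ b ∈ ℬ i, f b ∈ 𝒞 i)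
  (g : C →ₐ[k] E) (hg : ∀ i, ∀ b ∈ 𝒞 i, g b ∈ ℰ i)

@[simp] theorem map_ofFun (b : B) : map f hf (ofFun ℬ b) = ofFun 𝒞 (f b) :=
  lift_ofFun _ _ _ _ _ b

@[simp] theorem map_dFun (b : B) : map f hf (dFun ℬ b) = dFun 𝒞 (f b) :=
  lift_dFun _ _ _ _ _ b

theorem map_map (x : DR ℬ) :
    map g hg (map f hf x) = map (ℬ := ℬ) (𝒞 := ℰ) (g.comp f)
      (fun i b hb => hg i _ (hf i b hb)) x := by
  rw [← AlgHom.comp_apply]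
  congr 1
  apply algHom_ext
  · intro b
    rw [AlgHom.comp_apply, map_ofFun, map_ofFun]
    exact (map_ofFun (ℬ := ℬ) (𝒞 := ℰ) (g.comp f) (fun i b hb => hg i _ (hf i b hb)) b).symm
  · intro b
    rw [AlgHom.comp_apply, map_dFun, map_dFun]
    exact (map_dFun (ℬ := ℬ) (𝒞 := ℰ) (g.comp f) (fun i b hb => hg i _ (hf i b hb)) b).symm

theorem map_id (x : DR ℬ) : map (ℬ := ℬ) (𝒞 := ℬ) (AlgHom.id k B) (fun _ _ h => h) x = x := by
  conv_rhs => rw [← AlgHom.id_apply (R := k) x]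
  congr 1
  apply algHom_ext
  · exact fun b => map_ofFun (ℬ := ℬ) (𝒞 := ℬ) (AlgHom.id k B) (fun _ _ h => h) b
  · exact fun b => map_dFun (ℬ := ℬ) (𝒞 := ℬ) (AlgHom.id k B) (fun _ _ h => h) b

theorem map_mem {w : ℕ} {m : ℤ} {x : DR ℬ} (hx : x ∈ piece ℬ w m) :
    map f hf x ∈ piece 𝒞 w m := by
  induction hx using piece_induction with
  | hf i b hb => rw [map_ofFun]; exact ofFun_mem (hf i b hb)
  | hd w l x i b hx hb ih => rw [map_mul, map_dFun]; exact mul_dFun_mem ih (hf i b hb)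
  | hadd w m x y _ _ hx hy => rw [map_add]; exact add_mem hx hy
  | hsmul w m r x _ hx => rw [map_smul]; exact Submodule.smul_mem _ _ hx
  | hzero => simp

theorem sgn_map {f : B →ₐ[k] C} (hf : ∀ i, ∀ b ∈ ℬ i, f b ∈ 𝒞 i) [GradedAlgebra ℬ]
    [GradedAlgebra 𝒞] (b : B) : sgn 𝒞 (f b) = f (sgn ℬ b) := by
  induction b using DirectSum.Decomposition.inductionOn ℬ with
  | zero => simp
  | add x y hx hy => simp [hx, hy]
  | homogeneous x => rw [sgn_of_mem x.2, sgn_of_mem (hf _ _ x.2), map_smul]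

theorem map_tau [GradedAlgebra ℬ] [GradedAlgebra 𝒞] (x : DR ℬ) :
    map f hf (tau ℬ x) = tau 𝒞 (map f hf x) := by
  induction x using induction with
  | hf b => simp [tau_ofFun, sgn_map hf]
  | hd b => simp [tau_dFun, sgn_map hf]
  | hadd x y hx hy => simp [hx, hy]
  | hmul x y hx hy => simp [tau_mul, hx, hy]

theorem map_d [GradedAlgebra ℬ] [GradedAlgebra 𝒞] (x : DR ℬ) :
    map f hf (d ℬ x) = d 𝒞 (map f hf x) := by
  induction x using induction with
  | hf b => simp
  | hd b => simp
  | hadd x y hx hy => simp [hx, hy]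
  | hmul x y hx hy => simp [d_mul, hx, hy, map_tau]

end map

section realization
variable {k : Type u} [Field k] [CharZero k] {B C E : Type u} [Ring B] [Algebra k B] [Ring C]
  [Algebra k C] [Ring E] [Algebra k E]
  {ℬ : ℕ → Submodule k B} {𝒞 : ℕ → Submodule k C} {ℰ : ℕ → Submodule k E}
  [GradedAlgebra ℬ] [GradedAlgebra 𝒞] [GradedAlgebra ℰ]
  [GradedCommutative ℬ] [GradedCommutative 𝒞] [GradedCommutative ℰ]

variable (ℬ) in
/-- A closed two-form of degree `-1`: a form of weight `2`, of cohomological degree `1 = 2 - 1` in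
`DR ℬ`, which is closed. -/
structure ClosedTwoForm where
  val : DR ℬ
  mem : val ∈ piece ℬ 2 1
  closed : d ℬ val = 0

namespace ClosedTwoForm

instance : Zero (ClosedTwoForm ℬ) := ⟨⟨0, zero_mem _, map_zero _⟩⟩

@[simp] theorem val_zero : (0 : ClosedTwoForm ℬ).val = 0 := rfl

theorem mul_self (ω : ClosedTwoForm ℬ) : ω.val * ω.val = 0 := by
  have h := mul_comm_of_mem ω.mem ω.mem
  rw [mul_one, sg_one, neg_smul, one_smul, eq_neg_iff_add_eq_zero, ← two_smul k] at h
  exact (smul_eq_zero_iff_right (two_ne_zero (α := k))).1 h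

end ClosedTwoForm

variable (ℬ) in
/-- The de Rham differential as a map from weight `w` to weight `w + 1`. -/
def dPiece (w : ℕ) {m m' : ℤ} (h : m + 1 = m') : piece ℬ w m →ₗ[k] piece ℬ (w + 1) m' :=
  (d ℬ).restrict (fun _ hx => h ▸ d_mem hx)

/-- The operator `ω ∧ -` as a map from weight `w` to weight `w + 2`. -/
def wedgePiece (ω : ClosedTwoForm ℬ) (w : ℕ) {m m' : ℤ} (h : m + 1 = m') :
    piece ℬ w m →ₗ[k] piece ℬ (w + 2) m' :=
  (LinearMap.mulLeft k ω.val).restrict (fun x hx => by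
    have := mul_mem ω.mem hx
    rwa [add_comm 2 w, add_comm 1 m, h] at this)

/-- The total differential `d + ω ∧ -` on the product of all weights. -/
def twistedD (ω : ClosedTwoForm ℬ) {m m' : ℤ} (h : m + 1 = m') :
    (∀ w : ℕ, piece ℬ w m) →ₗ[k] (∀ w : ℕ, piece ℬ w m') :=
  LinearMap.pi fun w => match w with
    | 0 => 0
    | 1 => dPiece ℬ 0 h ∘ₗ LinearMap.proj 0
    | w + 2 => dPiece ℬ (w + 1) h ∘ₗ LinearMap.proj (w + 1) +
        wedgePiece ω w h ∘ₗ LinearMap.proj w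

theorem twistedD_zero (ω : ClosedTwoForm ℬ) {m m' : ℤ} (h : m + 1 = m')
    (x : ∀ w : ℕ, piece ℬ w m) : (twistedD ω h x 0 : DR ℬ) = 0 := rfl

theorem twistedD_one (ω : ClosedTwoForm ℬ) {m m' : ℤ} (h : m + 1 = m')
    (x : ∀ w : ℕ, piece ℬ w m) : (twistedD ω h x 1 : DR ℬ) = d ℬ (x 0) := rfl

theorem twistedD_add_two (ω : ClosedTwoForm ℬ) {m m' : ℤ} (h : m + 1 = m')
    (x : ∀ w : ℕ, piece ℬ w m) (w : ℕ) :
    (twistedD ω h x (w + 2) : DR ℬ) = d ℬ (x (w + 1)) + ω.val * x w := rfl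

theorem d_wedge (ω : ClosedTwoForm ℬ) (x : DR ℬ) : d ℬ (ω.val * x) + ω.val * d ℬ x = 0 := by
  rw [d_mul, ω.closed, tau_of_mem ω.mem, sg_one]
  simp

theorem twistedD_twistedD (ω : ClosedTwoForm ℬ) {l m n : ℤ} (h : l + 1 = m) (h' : m + 1 = n)
    (x : ∀ w : ℕ, piece ℬ w l) : twistedD ω h' (twistedD ω h x) = 0 := by
  funext w
  apply Subtype.ext
  match w with
  | 0 => rfl
  | 1 =>
    rw [twistedD_one, twistedD_zero, map_zero]; rfl
  | 2 =>
    rw [twistedD_add_two, twistedD_one, twistedD_zero, d_d, mul_zero, add_zero]; rfl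
  | 3 =>
    rw [twistedD_add_two, twistedD_add_two, twistedD_one, map_add, d_d, zero_add, d_wedge]; rfl
  | w + 4 =>
    rw [twistedD_add_two, twistedD_add_two, twistedD_add_two, map_add, d_d, zero_add, mul_add,
      ← mul_assoc, ω.mul_self, zero_mul, add_zero, d_wedge]
    rfl

/-- The `ω`-twisted de Rham complex: the product of the components of all weights, with the
differential `d + ω ∧ -`. For `ω = 0` this is the de Rham complex. -/
def twistedComplex (ω : ClosedTwoForm ℬ) : CochainComplex (ModuleCat.{u} k) ℤ where
  X m := ModuleCat.of k (∀ w : ℕ, piece ℬ w m)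
  d m m' := if h : m + 1 = m' then ModuleCat.ofHom (twistedD ω h) else 0
  shape m m' h := dif_neg h
  d_comp_d' l m n h h' := by
    have h : l + 1 = m := h
    have h' : m + 1 = n := h'
    rw [dif_pos h, dif_pos h']
    ext x : 2
    exact twistedD_twistedD ω h h' x

/-- Functoriality of the twisted de Rham complex. -/
def twistedMap (f : B →ₐ[k] C) (hf : ∀ i, ∀ b ∈ ℬ i, f b ∈ 𝒞 i) (ω : ClosedTwoForm ℬ)
    (η : ClosedTwoForm 𝒞) (h : map f hf ω.val = η.val) : twistedComplex ω ⟶ twistedComplex η where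
  f m := ModuleCat.ofHom (LinearMap.pi fun w =>
    (map f hf).toLinearMap.restrict (p := piece ℬ w m) (q := piece 𝒞 w m)
      (fun _ hx => map_mem f hf hx) ∘ₗ LinearMap.proj w)
  comm' m n hmn := by
    have hmn : m + 1 = n := hmn
    dsimp only [twistedComplex]
    rw [dif_pos hmn, dif_pos hmn]
    ext x : 2
    funext w
    apply Subtype.ext
    match w with
    | 0 => exact (map_zero (map f hf)).symm
    | 1 => exact (map_d f hf _).symm
    | w + 2 =>
      change d 𝒞 (map f hf (x (w + 1))) + η.val * map f hf (x w) =
        map f hf (d ℬ (x (w + 1)) + ω.val * x w)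
      rw [map_add, map_d, map_mul, h]

theorem twistedMap_f_apply (f : B →ₐ[k] C) (hf : ∀ i, ∀ b ∈ ℬ i, f b ∈ 𝒞 i)
    (ω : ClosedTwoForm ℬ) (η : ClosedTwoForm 𝒞) (h : map f hf ω.val = η.val) (m : ℤ)
    (x : (twistedComplex ω).X m) (w : ℕ) :
    (((twistedMap f hf ω η h).f m).hom x w : DR 𝒞) = map f hf (x w) := rfl

theorem twistedMap_id (ω : ClosedTwoForm ℬ) (f : B →ₐ[k] B) (hf : ∀ i, ∀ b ∈ ℬ i, f b ∈ ℬ i)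
    (h : map f hf ω.val = ω.val) (h' : f = AlgHom.id k B) : twistedMap f hf ω ω h = 𝟙 _ := by
  subst h'
  ext m x
  funext w
  exact Subtype.ext (map_id _)

theorem twistedMap_comp (f : B →ₐ[k] C) (hf : ∀ i, ∀ b ∈ ℬ i, f b ∈ 𝒞 i)
    (g : C →ₐ[k] E) (hg : ∀ i, ∀ b ∈ 𝒞 i, g b ∈ ℰ i)
    (e : B →ₐ[k] E) (he : ∀ i, ∀ b ∈ ℬ i, e b ∈ ℰ i)
    (ω : ClosedTwoForm ℬ) (η : ClosedTwoForm 𝒞) (θ : ClosedTwoForm ℰ)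
    (h : map f hf ω.val = η.val) (h' : map g hg η.val = θ.val) (h'' : map e he ω.val = θ.val)
    (hfg : e = g.comp f) :
    twistedMap e he ω θ h'' = twistedMap f hf ω η h ≫ twistedMap g hg η θ h' := by
  subst hfg
  ext m x
  funext w
  exact Subtype.ext (map_map f hf g hg _).symm

end realization
end DR

/-! ### Exterior algebras and semilinear maps -/

section Exterior

variable {k : Type*} [CommRing k] {A A' A'' : Type*} [CommRing A] [Algebra k A] [CommRing A']
  [Algebra k A'] [CommRing A''] [Algebra k A'']
  {M M' M'' : Type*} [AddCommGroup M] [Module k M] [Module A M] [IsScalarTower k A M]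
  [AddCommGroup M'] [Module k M'] [Module A' M'] [IsScalarTower k A' M']
  [AddCommGroup M''] [Module k M''] [Module A'' M''] [IsScalarTower k A'' M'']

theorem exterior_algHom_ext {R : Type*} [Ring R] [Algebra k R] {F G : ExteriorAlgebra A M →ₐ[k] R}
    (h₀ : ∀ a, F (algebraMap A _ a) = G (algebraMap A _ a))
    (h₁ : ∀ m, F (ExteriorAlgebra.ι A m) = G (ExteriorAlgebra.ι A m)) : F = G := by
  ext x
  induction x using ExteriorAlgebra.induction with
  | algebraMap a => exact h₀ a
  | ι m => exact h₁ m
  | mul x y hx hy => rw [map_mul, map_mul, hx, hy]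
  | add x y hx hy => rw [map_add, map_add, hx, hy]

/-- Auxiliary: the ring homomorphism underlying `exteriorMap`. -/
def exteriorRingHom (φ : A →ₐ[k] A') (g : M →ₗ[k] M') (hg : ∀ a m, g (a • m) = φ a • g m) :
    ExteriorAlgebra A M →+* ExteriorAlgebra A' M' :=
  letI : Algebra A (ExteriorAlgebra A' M') :=
    ((algebraMap A' (ExteriorAlgebra A' M')).comp φ.toRingHom).toAlgebra'
      (fun a x => Algebra.commutes (φ a) x)
  (ExteriorAlgebra.lift A ⟨
    { toFun := fun m => ExteriorAlgebra.ι A' (g m)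
      map_add' := fun m n => by rw [map_add, map_add]
      map_smul' := fun a m => by
        rw [hg, map_smul, Algebra.smul_def]; rfl },
    fun m => ExteriorAlgebra.ι_sq_zero _⟩ : ExteriorAlgebra A M →ₐ[A] ExteriorAlgebra A' M').toRingHom

theorem exteriorRingHom_algebraMap (φ : A →ₐ[k] A') (g : M →ₗ[k] M')
    (hg : ∀ a m, g (a • m) = φ a • g m) (a : A) :
    exteriorRingHom φ g hg (algebraMap A _ a) = algebraMap A' _ (φ a) :=
  letI : Algebra A (ExteriorAlgebra A' M') :=
    ((algebraMap A' (ExteriorAlgebra A' M')).comp φ.toRingHom).toAlgebra'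
      (fun a x => Algebra.commutes (φ a) x)
  AlgHom.commutes _ a

/-- A map of modules which is semilinear over `φ : A → A'` induces a map of exterior algebras. -/
def exteriorMap (φ : A →ₐ[k] A') (g : M →ₗ[k] M') (hg : ∀ a m, g (a • m) = φ a • g m) :
    ExteriorAlgebra A M →ₐ[k] ExteriorAlgebra A' M' where
  __ := exteriorRingHom φ g hg
  commutes' r := by
    rw [IsScalarTower.algebraMap_apply k A (ExteriorAlgebra A M),
      IsScalarTower.algebraMap_apply k A' (ExteriorAlgebra A' M')]
    exact (exteriorRingHom_algebraMap φ g hg _).trans (by rw [AlgHom.commutes])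

variable (φ : A →ₐ[k] A') (g : M →ₗ[k] M') (hg : ∀ a m, g (a • m) = φ a • g m)

@[simp] theorem exteriorMap_algebraMap (a : A) :
    exteriorMap φ g hg (algebraMap A _ a) = algebraMap A' _ (φ a) :=
  exteriorRingHom_algebraMap φ g hg a

@[simp] theorem exteriorMap_ι (m : M) :
    exteriorMap φ g hg (ExteriorAlgebra.ι A m) = ExteriorAlgebra.ι A' (g m) :=
  letI : Algebra A (ExteriorAlgebra A' M') :=
    ((algebraMap A' (ExteriorAlgebra A' M')).comp φ.toRingHom).toAlgebra'
      (fun a x => Algebra.commutes (φ a) x)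
  ExteriorAlgebra.lift_ι_apply A _ _ m

theorem exteriorMap_smul (a : A) (x : ExteriorAlgebra A M) :
    exteriorMap φ g hg (a • x) = φ a • exteriorMap φ g hg x := by
  rw [Algebra.smul_def, map_mul, exteriorMap_algebraMap, ← Algebra.smul_def]

theorem exteriorMap_mem {i : ℕ} {x : ExteriorAlgebra A M} (hx : x ∈ ⋀[A]^i M) :
    exteriorMap φ g hg x ∈ ⋀[A']^i M' := by
  induction hx using Submodule.pow_induction_on_left' with
  | algebraMap a => rw [exteriorMap_algebraMap]; exact Submodule.algebraMap_mem (φ a)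
  | add x y i _ _ hx hy => rw [map_add]; exact add_mem hx hy
  | mem_mul m hm i x _ hx =>
    obtain ⟨m, rfl⟩ := hm
    rw [map_mul, exteriorMap_ι]
    change _ ∈ LinearMap.range (ExteriorAlgebra.ι A' : M' →ₗ[A'] _) ^ (i + 1)
    rw [pow_succ']
    exact Submodule.mul_mem_mul (LinearMap.mem_range_self _ _) hx

theorem exteriorMap_comp (ψ : A' →ₐ[k] A'') (h : M' →ₗ[k] M'')
    (hh : ∀ a m, h (a • m) = ψ a • h m) (χ : A →ₐ[k] A'') (e : M →ₗ[k] M'')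
    (he : ∀ a m, e (a • m) = χ a • e m) (h₁ : χ = ψ.comp φ) (h₂ : e = h ∘ₗ g) :
    exteriorMap χ e he = (exteriorMap ψ h hh).comp (exteriorMap φ g hg) := by
  subst h₁ h₂
  apply exterior_algHom_ext <;> intro m <;> simp

theorem exteriorMap_id (φ : A →ₐ[k] A) (g : M →ₗ[k] M) (hg : ∀ a m, g (a • m) = φ a • g m)
    (h₁ : φ = AlgHom.id k A) (h₂ : g = LinearMap.id) : exteriorMap φ g hg = AlgHom.id k _ := by
  subst h₁ h₂
  apply exterior_algHom_ext <;> intro m <;> simp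

variable (k A M) in
/-- The exterior powers as `k`-submodules of the exterior algebra. -/
def exteriorGrading (i : ℕ) : Submodule k (ExteriorAlgebra A M) :=
  (⋀[A]^i M).restrictScalars k

instance : GradedAlgebra (exteriorGrading k A M) where
  one_mem := SetLike.one_mem_graded (fun i : ℕ => ⋀[A]^i M)
  mul_mem _ _ _ _ hx hy := SetLike.mul_mem_graded (A := fun i : ℕ => ⋀[A]^i M) hx hy
  decompose' := DirectSum.Decomposition.decompose' (ℳ := fun i : ℕ => ⋀[A]^i M)
  left_inv := DirectSum.Decomposition.left_inv (ℳ := fun i : ℕ => ⋀[A]^i M)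
  right_inv := DirectSum.Decomposition.right_inv (ℳ := fun i : ℕ => ⋀[A]^i M)

theorem ι_mul_of_mem {j : ℕ} {c : ExteriorAlgebra A M} (hc : c ∈ ⋀[A]^j M) (m : M) :
    ExteriorAlgebra.ι A m * c = (-1 : A) ^ j • (c * ExteriorAlgebra.ι A m) := by
  induction hc using Submodule.pow_induction_on_left' with
  | algebraMap a => simpa using (Algebra.commutes a _).symm
  | add x y i _ _ hx hy => rw [mul_add, hx, hy, add_mul, smul_add]
  | mem_mul n hn i x _ hx =>
    obtain ⟨n, rfl⟩ := hn
    have h := ExteriorAlgebra.ι_add_mul_swap (R := A) m n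
    rw [← mul_assoc, eq_neg_of_add_eq_zero_left h, neg_mul, mul_assoc, hx, mul_smul_comm,
      pow_succ, mul_assoc]
    simp

instance : GradedCommutative (exteriorGrading k A M) where
  comm := by
    intro i j b c hb hc
    replace hb : b ∈ ⋀[A]^i M := hb
    have h : b * c = (-1 : A) ^ (i * j) • (c * b) := by
      induction hb using Submodule.pow_induction_on_left' with
      | algebraMap a => simpa using Algebra.commutes a c
      | add x y i _ _ hx hy => rw [add_mul, hx, hy, mul_add, smul_add]
      | mem_mul m hm i x _ hx =>
        obtain ⟨m, rfl⟩ := hm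
        rw [mul_assoc, hx, mul_smul_comm, ← mul_assoc, ι_mul_of_mem hc, smul_mul_assoc, smul_smul,
          mul_assoc, ← pow_add, Nat.succ_mul]
    rw [h]
    rcases Nat.even_or_odd (i * j) with h2 | h2
    · rw [h2.neg_one_pow, h2.neg_one_pow, one_smul, one_smul]
    · rw [h2.neg_one_pow, h2.neg_one_pow, neg_smul, neg_smul, one_smul, one_smul]

end Exterior

section Const

variable (k : Type*) [CommRing k] (A : Type*) [CommRing A] [Algebra k A]

/-- A commutative algebra as a graded algebra concentrated in degree zero. -/
def constGrading (i : ℕ) : Submodule k A := if i = 0 then ⊤ else ⊥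

theorem mem_constGrading_zero (a : A) : a ∈ constGrading k A 0 := Submodule.mem_top

theorem eq_zero_of_mem_constGrading {i : ℕ} (hi : i ≠ 0) {a : A} (ha : a ∈ constGrading k A i) :
    a = 0 := by
  rwa [constGrading, if_neg hi, Submodule.mem_bot] at ha

instance : GradedAlgebra (constGrading k A) where
  one_mem := mem_constGrading_zero k A 1
  mul_mem i j a b ha hb := by
    rcases eq_or_ne i 0 with rfl | hi
    · rcases eq_or_ne j 0 with rfl | hj
      · exact mem_constGrading_zero k A _
      · rw [eq_zero_of_mem_constGrading k A hj hb, mul_zero]; exact zero_mem _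
    · rw [eq_zero_of_mem_constGrading k A hi ha, zero_mul]; exact zero_mem _
  decompose' a := DirectSum.of (fun i => constGrading k A i) 0 ⟨a, mem_constGrading_zero k A a⟩
  left_inv a := by simp
  right_inv x := by
    induction x using DirectSum.induction_on with
    | zero => exact (DirectSum.of (fun i => constGrading k A i) 0).map_zero
    | of i x =>
      rcases eq_or_ne i 0 with rfl | hi
      · simp
      · obtain ⟨x, hx⟩ := x
        obtain rfl := eq_zero_of_mem_constGrading k A hi hx
        have : (⟨0, hx⟩ : constGrading k A i) = 0 := rfl
        rw [this, map_zero, map_zero]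
        exact (DirectSum.of (fun i => constGrading k A i) 0).map_zero
    | add x y hx hy =>
      rw [map_add]
      conv_rhs => rw [← hx, ← hy, ← map_add]
      rfl

instance : GradedCommutative (constGrading k A) where
  comm := by
    intro i j b c hb hc
    rcases eq_or_ne i 0 with rfl | hi
    · simp [mul_comm]
    · rw [eq_zero_of_mem_constGrading k A hi hb]; simp

end Const

section Etale

variable {k : Type*} [CommRing k] {A A' A'' : Type*} [CommRing A] [Algebra k A] [CommRing A']
  [Algebra k A'] [CommRing A''] [Algebra k A'']

/-- A derivation of `A'` is determined by its restriction along a formally étale map. -/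
theorem derivation_ext (φ : A →ₐ[k] A') (hφ : φ.toRingHom.FormallyEtale) {N : Type*}
    [AddCommGroup N] [Module A' N] [Module k N] [IsScalarTower k A' N] {D₁ D₂ : Derivation k A' N}
    (h : ∀ a, D₁ (φ a) = D₂ (φ a)) : D₁ = D₂ := by
  letI : Algebra A A' := φ.toRingHom.toAlgebra
  haveI : IsScalarTower k A A' := IsScalarTower.of_algHom φ
  haveI : Algebra.FormallyEtale A A' := hφ
  letI : Module A N := Module.compHom N φ.toRingHom
  haveI : IsScalarTower A A' N := ⟨fun a a' n => by
    rw [Algebra.smul_def, mul_smul]; rfl⟩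
  haveI : IsScalarTower k A N := ⟨fun r a n => by
    change φ (r • a) • n = r • φ a • n
    rw [map_smul, smul_assoc]⟩
  have hb := KaehlerDifferential.isBaseChange_of_formallyEtale k A A'
  have h' : D₁.liftKaehlerDifferential = D₂.liftKaehlerDifferential := by
    apply hb.algHom_ext
    intro x
    have : (D₁.liftKaehlerDifferential.restrictScalars A) ∘ₗ KaehlerDifferential.map k k A A' =
        (D₂.liftKaehlerDifferential.restrictScalars A) ∘ₗ KaehlerDifferential.map k k A A' := by
      apply Derivation.liftKaehlerDifferential_unique
      ext a
      change D₁.liftKaehlerDifferential (KaehlerDifferential.map k k A A' (KaehlerDifferential.D k A a)) =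
        D₂.liftKaehlerDifferential (KaehlerDifferential.map k k A A' (KaehlerDifferential.D k A a))
      rw [KaehlerDifferential.map_D, Derivation.liftKaehlerDifferential_comp_D,
        Derivation.liftKaehlerDifferential_comp_D]
      exact h a
    exact LinearMap.congr_fun this x
  rw [← D₁.liftKaehlerDifferential_comp, h', D₂.liftKaehlerDifferential_comp]

theorem exists_derivation (φ : A →ₐ[k] A') (hφ : φ.toRingHom.FormallyEtale)
    (D : Derivation k A A) : ∃ D' : Derivation k A' A', ∀ a, D' (φ a) = φ (D a) := by
  letI : Algebra A A' := φ.toRingHom.toAlgebra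
  haveI : IsScalarTower k A A' := IsScalarTower.of_algHom φ
  haveI : Algebra.FormallyEtale A A' := hφ
  have hb := KaehlerDifferential.isBaseChange_of_formallyEtale k A A'
  refine ⟨(hb.lift (Algebra.linearMap A A' ∘ₗ D.liftKaehlerDifferential)).compDer
    (KaehlerDifferential.D k A'), fun a => ?_⟩
  have := hb.lift_eq (Algebra.linearMap A A' ∘ₗ D.liftKaehlerDifferential)
    (KaehlerDifferential.D k A a)
  rw [KaehlerDifferential.map_D] at this
  exact this.trans (by simp; rfl)

/-- Restriction of vector fields along a formally étale map `A → A'`. -/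
def vectorRes (φ : A →ₐ[k] A') (hφ : φ.toRingHom.FormallyEtale) :
    Derivation k A A →ₗ[k] Derivation k A' A' where
  toFun D := (exists_derivation φ hφ D).choose
  map_add' D E := derivation_ext φ hφ fun a => by
    rw [(exists_derivation φ hφ (D + E)).choose_spec]
    simp [(exists_derivation φ hφ _).choose_spec]
  map_smul' r D := derivation_ext φ hφ fun a => by
    rw [(exists_derivation φ hφ (r • D)).choose_spec]
    simp [(exists_derivation φ hφ _).choose_spec]

@[simp] theorem vectorRes_apply (φ : A →ₐ[k] A') (hφ : φ.toRingHom.FormallyEtale)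
    (D : Derivation k A A) (a : A) : vectorRes φ hφ D (φ a) = φ (D a) :=
  (exists_derivation φ hφ D).choose_spec a

theorem vectorRes_smul (φ : A →ₐ[k] A') (hφ : φ.toRingHom.FormallyEtale) (a : A)
    (D : Derivation k A A) : vectorRes φ hφ (a • D) = φ a • vectorRes φ hφ D :=
  derivation_ext φ hφ fun b => by simp

theorem vectorRes_comp (φ : A →ₐ[k] A') (hφ : φ.toRingHom.FormallyEtale) (ψ : A' →ₐ[k] A'')
    (hψ : ψ.toRingHom.FormallyEtale) (χ : A →ₐ[k] A'') (hχ : χ.toRingHom.FormallyEtale)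
    (h : χ = ψ.comp φ) : vectorRes χ hχ = vectorRes ψ hψ ∘ₗ vectorRes φ hφ := by
  subst h
  ext1 D
  refine derivation_ext _ hχ fun a => ?_
  rw [vectorRes_apply]
  simp

theorem vectorRes_id (φ : A →ₐ[k] A) (hφ : φ.toRingHom.FormallyEtale) (h : φ = AlgHom.id k A) :
    vectorRes φ hφ = LinearMap.id := by
  subst h
  ext1 D
  exact derivation_ext _ hφ fun a => (vectorRes_apply _ hφ D a).trans rfl

/-- Restriction of differential forms along `A → A'`. -/
def formRes (φ : A →ₐ[k] A') : Ω[A⁄k] →ₗ[k] Ω[A'⁄k] :=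
  letI : Algebra A A' := φ.toRingHom.toAlgebra
  haveI : IsScalarTower k A A' := IsScalarTower.of_algHom φ
  (KaehlerDifferential.map k k A A').restrictScalars k

@[simp] theorem formRes_D (φ : A →ₐ[k] A') (a : A) :
    formRes φ (KaehlerDifferential.D k A a) = KaehlerDifferential.D k A' (φ a) :=
  letI : Algebra A A' := φ.toRingHom.toAlgebra
  haveI : IsScalarTower k A A' := IsScalarTower.of_algHom φ
  KaehlerDifferential.map_D k k A A' a

theorem formRes_smul (φ : A →ₐ[k] A') (a : A) (α : Ω[A⁄k]) :
    formRes φ (a • α) = φ a • formRes φ α := by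
  letI : Algebra A A' := φ.toRingHom.toAlgebra
  haveI : IsScalarTower k A A' := IsScalarTower.of_algHom φ
  exact ((KaehlerDifferential.map k k A A').map_smul a α).trans (algebraMap_smul A' a _).symm

theorem form_induction {p : Ω[A⁄k] → Prop} (h₀ : ∀ b, p (KaehlerDifferential.D k A b))
    (h₁ : ∀ x y, p x → p y → p (x + y)) (h₂ : ∀ (a : A) x, p x → p (a • x)) (x : Ω[A⁄k]) : p x := by
  have hx : x ∈ Submodule.span A (Set.range (KaehlerDifferential.D k A)) := by
    rw [KaehlerDifferential.span_range_derivation]; trivial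
  induction hx using Submodule.span_induction with
  | mem x hx => obtain ⟨b, rfl⟩ := hx; exact h₀ b
  | zero => simpa using h₀ 0
  | add x y _ _ hx hy => exact h₁ x y hx hy
  | smul a x _ hx => exact h₂ a x hx

theorem formRes_comp (φ : A →ₐ[k] A') (ψ : A' →ₐ[k] A'') (χ : A →ₐ[k] A'')
    (h : χ = ψ.comp φ) : formRes χ = formRes ψ ∘ₗ formRes φ := by
  subst h
  refine LinearMap.ext fun x => ?_
  rw [LinearMap.comp_apply]
  refine form_induction (p := fun x => formRes (ψ.comp φ) x = formRes ψ (formRes φ x))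
    (fun b => ?_) (fun x y hx hy => ?_) (fun a x hx => ?_) x
  · rw [formRes_D, formRes_D, formRes_D, AlgHom.comp_apply]
  · rw [map_add, hx, hy, map_add, map_add]
  · rw [formRes_smul _ a x, hx, formRes_smul φ a x, formRes_smul ψ, AlgHom.comp_apply]

theorem formRes_id (φ : A →ₐ[k] A) (h : φ = AlgHom.id k A) : formRes φ = LinearMap.id := by
  subst h
  refine LinearMap.ext fun x => ?_
  rw [LinearMap.id_apply]
  refine form_induction (p := fun x => formRes (AlgHom.id k A) x = x)
    (fun b => ?_) (fun x y hx hy => ?_) (fun a x hx => ?_) x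
  · rw [formRes_D, AlgHom.id_apply]
  · rw [map_add, hx, hy]
  · rw [formRes_smul _ a x, hx, AlgHom.id_apply]

theorem derivation_sum_apply {N : Type*} [AddCommGroup N] [Module A N] [Module k N] {ι : Type*}
    (s : Finset ι) (D : ι → Derivation k A N) (a : A) : (∑ j ∈ s, D j) a = ∑ j ∈ s, D j a := by
  rw [← Derivation.coeFnAddMonoidHom_apply, map_sum, Finset.sum_apply]
  rfl

end Etale

/-! ### The shifted cotangent bundle -/

section Cotangent

variable (k : Type*) [CommRing k] (A : Type*) [CommRing A] [Algebra k A]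

/-- Functions on `T^*[-1] (Spec A)`: the algebra `Sym_A (T_A[1])` of polyvector fields. -/
abbrev Polyvector : Type _ := ExteriorAlgebra A (Derivation k A A)

/-- Polyvector fields of exterior degree `i` have cohomological degree `-i`. -/
abbrev polyGrading : ℕ → Submodule k (Polyvector k A) := exteriorGrading k A (Derivation k A A)

/-- A finite family of functions `x j` and vector fields `D j` such that
`d f = ∑ j, D j f • d (x j)` for all functions `f`; equivalently `∑ j, D j ⊗ d (x j)` is the
canonical element of `T_A ⊗ Ω_A`. -/
structure Frame where
  r : ℕ
  x : Fin r → A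
  D : Fin r → Derivation k A A
  spec : ∀ f : A, KaehlerDifferential.D k A f = ∑ j, D j f • KaehlerDifferential.D k A (x j)

theorem Frame.nonempty [Algebra.Smooth k A] : Nonempty (Frame k A) := by
  have hfg : (Submodule.span A (Set.range (KaehlerDifferential.D k A))).FG := by
    rw [KaehlerDifferential.span_range_derivation]
    exact Module.Finite.fg_top
  obtain ⟨S, hS, hspan⟩ := (Submodule.fg_span_iff_fg_span_finset_subset _).1 hfg
  rw [KaehlerDifferential.span_range_derivation] at hspan
  have hx : ∀ s : S, ∃ a, KaehlerDifferential.D k A a = s := fun s => hS s.2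
  choose x hx using hx
  let e := S.equivFin
  let p : (Fin S.card → A) →ₗ[A] Ω[A⁄k] :=
    Fintype.linearCombination A (fun j => KaehlerDifferential.D k A (x (e.symm j)))
  have hp : Function.Surjective p := by
    rw [← LinearMap.range_eq_top, Fintype.range_linearCombination, eq_top_iff, hspan]
    apply Submodule.span_mono
    intro s hs
    exact ⟨e ⟨s, hs⟩, by simp [hx]⟩
  obtain ⟨q, hq⟩ := Module.projective_lifting_property p LinearMap.id hp
  refine ⟨⟨S.card, fun j => x (e.symm j),
    fun j => (LinearMap.proj j ∘ₗ q).compDer (KaehlerDifferential.D k A), fun f => ?_⟩⟩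
  have := LinearMap.congr_fun hq (KaehlerDifferential.D k A f)
  rw [LinearMap.comp_apply, LinearMap.id_apply] at this
  exact this.symm

variable {k A}

/-- The Liouville one-form `∑ j, p_j d x_j`. -/
def Frame.liouville (F : Frame k A) : DR (polyGrading k A) :=
  ∑ j, DR.ofFun _ (ExteriorAlgebra.ι A (F.D j)) * DR.dFun _ (algebraMap A _ (F.x j))

theorem algebraMap_mem (a : A) : algebraMap A (Polyvector k A) a ∈ polyGrading k A 0 :=
  Submodule.algebraMap_mem a

theorem ι_mem (D : Derivation k A A) : ExteriorAlgebra.ι A D ∈ polyGrading k A 1 := by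
  change _ ∈ LinearMap.range (ExteriorAlgebra.ι A : Derivation k A A →ₗ[A] _) ^ 1
  rw [pow_one]
  exact LinearMap.mem_range_self _ _

theorem Frame.dFun_eq (F : Frame k A) (f : A) :
    DR.dFun (polyGrading k A) (algebraMap A _ f) =
      ∑ j, DR.ofFun _ (algebraMap A _ (F.D j f)) * DR.dFun _ (algebraMap A _ (F.x j)) := by
  let θ : A →ₐ[k] DR (polyGrading k A) :=
    (DR.ofFun _).comp (IsScalarTower.toAlgHom k A (Polyvector k A))
  letI : Module A (DR (polyGrading k A)) := Module.compHom _ θ.toRingHom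
  have hsmul : ∀ (a : A) (x : DR (polyGrading k A)), a • x = θ a * x := fun _ _ => rfl
  haveI : IsScalarTower k A (DR (polyGrading k A)) := ⟨fun r a x => by
    rw [hsmul, hsmul, map_smul, smul_mul_assoc]⟩
  let δ : Derivation k A (DR (polyGrading k A)) := Derivation.mk'
    (DR.dFun (polyGrading k A) ∘ₗ (IsScalarTower.toAlgHom k A (Polyvector k A)).toLinearMap)
    (fun a b => by
      have h1 := DR.dFun_mul (algebraMap_mem (k := k) a) (algebraMap A (Polyvector k A) b)
      have h2 := DR.dFun_mul_ofFun (algebraMap_mem (k := k) a) (algebraMap_mem (k := k) b)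
      rw [← map_mul, h2] at h1
      simp only [mul_zero, pow_zero, one_smul] at h1
      rw [hsmul, hsmul, add_comm]
      exact h1)
  have h := congrArg δ.liftKaehlerDifferential (F.spec f)
  rw [map_sum] at h
  simp only [map_smul, Derivation.liftKaehlerDifferential_comp_D] at h
  exact h

theorem Frame.liouville_eq (F G : Frame k A) : F.liouville = G.liouville := by
  have key : ∀ l, ∑ j, (G.D l (F.x j)) • F.D j = G.D l := fun l => by
    ext f
    have h := congrArg (G.D l).liftKaehlerDifferential (F.spec f)
    simp only [map_sum, map_smul, Derivation.liftKaehlerDifferential_comp_D, smul_eq_mul] at h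
    rw [h, derivation_sum_apply]
    exact Finset.sum_congr rfl fun j _ => by simp [mul_comm]
  unfold Frame.liouville
  simp_rw [G.dFun_eq (F.x _), Finset.mul_sum]
  rw [Finset.sum_comm]
  refine Finset.sum_congr rfl fun l _ => ?_
  have h : ExteriorAlgebra.ι A (G.D l) =
      ∑ j, ExteriorAlgebra.ι A (F.D j) * algebraMap A (Polyvector k A) (G.D l (F.x j)) := by
    conv_lhs => rw [← key l, map_sum]
    refine Finset.sum_congr rfl fun j _ => ?_
    rw [map_smul, Algebra.smul_def, Algebra.commutes]
  rw [h, map_sum, Finset.sum_mul]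
  refine Finset.sum_congr rfl fun j _ => ?_
  rw [← mul_assoc, ← map_mul]

theorem Frame.liouville_mem (F : Frame k A) : F.liouville ∈ DR.piece (polyGrading k A) 1 0 :=
  Submodule.sum_mem _ fun j _ => by
    have h := DR.mul_dFun_mem (DR.ofFun_mem (ι_mem (F.D j))) (algebraMap_mem (k := k) (F.x j))
    norm_num at h
    exact h

variable {A' A'' : Type*} [CommRing A'] [Algebra k A'] [CommRing A''] [Algebra k A'']

/-- Restriction of frames. -/
def Frame.res (F : Frame k A) (φ : A →ₐ[k] A') (hφ : φ.toRingHom.FormallyEtale) : Frame k A' where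
  r := F.r
  x j := φ (F.x j)
  D j := vectorRes φ hφ (F.D j)
  spec f := by
    let E : Derivation k A' Ω[A'⁄k] := ∑ j, (LinearMap.toSpanSingleton A' Ω[A'⁄k]
      (KaehlerDifferential.D k A' (φ (F.x j)))).compDer (vectorRes φ hφ (F.D j))
    have h : KaehlerDifferential.D k A' = E := derivation_ext φ hφ fun a => by
      rw [← formRes_D, F.spec a, map_sum, derivation_sum_apply]
      exact Finset.sum_congr rfl fun j _ => by simp [formRes_smul]
    conv_lhs => rw [h, derivation_sum_apply]
    exact Finset.sum_congr rfl fun j _ => by simp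

/-- Restriction of polyvector fields. -/
def polyRes (φ : A →ₐ[k] A') (hφ : φ.toRingHom.FormallyEtale) :
    Polyvector k A →ₐ[k] Polyvector k A' :=
  exteriorMap φ (vectorRes φ hφ) (vectorRes_smul φ hφ)

theorem polyRes_mem (φ : A →ₐ[k] A') (hφ : φ.toRingHom.FormallyEtale) (i : ℕ)
    (b : Polyvector k A) (hb : b ∈ polyGrading k A i) : polyRes φ hφ b ∈ polyGrading k A' i :=
  exteriorMap_mem _ _ _ hb

theorem Frame.map_liouville (F : Frame k A) (φ : A →ₐ[k] A') (hφ : φ.toRingHom.FormallyEtale) :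
    DR.map (polyRes φ hφ) (polyRes_mem φ hφ) F.liouville = (F.res φ hφ).liouville := by
  unfold Frame.liouville
  rw [map_sum]
  refine Finset.sum_congr rfl fun j _ => ?_
  rw [map_mul, DR.map_ofFun, DR.map_dFun, polyRes, exteriorMap_ι, exteriorMap_algebraMap]
  rfl

end Cotangent

section Standard

variable (k : Type u) [Field k] [CharZero k] (A : Type u) [CommRing A] [Algebra k A]
  [Algebra.Smooth k A]

/-- The standard `(-1)`-shifted symplectic structure on `T^*[-1] (Spec A)`: the de Rham
differential of the Liouville one-form. It does not depend on the choice of a frame, see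
`stdForm_eq`, and in coordinates it is `∑ i, d p_i * d x_i`. -/
def stdForm : DR.ClosedTwoForm (polyGrading k A) where
  val := DR.d _ (Frame.nonempty k A).some.liouville
  mem := by
    have h := DR.d_mem (Frame.nonempty k A).some.liouville_mem
    norm_num only at h
    exact h
  closed := DR.d_d _

variable {k A}

theorem stdForm_eq (F : Frame k A) : (stdForm k A).val =
    ∑ j, DR.dFun _ (ExteriorAlgebra.ι A (F.D j)) * DR.dFun _ (algebraMap A _ (F.x j)) := by
  change DR.d _ (Frame.nonempty k A).some.liouville = _
  rw [Frame.liouville_eq _ F, Frame.liouville, map_sum]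
  refine Finset.sum_congr rfl fun j _ => ?_
  rw [DR.d_mul, DR.d_ofFun, DR.d_dFun, mul_zero, add_zero]

theorem map_stdForm {A' : Type u} [CommRing A'] [Algebra k A'] [Algebra.Smooth k A']
    (φ : A →ₐ[k] A') (hφ : φ.toRingHom.FormallyEtale) :
    DR.map (polyRes φ hφ) (polyRes_mem φ hφ) (stdForm k A).val = (stdForm k A').val := by
  change DR.map _ _ (DR.d _ (Frame.nonempty k A).some.liouville) =
    DR.d _ (Frame.nonempty k A').some.liouville
  rw [DR.map_d, Frame.map_liouville, Frame.liouville_eq]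

end Standard

/-! ### The canonical bundle and the BV Laplacian -/

section Density

variable (k : Type*) [CommRing k] (A : Type*) [CommRing A] [Algebra k A] (n : ℕ)

/-- Sections of `π^* K` over `T^*[-1] (Spec A)`, for `Spec A` of dimension `n`. -/
abbrev Density : Type _ := Polyvector k A ⊗[A] ⋀[A]^n Ω[A⁄k]

/-- The component of degree `m` of `Γ(T^*[-1] (Spec A), π^* K) [-n]`: a polyvector field of
exterior degree `j` has degree `-j`, and top forms are put in degree `n`. -/
def densityPiece (m : ℤ) : Submodule k (Density k A n) :=
  Submodule.span k {z | ∃ (j : ℕ) (P : Polyvector k A) (μ : ⋀[A]^n Ω[A⁄k]),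
    P ∈ ⋀[A]^j (Derivation k A A) ∧ (n : ℤ) - j = m ∧ z = P ⊗ₜ[A] μ}

/-- Étale coordinates `x 0, ..., x (n - 1)` on `Spec A`, with the dual vector fields `∂ / ∂ x i`
(equivalently, the `d (x i)` form a basis of `Ω_A`). The vector field `del i` is also the fibre
coordinate `p_i` dual to `x i` on `T^*[-1] (Spec A)`. -/
structure EtaleCoordinates where
  x : Fin n → A
  del : Fin n → Derivation k A A
  del_x : ∀ i j, del i (x j) = if i = j then 1 else 0
  spec : ∀ f : A, KaehlerDifferential.D k A f = ∑ i, del i f • KaehlerDifferential.D k A (x i)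

variable {k A n}

/-- Contraction of polyvector fields with `d f`. For `f = x i` this is the odd derivative
`∂ / ∂ p_i`. -/
def contract (f : A) : Polyvector k A →ₗ[A] Polyvector k A :=
  CliffordAlgebra.contractLeft
    { toFun := fun D : Derivation k A A => D f
      map_add' := fun _ _ => rfl
      map_smul' := fun _ _ => rfl }

/-- `d x_1 ∧ ... ∧ d x_n` -/
def EtaleCoordinates.vol (c : EtaleCoordinates k A n) : ⋀[A]^n Ω[A⁄k] :=
  exteriorPower.ιMulti A n fun i => KaehlerDifferential.D k A (c.x i)

/-- `p_{I 0} ... p_{I (j-1)}`. -/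
def EtaleCoordinates.monomial (c : EtaleCoordinates k A n) {j : ℕ} (I : Fin j → Fin n) :
    Polyvector k A :=
  ExteriorAlgebra.ιMulti A j fun a => c.del (I a)

/-- The formula `Δ (g vol) = ∑ i, (∂² g / ∂ p_i ∂ x_i) vol` for the BV Laplacian, in all étale
coordinates, where `g` runs through the functions `a(x) p_{I 0} ... p_{I (j-1)}`, which span all
functions on `T^*[-1] (Spec A)`. -/
def IsBVLaplacian (Δ : Density k A n →ₗ[k] Density k A n) : Prop :=
  ∀ (c : EtaleCoordinates k A n) (a : A) (j : ℕ) (I : Fin j → Fin n),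
    Δ ((a • c.monomial I) ⊗ₜ[A] c.vol) =
      ∑ i, (c.del i a • contract (c.x i) (c.monomial I)) ⊗ₜ[A] c.vol

variable {A' A'' : Type*} [CommRing A'] [Algebra k A'] [CommRing A''] [Algebra k A'']

/-- Restriction of differential forms of degree `n`. -/
def topRes (φ : A →ₐ[k] A') : ⋀[A]^n Ω[A⁄k] →ₗ[k] ⋀[A']^n Ω[A'⁄k] :=
  (exteriorMap φ (formRes φ) (formRes_smul φ)).toLinearMap.restrict
    (p := (⋀[A]^n Ω[A⁄k]).restrictScalars k) (q := (⋀[A']^n Ω[A'⁄k]).restrictScalars k)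
    (fun _ hx => exteriorMap_mem φ (formRes φ) (formRes_smul φ) hx)

theorem topRes_smul (φ : A →ₐ[k] A') (a : A) (μ : ⋀[A]^n Ω[A⁄k]) :
    topRes φ (a • μ) = φ a • topRes φ μ :=
  Subtype.ext (exteriorMap_smul φ (formRes φ) (formRes_smul φ) a μ)

/-- Auxiliary: the additive map underlying `densityRes`. -/
def densityResAux (φ : A →ₐ[k] A') (hφ : φ.toRingHom.FormallyEtale) :
    Density k A n →+ Density k A' n :=
  TensorProduct.liftAddHom
    { toFun := fun P =>
        { toFun := fun μ => polyRes φ hφ P ⊗ₜ[A'] topRes φ μ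
          map_zero' := by rw [map_zero, tmul_zero]
          map_add' := fun μ ν => by rw [map_add, tmul_add] }
      map_zero' := by ext μ; change polyRes φ hφ 0 ⊗ₜ[A'] topRes φ μ = 0; rw [map_zero, zero_tmul]
      map_add' := fun P Q => by
        ext μ
        change polyRes φ hφ (P + Q) ⊗ₜ[A'] topRes φ μ = polyRes φ hφ P ⊗ₜ[A'] topRes φ μ +
          polyRes φ hφ Q ⊗ₜ[A'] topRes φ μ
        rw [map_add, add_tmul] }
    (fun a P μ => by
      change polyRes φ hφ (a • P) ⊗ₜ[A'] topRes φ μ = polyRes φ hφ P ⊗ₜ[A'] topRes φ (a • μ)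
      rw [topRes_smul, polyRes, exteriorMap_smul, smul_tmul])

/-- Restriction of sections of `π^* K`. -/
def densityRes (φ : A →ₐ[k] A') (hφ : φ.toRingHom.FormallyEtale) :
    Density k A n →ₗ[k] Density k A' n where
  __ := densityResAux φ hφ
  map_smul' r x := by
    change densityResAux φ hφ (r • x) = r • densityResAux φ hφ x
    induction x using TensorProduct.induction_on with
    | zero => simp
    | add x y hx hy => rw [smul_add, map_add, hx, hy, map_add, smul_add]
    | tmul P μ =>
      rw [smul_tmul']
      change polyRes φ hφ (r • P) ⊗ₜ[A'] topRes φ μ = r • polyRes φ hφ P ⊗ₜ[A'] topRes φ μ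
      rw [map_smul, smul_tmul']

@[simp] theorem densityRes_tmul (φ : A →ₐ[k] A') (hφ : φ.toRingHom.FormallyEtale)
    (P : Polyvector k A) (μ : ⋀[A]^n Ω[A⁄k]) :
    densityRes φ hφ (P ⊗ₜ[A] μ) = polyRes φ hφ P ⊗ₜ[A'] topRes φ μ := rfl

theorem densityRes_mem (φ : A →ₐ[k] A') (hφ : φ.toRingHom.FormallyEtale) {m : ℤ}
    {z : Density k A n} (hz : z ∈ densityPiece k A n m) :
    densityRes φ hφ z ∈ densityPiece k A' n m := by
  induction hz using Submodule.span_induction with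
  | mem z hz =>
    obtain ⟨j, P, μ, hP, hj, rfl⟩ := hz
    exact Submodule.subset_span ⟨j, _, _, polyRes_mem φ hφ j P hP, hj, densityRes_tmul φ hφ P μ⟩
  | zero => simp
  | add x y _ _ hx hy => rw [map_add]; exact add_mem hx hy
  | smul r x _ hx => rw [map_smul]; exact Submodule.smul_mem _ _ hx

theorem densityRes_id (φ : A →ₐ[k] A) (hφ : φ.toRingHom.FormallyEtale) (h : φ = AlgHom.id k A)
    (z : Density k A n) : densityRes φ hφ z = z := by
  induction z using TensorProduct.induction_on with
  | zero => simp
  | add x y hx hy => rw [map_add, hx, hy]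
  | tmul P μ =>
    rw [densityRes_tmul, polyRes, exteriorMap_id _ _ _ h (vectorRes_id φ hφ h)]
    congr 1
    apply Subtype.ext
    change exteriorMap φ (formRes φ) (formRes_smul φ) _ = _
    rw [exteriorMap_id _ _ _ h (formRes_id φ h)]
    rfl

theorem densityRes_comp (φ : A →ₐ[k] A') (hφ : φ.toRingHom.FormallyEtale) (ψ : A' →ₐ[k] A'')
    (hψ : ψ.toRingHom.FormallyEtale) (χ : A →ₐ[k] A'') (hχ : χ.toRingHom.FormallyEtale)
    (h : χ = ψ.comp φ) (z : Density k A n) :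
    densityRes χ hχ z = densityRes ψ hψ (densityRes φ hφ z) := by
  induction z using TensorProduct.induction_on with
  | zero => simp
  | add x y hx hy => rw [map_add, hx, hy, map_add, map_add]
  | tmul P μ =>
    rw [densityRes_tmul, densityRes_tmul, densityRes_tmul, polyRes, polyRes, polyRes,
      exteriorMap_comp φ _ (vectorRes_smul φ hφ) ψ _ (vectorRes_smul ψ hψ) χ _
      (vectorRes_smul χ hχ) h (vectorRes_comp φ hφ ψ hψ χ hχ h)]
    congr 1
    apply Subtype.ext
    change exteriorMap χ (formRes χ) (formRes_smul χ) _ = _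
    rw [exteriorMap_comp φ _ (formRes_smul φ) ψ _ (formRes_smul ψ) χ _
      (formRes_smul χ) h (formRes_comp φ ψ χ h)]
    rfl

/-- Restriction of densities of degree `m`. -/
def densityResPiece (φ : A →ₐ[k] A') (hφ : φ.toRingHom.FormallyEtale) (m : ℤ) :
    densityPiece k A n m →ₗ[k] densityPiece k A' n m :=
  (densityRes φ hφ).restrict fun _ hz => densityRes_mem φ hφ hz

theorem densityResPiece_id (φ : A →ₐ[k] A) (hφ : φ.toRingHom.FormallyEtale)
    (h : φ = AlgHom.id k A) (m : ℤ) :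
    densityResPiece (n := n) φ hφ m = LinearMap.id :=
  LinearMap.ext fun z => Subtype.ext (densityRes_id φ hφ h z.1)

theorem densityResPiece_comp (φ : A →ₐ[k] A') (hφ : φ.toRingHom.FormallyEtale) (ψ : A' →ₐ[k] A'')
    (hψ : ψ.toRingHom.FormallyEtale) (χ : A →ₐ[k] A'') (hχ : χ.toRingHom.FormallyEtale)
    (h : χ = ψ.comp φ) (m : ℤ) :
    densityResPiece (n := n) χ hχ m = densityResPiece ψ hψ m ∘ₗ densityResPiece φ hφ m :=
  LinearMap.ext fun z => Subtype.ext (densityRes_comp φ hφ ψ hψ χ hχ h z.1)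

end Density

section Total

variable {k : Type u} [Field k]

/-- Elements of total degree `m` of a double complex, with direct products: families
`x p q` of elements of bidegree `(p, q)`, for all `p + q = m`. -/
abbrev TotalDegree (E : CochainComplex (CochainComplex (ModuleCat.{u} k) ℕ) ℤ) (m : ℤ) : Type u :=
  ∀ i : {i : ℕ × ℤ // (i.1 : ℤ) + i.2 = m}, (E.X i.1.2).X i.1.1

/-- The component of bidegree `(p, q)`. -/
def totalProj (E : CochainComplex (CochainComplex (ModuleCat.{u} k) ℕ) ℤ) {m : ℤ} (p : ℕ) (q : ℤ)
    (h : (p : ℤ) + q = m) : TotalDegree E m →ₗ[k] (E.X q).X p :=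
  LinearMap.proj (φ := fun i : {i : ℕ × ℤ // (i.1 : ℤ) + i.2 = m} => (E.X i.1.2).X i.1.1)
    ⟨(p, q), h⟩

/-- The total differential `(D x) p q = (-1)^p d (x p (q - 1)) + δ (x (p - 1) q)`, where `d` and
`δ` are the differentials of the double complex in the second and in the first direction. -/
def totalD (E : CochainComplex (CochainComplex (ModuleCat.{u} k) ℕ) ℤ) {m m' : ℤ}
    (h : m + 1 = m') : TotalDegree E m →ₗ[k] TotalDegree E m' :=
  LinearMap.pi fun
    | ⟨(0, q), hpq⟩ => ((E.d (q - 1) q).f 0).hom ∘ₗ totalProj E 0 (q - 1) (by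
        dsimp only at hpq ⊢; omega)
    | ⟨(p + 1, q), hpq⟩ =>
        (-1 : k) ^ (p + 1) • (((E.d (q - 1) q).f (p + 1)).hom ∘ₗ
          totalProj E (p + 1) (q - 1) (by dsimp only at hpq ⊢; omega)) +
        ((E.X q).d p (p + 1)).hom ∘ₗ totalProj E p q (by
          dsimp only at hpq ⊢; push_cast at hpq; omega)

theorem totalD_zero (E : CochainComplex (CochainComplex (ModuleCat.{u} k) ℕ) ℤ) {m m' : ℤ}
    (h : m + 1 = m') (x : TotalDegree E m) (q : ℤ) (hpq : ((0 : ℕ) : ℤ) + q = m') :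
    totalD E h x ⟨(0, q), hpq⟩ =
      ((E.d (q - 1) q).f 0).hom (x ⟨(0, q - 1), by dsimp only; omega⟩) := rfl

theorem totalD_succ (E : CochainComplex (CochainComplex (ModuleCat.{u} k) ℕ) ℤ) {m m' : ℤ}
    (h : m + 1 = m') (x : TotalDegree E m) (p : ℕ) (q : ℤ) (hpq : ((p + 1 : ℕ) : ℤ) + q = m') :
    totalD E h x ⟨(p + 1, q), hpq⟩ =
      (-1 : k) ^ (p + 1) • ((E.d (q - 1) q).f (p + 1)).hom
        (x ⟨(p + 1, q - 1), by dsimp only; omega⟩) +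
        ((E.X q).d p (p + 1)).hom (x ⟨(p, q), by dsimp only; push_cast at hpq; omega⟩) := rfl

theorem bicomplex_d_d (E : CochainComplex (CochainComplex (ModuleCat.{u} k) ℕ) ℤ) (a b c : ℤ)
    (p : ℕ) (x : (E.X a).X p) : ((E.d b c).f p).hom (((E.d a b).f p).hom x) = 0 := by
  have h := congrArg (fun f => (f.f p).hom x) (E.d_comp_d a b c)
  exact h

theorem bicomplex_comm (E : CochainComplex (CochainComplex (ModuleCat.{u} k) ℕ) ℤ) (a b : ℤ)
    (p p' : ℕ) (x : (E.X a).X p) : ((E.X b).d p p').hom (((E.d a b).f p).hom x) =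
      ((E.d a b).f p').hom (((E.X a).d p p').hom x) := by
  have h := congrArg (fun f => f.hom x) ((E.d a b).comm p p')
  exact h

theorem bicomplex_δ_δ (E : CochainComplex (CochainComplex (ModuleCat.{u} k) ℕ) ℤ) (a : ℤ)
    (p p' p'' : ℕ) (x : (E.X a).X p) :
    ((E.X a).d p' p'').hom (((E.X a).d p p').hom x) = 0 := by
  have h := congrArg (fun f => f.hom x) ((E.X a).d_comp_d p p' p'')
  exact h

theorem totalD_totalD (E : CochainComplex (CochainComplex (ModuleCat.{u} k) ℕ) ℤ) {l m n : ℤ}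
    (h : l + 1 = m) (h' : m + 1 = n) (x : TotalDegree E l) :
    totalD E h' (totalD E h x) = 0 := by
  funext ⟨⟨p, q⟩, hpq⟩
  match p, hpq with
  | 0, hpq =>
    rw [totalD_zero, totalD_zero, bicomplex_d_d]; rfl
  | 1, hpq =>
    rw [totalD_succ E h' _ 0, totalD_succ E h _ 0, totalD_zero, map_add, map_smul, bicomplex_d_d,
      bicomplex_comm]
    simp
  | p + 2, hpq =>
    rw [totalD_succ E h' _ (p + 1), totalD_succ E h _ (p + 1), totalD_succ E h _ p, map_add,
      map_smul, map_add, map_smul, bicomplex_d_d, bicomplex_comm, bicomplex_δ_δ]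
    simp [pow_succ]

/-- The total complex of a double complex, formed with direct products. -/
def total (E : CochainComplex (CochainComplex (ModuleCat.{u} k) ℕ) ℤ) :
    CochainComplex (ModuleCat.{u} k) ℤ where
  X m := ModuleCat.of k (TotalDegree E m)
  d m m' := if h : m + 1 = m' then ModuleCat.ofHom (totalD E h) else 0
  shape m m' h := dif_neg h
  d_comp_d' l m n h h' := by
    have h : l + 1 = m := h
    have h' : m + 1 = n := h'
    rw [dif_pos h, dif_pos h']
    ext x : 2
    exact totalD_totalD E h h' x

/-- Functoriality of `total`. -/
def totalMap {E E' : CochainComplex (CochainComplex (ModuleCat.{u} k) ℕ) ℤ} (φ : E ⟶ E') :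
    total E ⟶ total E' where
  f m := ModuleCat.ofHom (LinearMap.pi fun i => ((φ.f i.1.2).f i.1.1).hom ∘ₗ LinearMap.proj i)
  comm' m n hmn := by
    have hmn : m + 1 = n := hmn
    dsimp only [total]
    rw [dif_pos hmn, dif_pos hmn]
    ext x : 2
    funext ⟨⟨p, q⟩, hpq⟩
    have h₁ : ∀ (a b : ℤ) (p : ℕ) (x : (E.X a).X p), ((E'.d a b).f p).hom (((φ.f a).f p).hom x) =
        ((φ.f b).f p).hom (((E.d a b).f p).hom x) := fun a b p x =>
      congrArg (fun f => (f.f p).hom x) (φ.comm a b)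
    have h₂ : ∀ (a : ℤ) (p p' : ℕ) (x : (E.X a).X p),
        ((E'.X a).d p p').hom (((φ.f a).f p).hom x) =
        ((φ.f a).f p').hom (((E.X a).d p p').hom x) := fun a p p' x =>
      congrArg (fun f => f.hom x) ((φ.f a).comm p p')
    match p, hpq with
    | 0, hpq =>
      refine (totalD_zero E' hmn _ q hpq).trans
        (Eq.trans ?_ (congrArg ((φ.f q).f 0).hom (totalD_zero E hmn x q hpq)).symm)
      exact h₁ _ _ _ _
    | p + 1, hpq =>
      refine (totalD_succ E' hmn _ p q hpq).trans
        (Eq.trans ?_ (congrArg ((φ.f q).f (p + 1)).hom (totalD_succ E hmn x p q hpq)).symm)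
      rw [map_add, map_smul]
      exact congrArg₂ (fun a b => (-1 : k) ^ (p + 1) • a + b) (h₁ _ _ _ _) (h₂ _ _ _ _)

end Total

section DerivedSections

variable {k : Type u} [Field k] {P : Type u} [PartialOrder P]

/-- The cosimplicial replacement of a presheaf `G` on a partially ordered set: in degree `p`,
families of elements of `G (σ 0)` indexed by the chains `σ 0 ≤ ... ≤ σ p`. -/
def cosimplicialCochains (G : Pᵒᵖ ⥤ ModuleCat.{u} k) : CosimplicialObject (ModuleCat.{u} k) where
  obj I := ModuleCat.of k (∀ σ : Fin (I.len + 1) →o P, G.obj (op (σ 0)))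
  map θ := ModuleCat.ofHom
    { toFun := fun x σ => (G.map (homOfLE (σ.monotone (Fin.zero_le (θ.toOrderHom 0)))).op).hom
        (x (σ.comp θ.toOrderHom))
      map_add' := fun x y => by funext σ; exact map_add _ _ _
      map_smul' := fun r x => by funext σ; exact map_smul _ _ _ }
  map_id I := by
    ext x : 2
    funext σ
    exact congrArg (fun f => f.hom (x σ)) (G.map_id (op (σ 0)))
  map_comp {I J K} θ η := by
    ext x : 2
    funext σ
    exact congrArg (fun f => f.hom (x (σ.comp (θ ≫ η).toOrderHom)))
      (G.map_comp (homOfLE ((σ.comp η.toOrderHom).monotone (Fin.zero_le (θ.toOrderHom 0)))).op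
        (homOfLE (σ.monotone (Fin.zero_le (η.toOrderHom 0)))).op)

/-- Functoriality of `cosimplicialCochains`. -/
def cosimplicialCochainsMap {G G' : Pᵒᵖ ⥤ ModuleCat.{u} k} (α : G ⟶ G') :
    cosimplicialCochains G ⟶ cosimplicialCochains G' where
  app I := ModuleCat.ofHom (LinearMap.pi fun σ => (α.app (op (σ 0))).hom ∘ₗ LinearMap.proj σ)
  naturality I J θ := by
    ext x : 2
    funext σ
    exact congrArg (fun f => f.hom (x (σ.comp θ.toOrderHom))) (α.naturality
      (homOfLE (σ.monotone (Fin.zero_le (θ.toOrderHom 0)))).op)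

variable (k P) in
/-- The complex of cochains with values in a presheaf `G`: in degree `p` families of elements of
`G (σ 0)` indexed by chains `σ 0 ≤ ... ≤ σ p`, with the alternating sum of the coface maps. -/
def cochains : (Pᵒᵖ ⥤ ModuleCat.{u} k) ⥤ CochainComplex (ModuleCat.{u} k) ℕ where
  obj G := (AlgebraicTopology.alternatingCofaceMapComplex _).obj (cosimplicialCochains G)
  map α := (AlgebraicTopology.alternatingCofaceMapComplex _).map (cosimplicialCochainsMap α)
  map_id G := (AlgebraicTopology.alternatingCofaceMapComplex _).map_id (cosimplicialCochains G)
  map_comp α β := (AlgebraicTopology.alternatingCofaceMapComplex _).map_comp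
    (cosimplicialCochainsMap α) (cosimplicialCochainsMap β)

theorem cochains_ext {G : CochainComplex (ModuleCat.{u} k) ℕ} {G' : Pᵒᵖ ⥤ ModuleCat.{u} k}
    {f g : G ⟶ (cochains k P).obj G'}
    (h : ∀ (p : ℕ) (x : G.X p) (σ : Fin (p + 1) →o P),
      ((f.f p).hom x : ∀ σ : Fin (p + 1) →o P, G'.obj (op (σ 0))) σ =
      ((g.f p).hom x : ∀ σ : Fin (p + 1) →o P, G'.obj (op (σ 0))) σ) : f = g := by
  ext p x
  exact funext (h p x)

/-- The double complex of cochains with values in a presheaf of complexes. -/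
def cochainBicomplex (F : Pᵒᵖ ⥤ CochainComplex (ModuleCat.{u} k) ℤ) :
    CochainComplex (CochainComplex (ModuleCat.{u} k) ℕ) ℤ where
  X q := (cochains k P).obj (F ⋙ HomologicalComplex.eval _ _ q)
  d q q' := (cochains k P).map (Functor.whiskerLeft F
    { app := fun K => K.d q q', naturality := fun _ _ f => f.comm q q' })
  shape q q' h := cochains_ext fun _ x σ =>
    congrArg (fun f => f.hom (x σ)) ((F.obj (op (σ 0))).shape q q' h)
  d_comp_d' a b c _ _ := cochains_ext fun _ x σ =>
    congrArg (fun f => f.hom (x σ)) ((F.obj (op (σ 0))).d_comp_d a b c)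

variable (k P) in
/-- Derived global sections of a presheaf of complexes `F` on a partially ordered set `P`:
the homotopy limit of `F` (in the form of Bousfield and Kan), that is, the total complex of the
double complex of cochains with values in `F`. It will be used for the partially ordered set of
affine open subsets of a scheme and presheaves whose components are products of quasi-coherent
sheaves; then it computes the derived global sections. -/
def RΓ : (Pᵒᵖ ⥤ CochainComplex (ModuleCat.{u} k) ℤ) ⥤ CochainComplex (ModuleCat.{u} k) ℤ where
  obj F := total (cochainBicomplex F)
  map α := totalMap
    { f := fun q => (cochains k P).map (Functor.whiskerRight α (HomologicalComplex.eval _ _ q))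
      comm' := fun q q' _ => cochains_ext fun _ x σ =>
        congrArg (fun f => f.hom (x σ)) ((α.app (op (σ 0))).comm q q') }
  map_id _ := rfl
  map_comp _ _ := rfl

end DerivedSections

section Scheme

variable {k : Type u} [Field k] {Y : Scheme.{u}} (f : Y ⟶ Spec (CommRingCat.of k))

/-- The `k`-algebra of functions on an open subset `U` of a `k`-scheme `Y`. -/
def Sections (_ : Y ⟶ Spec (CommRingCat.of k)) (U : Y.Opens) : Type u := Γ(Y, U)

instance (U : Y.Opens) : CommRing (Sections f U) := inferInstanceAs (CommRing Γ(Y, U))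

/-- The structure map `k → Γ(Y, U)`. -/
def structureMap (U : Y.Opens) : k →+* Sections f U :=
  (f.appLE ⊤ U le_top).hom.comp (Scheme.ΓSpecIso (CommRingCat.of k)).inv.hom

instance (U : Y.Opens) : Algebra k (Sections f U) := (structureMap f U).toAlgebra

instance [Smooth f] (U : Y.affineOpens) : Algebra.Smooth k (Sections f U) := by
  have h₁ : (f.appLE ⊤ U le_top).hom.Smooth := f.smooth_appLE (isAffineOpen_top _) U.2 le_top
  have h₂ : (Scheme.ΓSpecIso (CommRingCat.of k)).inv.hom.Smooth :=
    RingHom.Smooth.of_bijective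
      (Scheme.ΓSpecIso (CommRingCat.of k)).symm.commRingCatIsoToRingEquiv.bijective
  have h : (structureMap f U).Smooth := h₂.comp h₁
  exact h

/-- Restriction of functions. -/
def res {U V : Y.Opens} (h : V ≤ U) : Sections f U →ₐ[k] Sections f V where
  __ := (Y.presheaf.map (homOfLE h).op).hom
  commutes' r := by
    have : f.appLE ⊤ U le_top ≫ Y.presheaf.map (homOfLE h).op = f.appLE ⊤ V le_top :=
      Scheme.Hom.appLE_map _ _ _
    exact congrArg (fun φ => φ.hom ((Scheme.ΓSpecIso (CommRingCat.of k)).inv.hom r)) this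

theorem res_id {U : Y.Opens} (h : U ≤ U) : res f h = AlgHom.id k _ := by
  apply AlgHom.ext
  intro x
  exact congrArg (fun φ => φ.hom x) (Y.presheaf.map_id (op U))

theorem res_comp {U V W : Y.Opens} (h : V ≤ U) (h' : W ≤ V) (h'' : W ≤ U) :
    res f h'' = (res f h').comp (res f h) := by
  apply AlgHom.ext
  intro x
  exact congrArg (fun φ => φ.hom x) (Y.presheaf.map_comp (homOfLE h).op (homOfLE h').op)

theorem res_etale {U V : Y.affineOpens} (h : V ≤ U) :
    (res f h).toRingHom.FormallyEtale := by
  have h₁ : ((𝟙 Y : Y ⟶ Y).appLE U V h).hom.Etale := (𝟙 Y : Y ⟶ Y).etale_appLE U.2 V.2 h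
  have h₂ : (𝟙 Y : Y ⟶ Y).appLE U V h = Y.presheaf.map (homOfLE h).op := by
    simp [Scheme.Hom.appLE]
    rfl
  rw [h₂] at h₁
  letI : Algebra Γ(Y, U) Γ(Y, V) := (Y.presheaf.map (homOfLE h).op).hom.toAlgebra
  haveI : Algebra.Etale Γ(Y, U) Γ(Y, V) := h₁
  exact (inferInstance : Algebra.FormallyEtale Γ(Y, U) Γ(Y, V))

end Scheme

section Complexes

variable {k : Type u} [Field k] [CharZero k] {Y : Scheme.{u}} (f : Y ⟶ Spec (CommRingCat.of k))

/-- The presheaf of complexes `U ↦ Ω_ω (T^*[-1] U)` on the affine open subsets of `Y`, for the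
standard `ω`. The complex `Ω_ω (T^*[-1] Y)` is `RΓ` of this presheaf. -/
def twistedDeRham [Smooth f] : Y.affineOpensᵒᵖ ⥤ CochainComplex (ModuleCat.{u} k) ℤ where
  obj U := DR.twistedComplex (stdForm k (Sections f U.unop))
  map i := DR.twistedMap (polyRes (res f i.unop.le) (res_etale f i.unop.le))
    (polyRes_mem _ _) _ _ (map_stdForm _ _)
  map_id _ := DR.twistedMap_id _ _ _ _
    (exteriorMap_id _ _ _ (res_id f le_rfl) (vectorRes_id _ (res_etale f le_rfl) (res_id f le_rfl)))
  map_comp i j := DR.twistedMap_comp _ _ _ _ _ _ _ _ _ _ _ _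
    (exteriorMap_comp _ _ (vectorRes_smul _ (res_etale f i.unop.le)) _ _
      (vectorRes_smul _ (res_etale f j.unop.le)) _ _
      (vectorRes_smul _ (res_etale f (j.unop.le.trans i.unop.le))) (res_comp f _ _ _)
      (vectorRes_comp _ _ _ _ _ _ (res_comp f _ _ _)))

theorem map_mem_constGrading {A A' : Type*} [CommRing A] [Algebra k A] [CommRing A'] [Algebra k A']
    (φ : A →ₐ[k] A') (i : ℕ) (b : A) (hb : b ∈ constGrading k A i) :
    φ b ∈ constGrading k A' i := by
  rcases eq_or_ne i 0 with rfl | hi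
  · exact mem_constGrading_zero k A' _
  · rw [eq_zero_of_mem_constGrading k A hi hb, map_zero]; exact zero_mem _

/-- The presheaf of complexes `U ↦ Ω (U)` on the affine open subsets of `Y`. The complex `Ω (Y)`
is `RΓ` of this presheaf. -/
def deRham : Y.affineOpensᵒᵖ ⥤ CochainComplex (ModuleCat.{u} k) ℤ where
  obj U := DR.twistedComplex (0 : DR.ClosedTwoForm (constGrading k (Sections f U.unop)))
  map i := DR.twistedMap (res f i.unop.le) (map_mem_constGrading _) _ _ (map_zero _)
  map_id _ := DR.twistedMap_id _ _ _ _ (res_id f le_rfl)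
  map_comp _ _ := DR.twistedMap_comp _ _ _ _ _ _ _ _ _ _ _ _ (res_comp f _ _ _)

/-- A BV Laplacian on `π^* K_Y [-n]`: a family of operators of degree one on the sections over
`T^*[-1] U`, for all affine open subsets `U` of `Y`, compatible with restriction and given by the
formula `IsBVLaplacian` in étale coordinates. -/
structure BVLaplacian (n : ℕ) where
  op (U : Y.affineOpens) : Density k (Sections f U) n →ₗ[k] Density k (Sections f U) n
  degree (U : Y.affineOpens) (m : ℤ) (z : Density k (Sections f U) n) :
    z ∈ densityPiece k (Sections f U) n m → op U z ∈ densityPiece k (Sections f U) n (m + 1)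
  natural {U V : Y.affineOpens} (h : V ≤ U) (z : Density k (Sections f U) n) :
    op V (densityRes (res f h) (res_etale f h) z) = densityRes (res f h) (res_etale f h) (op U z)
  formula (U : Y.affineOpens) : IsBVLaplacian (op U)

variable {f} {n : ℕ}

/-- The BV Laplacian squares to zero. -/
def BVLaplacian.IsDifferential (Δ : BVLaplacian f n) : Prop :=
  ∀ (U : Y.affineOpens) (z : Density k (Sections f U) n), Δ.op U (Δ.op U z) = 0

variable (f n) in
/-- The module of sections of degree `m` of `π^* K_Y [-n]` over `T^*[-1] U`. -/
def densityModule (U : Y.affineOpens) (m : ℤ) : ModuleCat.{u} k :=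
  ModuleCat.of k (densityPiece k (Sections f U) n m)

/-- The component `m → m'` of the BV Laplacian, for `m' = m + 1`. -/
def BVLaplacian.opHom (Δ : BVLaplacian f n) (U : Y.affineOpens) {m m' : ℤ} (h : m + 1 = m') :
    densityModule f n U m ⟶ densityModule f n U m' :=
  ModuleCat.ofHom ((Δ.op U).restrict (p := densityPiece k (Sections f U) n m)
    (q := densityPiece k (Sections f U) n m') fun z hz => by
      subst h
      exact Δ.degree U m z hz)

variable (f n) in
/-- Restriction of sections of degree `m` from `U` to `V`. -/
def resHom {U V : Y.affineOpens} (h : V ≤ U) (m : ℤ) :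
    densityModule f n U m ⟶ densityModule f n V m :=
  ModuleCat.ofHom (densityResPiece (res f h) (res_etale f h) m)

theorem resHom_id {U : Y.affineOpens} (h : U ≤ U) (m : ℤ) : resHom f n h m = 𝟙 _ :=
  ModuleCat.hom_ext (densityResPiece_id (res f h) (res_etale f h) (res_id f h) m)

theorem resHom_comp {U V W : Y.affineOpens} (h : V ≤ U) (h' : W ≤ V) (h'' : W ≤ U) (m : ℤ) :
    resHom f n h'' m = resHom f n h m ≫ resHom f n h' m :=
  ModuleCat.hom_ext (densityResPiece_comp (res f h) (res_etale f h) (res f h') (res_etale f h')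
    (res f h'') (res_etale f h'') (res_comp f h h' h'') m)

theorem BVLaplacian.opHom_natural (Δ : BVLaplacian f n) {U V : Y.affineOpens} (hUV : V ≤ U)
    {m m' : ℤ} (h : m + 1 = m') :
    resHom f n hUV m ≫ Δ.opHom V h = Δ.opHom U h ≫ resHom f n hUV m' :=
  ModuleCat.hom_ext (LinearMap.ext fun z => Subtype.ext (Δ.natural hUV z.1))

theorem BVLaplacian.opHom_opHom (Δ : BVLaplacian f n) (hΔ : Δ.IsDifferential) (U : Y.affineOpens)
    {l m m' : ℤ} (h : l + 1 = m) (h' : m + 1 = m') : Δ.opHom U h ≫ Δ.opHom U h' = 0 :=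
  ModuleCat.hom_ext (LinearMap.ext fun z => Subtype.ext (hΔ U z.1))

/-- The complex of sections of `π^* K_Y [-n]` over `T^*[-1] U`, with the BV Laplacian. -/
def BVLaplacian.complexOn (Δ : BVLaplacian f n) (hΔ : Δ.IsDifferential) (U : Y.affineOpens) :
    CochainComplex (ModuleCat.{u} k) ℤ where
  X m := densityModule f n U m
  d m m' := if h : m + 1 = m' then Δ.opHom U h else 0
  shape m m' h := dif_neg h
  d_comp_d' l m m' h h' := by
    have h : l + 1 = m := h
    have h' : m + 1 = m' := h'
    rw [dif_pos h, dif_pos h', Δ.opHom_opHom hΔ]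

/-- Restriction of the complex `BVLaplacian.complexOn` from `U` to `V`. -/
def BVLaplacian.complexRes (Δ : BVLaplacian f n) (hΔ : Δ.IsDifferential) {U V : Y.affineOpens}
    (hUV : V ≤ U) : Δ.complexOn hΔ U ⟶ Δ.complexOn hΔ V where
  f m := resHom f n hUV m
  comm' m m' h := by
    have h : m + 1 = m' := h
    dsimp only [complexOn]
    rw [dif_pos h, dif_pos h, Δ.opHom_natural hUV h]

theorem BVLaplacian.complexRes_id (Δ : BVLaplacian f n) (hΔ : Δ.IsDifferential)
    {U : Y.affineOpens} (h : U ≤ U) : Δ.complexRes hΔ h = 𝟙 _ :=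
  HomologicalComplex.hom_ext _ _ fun m => resHom_id h m

theorem BVLaplacian.complexRes_comp (Δ : BVLaplacian f n) (hΔ : Δ.IsDifferential)
    {U V W : Y.affineOpens} (h : V ≤ U) (h' : W ≤ V) (h'' : W ≤ U) :
    Δ.complexRes hΔ h'' = Δ.complexRes hΔ h ≫ Δ.complexRes hΔ h' :=
  HomologicalComplex.hom_ext _ _ fun m => resHom_comp h h' h'' m

/-- The presheaf of complexes `U ↦ (Γ(T^*[-1] U, π^* K_Y)[-n], Δ)` on the affine open subsets
of `Y`. -/
def BVLaplacian.complex (Δ : BVLaplacian f n) (hΔ : Δ.IsDifferential) :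
    Y.affineOpensᵒᵖ ⥤ CochainComplex (ModuleCat.{u} k) ℤ where
  obj U := Δ.complexOn hΔ U.unop
  map i := Δ.complexRes hΔ i.unop.le
  map_id _ := Δ.complexRes_id hΔ le_rfl
  map_comp i j := Δ.complexRes_comp hΔ i.unop.le j.unop.le (j.unop.le.trans i.unop.le)

end Complexes

end BVQuantization

end

open BVQuantization

/-!
Both comparison maps are given by formulas on affine open subsets `U = Spec A`, natural in `U`, and
are quasi-isomorphisms there. Derived global sections are the direct product total complex of a
double complex whose columns, one for each `p ≥ 0`, are products of the values of the presheaf over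
chains of `p + 1` open subsets. A map which is a quasi-isomorphism on every column is one on the
total complexes, since a primitive of a cycle of its cone can be found column by column
(`coneExactAt_totalMap`, `quasiIso_RΓ_map`).

The first map is the restriction of forms on `T^*[-1] U` to the zero section, on which `ω`
vanishes. The pullback along the projection splits it. By Cartan's formula for the Euler vector
field of the fibres (`DR.d_contractEuler_add`) the forms of nonzero degree in the fibre coordinates
are acyclic for `d` in characteristic zero. As `ω ∧ -` raises the weight by two and `d` by one, the
equation `(d + ω) u = x` on the kernel of the restriction is solved successively, weight by weight
(`DR.exists_twistedD_eq`), and the product of all weights contains the solution. Hence the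
restriction is a quasi-isomorphism (`DR.quasiIso_twistedMap`).

The second map is the contraction `P ⊗ μ ↦ P ⌋ μ` of top forms with polyvector fields
(`densityToForms`), where `DR A` is identified with the exterior algebra of `Ω_A` (`formsToDR`). It
is bijective. To avoid local bases, this is derived from a global family of functions `x_j` and
vector fields `D_j` with `d f = ∑ D_j(f) d x_j`: contraction with `D_j` and exterior multiplication
by `d x_j` on forms correspond to multiplication by `D_j` and contraction with `d x_j` on polyvector
fields, and the operators `∑ D_j ⌋ (d x_j ∧ -)` on forms and `∑ D_j ∧ (d x_j ⌋ -)` on polyvector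
fields are multiplication by `n - q` and by the degree, respectively
(`sum_contractLeft_ι_mul`, `sum_ι_mul_contractLeft`). The first statement needs that the trace
`∑ D_j(x_j)`, the rank of `Ω_A`, is `n`, which is checked in étale coordinates
(`Frame.trace_eq_natCast`).

The BV Laplacian is the operator which corresponds to the de Rham differential under this
bijection (`laplacian`). Thus it squares to zero, and the contraction is an isomorphism of
complexes. In étale coordinates `p_I ⌋ vol` is a form with constant coefficients, hence closed, and
`d x_i ∧ -` corresponds to `∂ / ∂ p_i`, which gives the coordinate formula
(`isBVLaplacian_laplacian`). The formula determines the operator on affine open subsets with étale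
coordinates; these cover `Y`, and differential forms are determined by their restrictions to them
(`form_eq_zero_of_forall_exteriorMap`), so the BV Laplacian is unique (`BVLaplacian.eq`).
-/

namespace BVQuantization

/-! ### Quasi-isomorphisms and elementwise acyclicity of the cone -/

section QuasiIsoCriterion

variable {k : Type u} [Field k] {K L : CochainComplex (ModuleCat.{u} k) ℤ}

theorem exists_iCycles_eq {m m' : ℤ} (h : m + 1 = m') (x : K.X m) (hx : (K.d m m').hom x = 0) :
    ∃ c : K.cycles m, (K.iCycles m).hom c = x := by
  have hex : (ShortComplex.mk (K.iCycles m) (K.d m m') (by simp)).Exact :=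
    ShortComplex.exact_of_f_is_kernel _ (K.cyclesIsKernel m m' (by simp [h]))
  exact (ShortComplex.moduleCat_exact_iff _).1 hex x hx

theorem homologyπ_eq_zero_iff {l m : ℤ} (h : l + 1 = m) (c : K.cycles m) :
    (K.homologyπ m).hom c = 0 ↔ ∃ y : K.X l, (K.d l m).hom y = (K.iCycles m).hom c := by
  have hex : (ShortComplex.mk (K.toCycles l m) (K.homologyπ m) (by simp)).Exact :=
    ShortComplex.exact_of_g_is_cokernel _ (K.homologyIsCokernel l m (by simp [← h]))
  have hinj : Function.Injective (K.iCycles m).hom :=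
    (ModuleCat.mono_iff_injective _).1 inferInstance
  have hcomp : ∀ y, (K.iCycles m).hom ((K.toCycles l m).hom y) = (K.d l m).hom y := fun y =>
    congrArg (fun f => f.hom y) (K.toCycles_i l m)
  constructor
  · intro hc
    obtain ⟨y, hy⟩ := (ShortComplex.moduleCat_exact_iff _).1 hex c hc
    exact ⟨y, by rw [← hcomp]; exact congrArg _ hy⟩
  · rintro ⟨y, hy⟩
    rw [← hcomp] at hy
    rw [← hinj hy]
    exact congrArg (fun f => f.hom y) (K.toCycles_comp_homologyπ l m)

/-- Elementwise acyclicity of the mapping cone of a map of complexes `φ`, in the degree which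
contains `K.X m` and `L.X l`, for `m = l + 1`. -/
def ConeExactAt (φ : K ⟶ L) (l m n p : ℤ) : Prop :=
  ∀ (x : K.X n) (y : L.X m), (K.d n p).hom x = 0 → (φ.f n).hom x = (L.d m n).hom y →
    ∃ (x' : K.X m) (y' : L.X l), (K.d m n).hom x' = x ∧ y = (φ.f m).hom x' + (L.d l m).hom y'

theorem hom_d_comm (φ : K ⟶ L) {m n : ℤ} (x : K.X m) :
    (φ.f n).hom ((K.d m n).hom x) = (L.d m n).hom ((φ.f m).hom x) :=
  (congrArg (fun f => f.hom x) (φ.comm m n)).symm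

theorem d_d_apply {l m n : ℤ} (x : K.X l) : (K.d m n).hom ((K.d l m).hom x) = 0 :=
  congrArg (fun f => f.hom x) (K.d_comp_d l m n)

theorem hom_iCycles (φ : K ⟶ L) (m : ℤ) (c : K.cycles m) :
    (L.iCycles m).hom ((HomologicalComplex.cyclesMap φ m).hom c) =
      (φ.f m).hom ((K.iCycles m).hom c) :=
  congrArg (fun f => f.hom c) (HomologicalComplex.cyclesMap_i φ m)

theorem hom_homologyπ (φ : K ⟶ L) (m : ℤ) (c : K.cycles m) :
    (HomologicalComplex.homologyMap φ m).hom ((K.homologyπ m).hom c) =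
      (L.homologyπ m).hom ((HomologicalComplex.cyclesMap φ m).hom c) :=
  congrArg (fun f => f.hom c) (HomologicalComplex.homologyπ_naturality φ m)

theorem d_iCycles {m n : ℤ} (c : K.cycles m) : (K.d m n).hom ((K.iCycles m).hom c) = 0 :=
  congrArg (fun f => f.hom c) (K.iCycles_d m n)

theorem homologyπ_surjective (m : ℤ) : Function.Surjective (K.homologyπ m).hom :=
  (ModuleCat.epi_iff_surjective _).1 inferInstance

/-- A map of complexes is a quasi-isomorphism if its cone is acyclic. -/
theorem quasiIso_of_coneExactAt (φ : K ⟶ L)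
    (h : ∀ l m n p : ℤ, l + 1 = m → m + 1 = n → n + 1 = p → ConeExactAt φ l m n p) :
    QuasiIso φ := by
  refine ⟨fun m => ?_⟩
  rw [quasiIsoAt_iff_isIso_homologyMap]
  apply (ConcreteCategory.isIso_iff_bijective _).2
  refine ⟨(injective_iff_map_eq_zero (HomologicalComplex.homologyMap φ m).hom).2 ?_, fun z => ?_⟩
  · intro z hz
    obtain ⟨c, rfl⟩ := homologyπ_surjective m z
    rw [hom_homologyπ, homologyπ_eq_zero_iff (sub_add_cancel m 1)] at hz
    obtain ⟨y, hy⟩ := hz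
    rw [hom_iCycles] at hy
    obtain ⟨x', y', hx', -⟩ := h (m - 1 - 1) (m - 1) m (m + 1) (by ring) (by ring) rfl
      _ y (d_iCycles c) hy.symm
    exact (homologyπ_eq_zero_iff (sub_add_cancel m 1) c).2 ⟨x', hx'⟩
  · obtain ⟨c, rfl⟩ := homologyπ_surjective m z
    obtain ⟨x', y', hx', hy'⟩ := h (m - 1) m (m + 1) (m + 1 + 1) (by ring) rfl rfl 0
      ((L.iCycles m).hom c) (map_zero _) (by rw [map_zero, d_iCycles])
    obtain ⟨c', rfl⟩ := exists_iCycles_eq rfl x' hx'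
    refine ⟨(K.homologyπ m).hom c', ?_⟩
    refine (hom_homologyπ φ m c').trans ?_
    rw [eq_comm, ← sub_eq_zero, ← map_sub, homologyπ_eq_zero_iff (sub_add_cancel m 1)]
    exact ⟨y', by rw [map_sub, hom_iCycles, hy', add_sub_cancel_left]⟩

/-- The cone of a quasi-isomorphism is acyclic. -/
theorem coneExactAt_of_quasiIso (φ : K ⟶ L) [QuasiIso φ] {l m n p : ℤ} (hl : l + 1 = m)
    (hm : m + 1 = n) (hn : n + 1 = p) : ConeExactAt φ l m n p := by
  intro x y hx hy
  have hbij : ∀ m, Function.Bijective (HomologicalComplex.homologyMap φ m).hom := fun m =>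
    (ConcreteCategory.isIso_iff_bijective (HomologicalComplex.homologyMap φ m)).1 inferInstance
  obtain ⟨c, rfl⟩ := exists_iCycles_eq hn x hx
  obtain ⟨x₁, hx₁⟩ := (homologyπ_eq_zero_iff hm c).1 <| (hbij n).1 <| by
    rw [map_zero, hom_homologyπ, homologyπ_eq_zero_iff hm]
    exact ⟨y, by rw [hom_iCycles, hy]⟩
  obtain ⟨c₁, hc₁⟩ := exists_iCycles_eq hm (y - (φ.f m).hom x₁) (by
    rw [map_sub, ← hom_d_comm, hx₁, hy, sub_self])
  obtain ⟨z, hz⟩ := (hbij m).2 ((L.homologyπ m).hom c₁)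
  obtain ⟨c₂, rfl⟩ := homologyπ_surjective m z
  have hz' := hom_homologyπ φ m c₂
  rw [hz, ← sub_eq_zero, ← map_sub, homologyπ_eq_zero_iff hl] at hz'
  obtain ⟨y', hy'⟩ := hz'
  refine ⟨x₁ + (K.iCycles m).hom c₂, y', by rw [map_add, d_iCycles, add_zero, hx₁], ?_⟩
  rw [hy', map_sub, hc₁, hom_iCycles, map_add]
  abel

end QuasiIsoCriterion

/-! ### Derived global sections preserve objectwise quasi-isomorphisms -/

section TotalQuasiIso

variable {k : Type u} [Field k]

theorem totalD_zero' (E : CochainComplex (CochainComplex (ModuleCat.{u} k) ℕ) ℤ) {m m' : ℤ}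
    (h : m + 1 = m') (x : TotalDegree E m) {l q : ℤ} (hl : l + 1 = q)
    (hpq : ((0 : ℕ) : ℤ) + q = m') (hpl : ((0 : ℕ) : ℤ) + l = m) :
    totalD E h x ⟨(0, q), hpq⟩ = ((E.d l q).f 0).hom (x ⟨(0, l), hpl⟩) := by
  obtain rfl : l = q - 1 := by omega
  exact totalD_zero E h x q hpq

theorem totalD_succ' (E : CochainComplex (CochainComplex (ModuleCat.{u} k) ℕ) ℤ) {m m' : ℤ}
    (h : m + 1 = m') (x : TotalDegree E m) (p : ℕ) {l q : ℤ} (hl : l + 1 = q)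
    (hpq : ((p + 1 : ℕ) : ℤ) + q = m') (hpl : ((p + 1 : ℕ) : ℤ) + l = m)
    (hq : ((p : ℕ) : ℤ) + q = m) :
    totalD E h x ⟨(p + 1, q), hpq⟩ =
      (-1 : k) ^ (p + 1) • ((E.d l q).f (p + 1)).hom (x ⟨(p + 1, l), hpl⟩) +
        ((E.X q).d p (p + 1)).hom (x ⟨(p, q), hq⟩) := by
  obtain rfl : l = q - 1 := by omega
  exact totalD_succ E h x p q hpq

theorem neg_one_pow_smul_smul {M : Type*} [AddCommGroup M] [Module k M] (p : ℕ) (x : M) :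
    (-1 : k) ^ p • (-1 : k) ^ p • x = x := by
  rw [smul_smul, ← pow_add, Even.neg_one_pow ⟨p, rfl⟩, one_smul]

/-- Dependent choice. -/
theorem exists_seq_of_step {S : ℕ → Type*} (good : ∀ p, S p → Prop)
    (R : ∀ p, S p → S (p + 1) → Prop) {s₀ : S 0} (h₀ : good 0 s₀)
    (step : ∀ p s, good p s → ∃ s', good (p + 1) s' ∧ R p s s') :
    ∃ s : ∀ p, S p, s 0 = s₀ ∧ ∀ p, R p (s p) (s (p + 1)) := by
  let t : ∀ p, {s : S p // good p s} := fun p => Nat.rec ⟨s₀, h₀⟩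
    (fun p s => ⟨(step p s.1 s.2).choose, (step p s.1 s.2).choose_spec.1⟩) p
  exact ⟨fun p => (t p).1, rfl, fun p => (step p (t p).1 (t p).2).choose_spec.2⟩

variable {E E' : CochainComplex (CochainComplex (ModuleCat.{u} k) ℕ) ℤ} (φ : E ⟶ E')

theorem bicomplex_hom_δ (a : ℤ) (p p' : ℕ) (x : (E.X a).X p) :
    ((φ.f a).f p').hom (((E.X a).d p p').hom x) =
      ((E'.X a).d p p').hom (((φ.f a).f p).hom x) :=
  (congrArg (fun f => f.hom x) ((φ.f a).comm p p')).symm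

/-- A map of double complexes is a quasi-isomorphism on total complexes if it is one on every
column. As the columns are indexed by natural numbers and the totals are direct products, an element
which bounds a given cycle of the cone can be constructed column by column. -/
theorem coneExactAt_totalMap
    (hφ : ∀ (p : ℕ) (l m n t : ℤ), l + 1 = m → m + 1 = n → n + 1 = t →
      ∀ (x : (E.X n).X p) (y : (E'.X m).X p), ((E.d n t).f p).hom x = 0 →
        ((φ.f n).f p).hom x = ((E'.d m n).f p).hom y →
        ∃ (x' : (E.X m).X p) (y' : (E'.X l).X p), ((E.d m n).f p).hom x' = x ∧
          y = ((φ.f m).f p).hom x' + ((E'.d l m).f p).hom y')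
    {l m n t : ℤ} (hl : l + 1 = m) (hm : m + 1 = n) (hn : n + 1 = t) :
    ConeExactAt (totalMap φ) l m n t := by
  intro x y hx hxy
  change TotalDegree E n at x
  change TotalDegree E' m at y
  dsimp only [total] at hx hxy
  rw [dif_pos hn] at hx
  rw [dif_pos hm] at hxy
  replace hx : totalD E hn x = 0 := hx
  replace hxy : ∀ i, ((φ.f i.1.2).f i.1.1).hom (x i) = totalD E' hm y i := fun i => congrFun hxy i
  -- The state in column `p` consists of the components of `x'` and `y'` there; `good` is what is
  -- needed to proceed to the next column.
  let S : ℕ → Type u := fun p => (E.X (m - p)).X p × (E'.X (m - (p + 1 : ℕ))).X p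
  let good : ∀ p, S p → Prop := fun p s =>
    (∀ (q : ℤ) (hq : (p : ℤ) + q = n),
      ((E.X q).d p (p + 1)).hom (((E.d (m - p) q).f p).hom s.1) =
        (-1 : k) ^ p • ((E.X q).d p (p + 1)).hom (x ⟨(p, q), hq⟩)) ∧
    ((E'.X (m - p)).d p (p + 1)).hom (y ⟨(p, m - p), by dsimp only; omega⟩) =
      ((φ.f (m - p)).f (p + 1)).hom (((E.X (m - p)).d p (p + 1)).hom s.1) +
        (-1 : k) ^ p • ((E'.d (m - (p + 1 : ℕ)) (m - p)).f (p + 1)).hom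
          (((E'.X (m - (p + 1 : ℕ))).d p (p + 1)).hom s.2)
  let R : ∀ p, S p → S (p + 1) → Prop := fun p s s' =>
    (-1 : k) ^ (p + 1) • ((E.d (m - (p + 1 : ℕ)) (m - p)).f (p + 1)).hom s'.1 +
        ((E.X (m - p)).d p (p + 1)).hom s.1 =
      x ⟨(p + 1, m - p), by dsimp only; push_cast; omega⟩ ∧
    y ⟨(p + 1, m - (p + 1 : ℕ)), by dsimp only; push_cast; omega⟩ =
      ((φ.f (m - (p + 1 : ℕ))).f (p + 1)).hom s'.1 +
        ((-1 : k) ^ (p + 1) •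
          ((E'.d (m - (p + 1 + 1 : ℕ)) (m - (p + 1 : ℕ))).f (p + 1)).hom s'.2 +
          ((E'.X (m - (p + 1 : ℕ))).d p (p + 1)).hom s.2)
  obtain ⟨a₀, b₀, ha₀, hb₀⟩ := hφ 0 (m - (0 + 1 : ℕ)) (m - (0 : ℕ)) (n - (0 : ℕ)) (t - (0 : ℕ))
    (by push_cast; omega) (by push_cast; omega) (by push_cast; omega)
    (x ⟨(0, n - (0 : ℕ)), by simp⟩) (y ⟨(0, m - (0 : ℕ)), by simp⟩)
    (by
      have h := totalD_zero' E hn x (l := n - (0 : ℕ)) (q := t - (0 : ℕ)) (by push_cast; omega)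
        (by push_cast; omega) (by push_cast; omega)
      rw [← h, hx]; rfl)
    (by
      have h := totalD_zero' E' hm y (l := m - (0 : ℕ)) (q := n - (0 : ℕ)) (by push_cast; omega)
        (by push_cast; omega) (by push_cast; omega)
      rw [← h]
      exact hxy ⟨(0, n - (0 : ℕ)), by simp⟩)
  have h₀ : good 0 (a₀, b₀) := by
    refine ⟨?_, ?_⟩
    · intro q hq
      obtain rfl : q = n - (0 : ℕ) := by omega
      dsimp only
      rw [ha₀, pow_zero, one_smul]
    · dsimp only
      rw [hb₀, map_add, bicomplex_hom_δ, bicomplex_comm, pow_zero, one_smul]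
  have step : ∀ p s, good p s → ∃ s', good (p + 1) s' ∧ R p s s' := by
    rintro p ⟨a, b⟩ ⟨hg₁, hg₂⟩
    obtain ⟨a', b', ha', hb'⟩ := hφ (p + 1) (m - (p + 1 + 1 : ℕ)) (m - (p + 1 : ℕ)) (m - p)
      (n - p) (by push_cast; omega) (by push_cast; omega) (by omega)
      ((-1 : k) ^ (p + 1) • (x ⟨(p + 1, m - p), by dsimp only; push_cast; omega⟩ -
        ((E.X (m - p)).d p (p + 1)).hom a))
      (y ⟨(p + 1, m - (p + 1 : ℕ)), by dsimp only; push_cast; omega⟩ -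
        ((E'.X (m - (p + 1 : ℕ))).d p (p + 1)).hom b)
      (by
        have h := totalD_succ' E hn x p (l := m - p) (q := n - p) (by omega)
          (by push_cast; omega) (by push_cast; omega) (by omega)
        rw [hx] at h
        replace h := h.symm
        replace h : _ = (0 : (E.X (n - p)).X (p + 1)) := h
        rw [map_smul, map_sub, ← bicomplex_comm]
        dsimp only at hg₁
        rw [hg₁ _ (by omega), smul_sub, smul_smul, pow_succ, mul_neg_one, neg_mul, ← pow_add,
          Even.neg_one_pow ⟨p, rfl⟩, neg_one_smul, sub_neg_eq_add, ← mul_neg_one, ← pow_succ]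
        exact h)
      (by
        have h := (hxy ⟨(p + 1, m - p), by dsimp only; push_cast; omega⟩).trans
          (totalD_succ' E' hm y p (l := m - (p + 1 : ℕ)) (q := m - p) (by push_cast; omega)
            (by push_cast; omega) (by push_cast; omega) (by omega))
        dsimp only at h hg₂
        rw [map_smul, map_sub, h, hg₂, map_sub, smul_sub, smul_add, smul_add,
          neg_one_pow_smul_smul, smul_smul _ ((-1 : k) ^ p), pow_succ, mul_neg_one, neg_mul,
          ← pow_add, Even.neg_one_pow ⟨p, rfl⟩, neg_one_smul]
        abel)
    obtain ⟨b'', hR⟩ : ∃ b'', R p (a, b) (a', b'') := by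
      refine ⟨(-1 : k) ^ (p + 1) • b', ?_, ?_⟩
      · dsimp only
        rw [ha', neg_one_pow_smul_smul, sub_add_cancel]
      · dsimp only
        rw [map_smul, neg_one_pow_smul_smul, ← add_assoc, ← hb', sub_add_cancel]
    refine ⟨(a', b''), ⟨?_, ?_⟩, hR⟩
    · intro q hq
      obtain rfl : q = m - p := by push_cast at hq; omega
      dsimp only
      rw [ha', map_smul, map_sub, bicomplex_δ_δ, sub_zero]
    · have h := hR.2
      dsimp only at h ⊢
      rw [h, map_add, map_add, map_smul, bicomplex_δ_δ, add_zero, bicomplex_hom_δ,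
        bicomplex_comm]
  obtain ⟨s, hs₀, hs⟩ := exists_seq_of_step good R h₀ step
  have e : ∀ i : {i : ℕ × ℤ // (i.1 : ℤ) + i.2 = m}, m - (i.1.1 : ℤ) = i.1.2 := fun i => by
    have := i.2; omega
  have e' : ∀ i : {i : ℕ × ℤ // (i.1 : ℤ) + i.2 = l}, m - ((i.1.1 + 1 : ℕ) : ℤ) = i.1.2 :=
    fun i => by have := i.2; push_cast; omega
  let x' : TotalDegree E m := fun i =>
    Eq.rec (motive := fun q _ => (E.X q).X i.1.1) (s i.1.1).1 (e i)
  let y' : TotalDegree E' l := fun i =>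
    Eq.rec (motive := fun q _ => (E'.X q).X i.1.1) (s i.1.1).2 (e' i)
  refine ⟨x', y', ?_, ?_⟩
  · dsimp only [total]
    rw [dif_pos hm]
    change totalD E hm x' = x
    funext ⟨⟨p, q⟩, hpq⟩
    dsimp only at hpq
    match p, hpq with
    | 0, hpq =>
      obtain rfl : q = n - (0 : ℕ) := by push_cast at hpq ⊢; omega
      rw [totalD_zero' E hm x' (l := m - (0 : ℕ)) (by push_cast; omega) hpq
        (by push_cast; omega), ← ha₀]
      change ((E.d (m - (0 : ℕ)) (n - (0 : ℕ))).f 0).hom (s 0).1 = _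
      rw [hs₀]
    | p + 1, hpq =>
      obtain rfl : q = m - p := by push_cast at hpq ⊢; omega
      rw [totalD_succ' E hm x' p (l := m - (p + 1 : ℕ)) (by push_cast; omega) hpq
        (by push_cast; omega) (by omega)]
      exact (hs p).1
  · dsimp only [total]
    rw [dif_pos hl]
    change y = fun i => ((φ.f i.1.2).f i.1.1).hom (x' i) + totalD E' hl y' i
    funext ⟨⟨p, q⟩, hpq⟩
    dsimp only at hpq ⊢
    match p, hpq with
    | 0, hpq =>
      obtain rfl : q = m - (0 : ℕ) := by push_cast at hpq ⊢; omega
      rw [totalD_zero' E' hl y' (l := m - (0 + 1 : ℕ)) (by push_cast; omega) hpq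
        (by push_cast; omega), hb₀]
      change _ = ((φ.f (m - (0 : ℕ))).f 0).hom (s 0).1 +
        ((E'.d (m - (0 + 1 : ℕ)) (m - (0 : ℕ))).f 0).hom (s 0).2
      rw [hs₀]
    | p + 1, hpq =>
      obtain rfl : q = m - (p + 1 : ℕ) := by push_cast at hpq ⊢; omega
      rw [totalD_succ' E' hl y' p (l := m - (p + 1 + 1 : ℕ)) (by push_cast; omega) hpq
        (by push_cast; omega) (by push_cast; omega)]
      exact (hs p).2

variable {P : Type u} [PartialOrder P]

/-- Derived global sections preserve objectwise quasi-isomorphisms. -/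
theorem quasiIso_RΓ_map {F F' : Pᵒᵖ ⥤ CochainComplex (ModuleCat.{u} k) ℤ} (α : F ⟶ F')
    (hα : ∀ U, QuasiIso (α.app U)) : QuasiIso ((RΓ k P).map α) := by
  refine quasiIso_of_coneExactAt _ fun l m n t hl hm hn => coneExactAt_totalMap _ ?_ hl hm hn
  intro p l m n t hl hm hn x y hx hxy
  have h : ∀ σ : Fin (p + 1) →o P, ∃ (x' : (F.obj (op (σ 0))).X m) (y' : (F'.obj (op (σ 0))).X l),
      ((F.obj (op (σ 0))).d m n).hom x' = x σ ∧
        y σ = ((α.app (op (σ 0))).f m).hom x' + ((F'.obj (op (σ 0))).d l m).hom y' := fun σ =>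
    haveI := hα (op (σ 0))
    coneExactAt_of_quasiIso (α.app (op (σ 0))) hl hm hn (x σ) (y σ) (congrFun hx σ) (congrFun hxy σ)
  choose x' y' hx' hy' using h
  exact ⟨x', y', funext hx', funext hy'⟩

end TotalQuasiIso

/-! ### The Euler vector field of the fibres and Cartan's formula -/

namespace DR

section Euler

variable {k : Type*} [CommRing k] {B : Type*} [Ring B] [Algebra k B]
  {ℬ : ℕ → Submodule k B} [GradedAlgebra ℬ]

variable (ℬ) in
/-- The Euler derivation of a graded algebra: multiplication by `i` on `ℬ i`. -/
noncomputable def euler : B →ₗ[k] B :=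
  DirectSum.toModule k ℕ B (fun i => (i : k) • (ℬ i).subtype) ∘ₗ
    (DirectSum.decomposeLinearEquiv ℬ).toLinearMap

theorem euler_of_mem {i : ℕ} {b : B} (hb : b ∈ ℬ i) : euler ℬ b = (i : k) • b := by
  simp only [euler, LinearMap.coe_comp, LinearEquiv.coe_coe, Function.comp_apply,
    DirectSum.decomposeLinearEquiv_apply, DirectSum.decompose_of_mem ℬ hb]
  exact (DirectSum.toModule_lof k (M := fun i => ℬ i) i (⟨b, hb⟩ : ℬ i)).trans rfl

theorem euler_mul (b c : B) : euler ℬ (b * c) = euler ℬ b * c + b * euler ℬ c := by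
  induction b using DirectSum.Decomposition.inductionOn ℬ with
  | zero => simp
  | add x y hx hy => simp only [add_mul, map_add, hx, hy]; abel
  | homogeneous x =>
    induction c using DirectSum.Decomposition.inductionOn ℬ with
    | zero => simp
    | add x y hx hy => simp only [mul_add, map_add, hx, hy]; abel
    | homogeneous y =>
      rw [euler_of_mem x.2, euler_of_mem y.2, euler_of_mem (SetLike.mul_mem_graded x.2 y.2),
        smul_mul_assoc, mul_smul_comm, ← add_smul, Nat.cast_add]

variable [GradedCommutative ℬ]

variable (ℬ) in
/-- The contraction with the Euler vector field is the upper right entry of this algebra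
homomorphism, in the same way as the de Rham differential is that of `dMatrix`. -/
noncomputable def eulerMatrix : DR ℬ →ₐ[k] Matrix (Fin 2) (Fin 2) (DR ℬ) :=
  lift (AlgHom.ofLinearMap
      { toFun := fun b => upper (ofFun ℬ (sgn ℬ b)) 0 (ofFun ℬ b)
        map_add' := fun b c => by simp only [map_add, upper_add, add_zero]
        map_smul' := fun r b => by simp only [map_smul, upper_smul, RingHom.id_apply, smul_zero] }
      (by
        have h2 : sgn ℬ (1 : B) = 1 := (sgnHom ℬ).map_one
        simp only [LinearMap.coe_mk, AddHom.coe_mk, h2, map_one, one_eq_upper])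
      (fun b c => by
        simp only [LinearMap.coe_mk, AddHom.coe_mk, upper_mul, sgn_mul, map_mul, mul_zero,
          zero_mul, add_zero]))
    { toFun := fun b => upper (-dFun ℬ (sgn ℬ b)) (ofFun ℬ (euler ℬ b)) (dFun ℬ b)
      map_add' := fun b c => by simp only [map_add, upper_add, neg_add]
      map_smul' := fun r b => by simp only [map_smul, upper_smul, RingHom.id_apply, smul_neg] }
    (fun i b hb c => by
      simp only [AlgHom.ofLinearMap_apply, LinearMap.coe_mk, AddHom.coe_mk, upper_mul, upper_smul,
        upper_add, sgn_mul, dFun_mul hb, sgn_of_mem hb, map_smul, smul_mul_assoc, smul_add,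
        euler_mul, map_add, map_mul, mul_zero, zero_mul, zero_add, add_zero]
      congr 1
      · simp only [neg_add, neg_mul, mul_neg, smul_neg, smul_mul_assoc]
      · rw [smul_smul, ← pow_add, Even.neg_one_pow ⟨i, rfl⟩, one_smul])
    (fun i j b c hb hc => by
      simp only [AlgHom.ofLinearMap_apply, LinearMap.coe_mk, AddHom.coe_mk, upper_mul, upper_smul,
        sgn_of_mem hb, sgn_of_mem hc, map_smul]
      congr 1
      · simp only [neg_mul, mul_neg, smul_mul_smul_comm, dFun_mul_ofFun hb hc, smul_smul, smul_neg]
        congr 2; ring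
      · have hs : (-1 : k) ^ ((i + 1) * j) * (-1 : k) ^ j = (-1 : k) ^ (i * j) := by
          rw [← pow_add, show (i + 1) * j + j = i * j + (j + j) by ring, pow_add,
            Even.neg_one_pow ⟨j, rfl⟩, mul_one]
        simp only [mul_zero, zero_mul, zero_add, add_zero]
        rw [euler_of_mem hb, map_smul, smul_mul_assoc, mul_smul_comm, smul_mul_assoc,
          smul_comm (i : k) ((-1 : k) ^ j), smul_smul ((-1 : k) ^ ((i + 1) * j)), hs, ← map_mul,
          ← map_mul, GradedCommutative.comm hb hc, map_smul, smul_comm]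
      · exact dFun_mul_ofFun hb hc)
    (fun i j b c hb hc => by
      simp only [LinearMap.coe_mk, AddHom.coe_mk, upper_mul, upper_smul,
        sgn_of_mem hb, sgn_of_mem hc, euler_of_mem hb, euler_of_mem hc, map_smul]
      congr 1
      · simp only [neg_mul, mul_neg, neg_neg, smul_mul_smul_comm, dFun_mul_dFun hb hc, smul_smul]
        congr 1; ring
      · have h₁ : (-1 : k) ^ ((i + 1) * (j + 1)) * (-((-1 : k) ^ j) * (-1 : k) ^ ((j + 1) * i)) =
            1 := by
          rw [← neg_one_mul ((-1 : k) ^ j), ← pow_succ', ← pow_add, ← pow_add]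
          exact Even.neg_one_pow ⟨(j + 1) * (i + 1), by ring⟩
        have h₂ : -((-1 : k) ^ i) * (-1 : k) ^ ((i + 1) * j) = (-1 : k) ^ ((i + 1) * (j + 1)) := by
          rw [← neg_one_mul ((-1 : k) ^ i), ← pow_succ', ← pow_add]
          congr 1; ring
        simp only [← neg_smul, smul_mul_assoc, mul_smul_comm, smul_add]
        rw [dFun_mul_ofFun hc hb, dFun_mul_ofFun hb hc, add_comm]
        congr 1
        · simp only [smul_smul]
          congr 1
          linear_combination -(i : k) * h₁
        · simp only [smul_smul]
          congr 1
          linear_combination (j : k) * h₂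
      · exact dFun_mul_dFun hb hc)

theorem eulerMatrix_ofFun (b : B) :
    eulerMatrix ℬ (ofFun ℬ b) = upper (ofFun ℬ (sgn ℬ b)) 0 (ofFun ℬ b) :=
  lift_ofFun _ _ _ _ _ b

theorem eulerMatrix_dFun (b : B) :
    eulerMatrix ℬ (dFun ℬ b) = upper (-dFun ℬ (sgn ℬ b)) (ofFun ℬ (euler ℬ b)) (dFun ℬ b) :=
  lift_dFun _ _ _ _ _ b

variable (ℬ) in
/-- The contraction of forms with the Euler vector field of the grading of `B`: the graded
derivation with `b ↦ 0` and `d b ↦ euler b`. On functions on `T^*[-1] U` this is the contraction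
with the vector field which generates the scaling of the fibres. -/
noncomputable def contractEuler : DR ℬ →ₗ[k] DR ℬ :=
  Matrix.entryLinearMap k (DR ℬ) 0 1 ∘ₗ (eulerMatrix ℬ).toLinearMap

theorem eulerMatrix_eq (x : DR ℬ) :
    eulerMatrix ℬ x = upper (tau ℬ x) (contractEuler ℬ x) x := by
  suffices h : ∃ b, eulerMatrix ℬ x = upper (tau ℬ x) b x by
    obtain ⟨b, h⟩ := h
    have h2 : contractEuler ℬ x = b := by
      change eulerMatrix ℬ x 0 1 = b
      rw [h]; rfl
    rw [h2, h]
  induction x using induction with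
  | hf b => exact ⟨_, by rw [eulerMatrix_ofFun, tau_ofFun]⟩
  | hd b => exact ⟨_, by rw [eulerMatrix_dFun, tau_dFun]⟩
  | hadd x y hx hy =>
    obtain ⟨b, hx⟩ := hx
    obtain ⟨b', hy⟩ := hy
    exact ⟨_, by rw [map_add, hx, hy, upper_add, map_add]⟩
  | hmul x y hx hy =>
    obtain ⟨b, hx⟩ := hx
    obtain ⟨b', hy⟩ := hy
    exact ⟨_, by rw [map_mul, hx, hy, upper_mul, tau_mul]⟩

@[simp] theorem contractEuler_ofFun (b : B) : contractEuler ℬ (ofFun ℬ b) = 0 :=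
  (upper_inj ((eulerMatrix_eq _).symm.trans (eulerMatrix_ofFun b))).2

@[simp] theorem contractEuler_dFun (b : B) :
    contractEuler ℬ (dFun ℬ b) = ofFun ℬ (euler ℬ b) :=
  (upper_inj ((eulerMatrix_eq _).symm.trans (eulerMatrix_dFun b))).2

theorem contractEuler_mul (x y : DR ℬ) :
    contractEuler ℬ (x * y) = contractEuler ℬ x * y + tau ℬ x * contractEuler ℬ y := by
  have := eulerMatrix_eq (x * y)
  rw [map_mul, eulerMatrix_eq, eulerMatrix_eq y, upper_mul] at this
  rw [← (upper_inj this).2, add_comm]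

theorem contractEuler_of_mem_zero {m : ℤ} {x : DR ℬ} (hx : x ∈ piece ℬ 0 m) :
    contractEuler ℬ x = 0 := by
  suffices h : ∀ w, x ∈ piece ℬ w m → w = 0 → contractEuler ℬ x = 0 from h 0 hx rfl
  clear hx
  intro w hx
  induction hx using piece_induction with
  | hf i b hb => exact fun _ => contractEuler_ofFun b
  | hd w l x i b hx hb ih => exact fun h => absurd h (Nat.succ_ne_zero w)
  | hadd w m x y _ _ hx hy => exact fun h => by rw [map_add, hx h, hy h, add_zero]
  | hsmul w m r x _ hx => exact fun h => by rw [map_smul, hx h, smul_zero]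
  | hzero => exact fun _ => map_zero _

theorem contractEuler_mem {w : ℕ} {m : ℤ} {x : DR ℬ} (hx : x ∈ piece ℬ (w + 1) m) :
    contractEuler ℬ x ∈ piece ℬ w (m - 1) := by
  suffices h : ∀ v, x ∈ piece ℬ v m → ∀ w, v = w + 1 → contractEuler ℬ x ∈ piece ℬ w (m - 1) from
    h _ hx _ rfl
  clear hx
  intro v hx
  induction hx using piece_induction with
  | hf i b hb => exact fun w h => absurd h.symm (Nat.succ_ne_zero w)
  | hd w l x i b hx hb ih =>
    intro v hv
    obtain rfl : w = v := by omega
    rw [contractEuler_mul, contractEuler_dFun, euler_of_mem hb, tau_of_mem hx, map_smul,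
      mul_smul_comm, smul_mul_assoc]
    refine add_mem ?_ (Submodule.smul_mem _ _ (Submodule.smul_mem _ _ ?_))
    · rcases w with _ | w
      · rw [contractEuler_of_mem_zero hx, zero_mul]
        exact zero_mem _
      · convert mul_dFun_mem (ih w rfl) hb using 2
        ring
    · convert mul_ofFun_mem hx hb using 2
      ring
  | hadd w m x y _ _ hx hy => exact fun v h => by rw [map_add]; exact add_mem (hx v h) (hy v h)
  | hsmul w m r x _ hx => exact fun v h => by rw [map_smul]; exact Submodule.smul_mem _ _ (hx v h)
  | hzero => exact fun v _ => by rw [map_zero]; exact zero_mem _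

/-- Cartan's formula for the Euler vector field: the Lie derivative multiplies a form by its degree
in the fibre coordinates, which on weight `w` and degree `m` is `w - m`. -/
theorem d_contractEuler_add {w : ℕ} {m : ℤ} {x : DR ℬ} (hx : x ∈ piece ℬ w m) :
    d ℬ (contractEuler ℬ x) + contractEuler ℬ (d ℬ x) = ((w : k) - (m : k)) • x := by
  induction hx using piece_induction with
  | hf i b hb =>
    rw [contractEuler_ofFun, map_zero, zero_add, d_ofFun, contractEuler_dFun, euler_of_mem hb,
      map_smul]
    simp
  | hd w l x i b hx hb ih =>
    have ht : tau ℬ (tau ℬ x) = x := by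
      rw [tau_of_mem hx, map_smul, tau_of_mem hx, smul_smul, sg_mul_self, one_smul]
    have h : d ℬ (contractEuler ℬ (x * dFun ℬ b)) + contractEuler ℬ (d ℬ (x * dFun ℬ b)) =
        (d ℬ (contractEuler ℬ x) + contractEuler ℬ (d ℬ x)) * dFun ℬ b +
          x * dFun ℬ (euler ℬ b) := by
      simp only [contractEuler_mul, d_mul, map_add, d_dFun, contractEuler_dFun, d_ofFun, d_tau, ht,
        mul_zero, add_zero, add_mul, neg_mul]
      abel
    rw [h, ih, euler_of_mem hb, map_smul, smul_mul_assoc, mul_smul_comm, ← add_smul]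
    congr 1
    push_cast
    ring
  | hadd w m x y _ _ hx hy => rw [smul_add, ← hx, ← hy]; simp only [map_add]; abel
  | hsmul w m r x _ hx => rw [smul_comm, ← hx]; simp only [map_smul, smul_add]
  | hzero => simp

theorem eq_zero_of_mem_piece_of_lt {w : ℕ} {m : ℤ} {x : DR ℬ} (hx : x ∈ piece ℬ w m)
    (h : (w : ℤ) < m) : x = 0 := by
  induction hx using piece_induction with
  | hf i b hb => exact absurd h (by push_cast; omega)
  | hd w l x i b hx hb ih => rw [ih (by push_cast at h; omega), zero_mul]
  | hadd w m x y _ _ hx hy => rw [hx h, hy h, add_zero]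
  | hsmul w m r x _ hx => rw [hx h, smul_zero]
  | hzero => rfl

theorem eq_zero_of_mem_piece_constGrading {A : Type*} [CommRing A] [Algebra k A] {w : ℕ} {m : ℤ}
    {x : DR (constGrading k A)} (hx : x ∈ piece (constGrading k A) w m) (h : (w : ℤ) ≠ m) :
    x = 0 := by
  induction hx using piece_induction with
  | hf i b hb =>
    rw [eq_zero_of_mem_constGrading k A (by rintro rfl; exact h (by simp)) hb, map_zero]
  | hd w l x i b hx hb ih =>
    rcases eq_or_ne (w : ℤ) l with rfl | hl
    · rw [eq_zero_of_mem_constGrading k A (by rintro rfl; exact h (by simp)) hb, map_zero, mul_zero]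
    · rw [ih hl, zero_mul]
  | hadd w m x y _ _ hx hy => rw [hx h, hy h, add_zero]
  | hsmul w m r x _ hx => rw [hx h, smul_zero]
  | hzero => rfl

end Euler

/-! ### The twisted de Rham complex and the zero section -/

section ZeroSection

variable {k : Type u} [Field k] [CharZero k] {B A : Type u} [Ring B] [Algebra k B] [CommRing A]
  [Algebra k A] {ℬ : ℕ → Submodule k B} [GradedAlgebra ℬ] [GradedCommutative ℬ]

variable (ℬ) in
/-- The contraction with the Euler vector field divided by the degree in the fibre coordinates.
It is `0` where this degree is `0`. -/
noncomputable def homotopyPiece (w : ℕ) {l m : ℤ} (h : l + 1 = m) :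
    piece ℬ (w + 1) m →ₗ[k] piece ℬ w l :=
  (((w + 1 : ℕ) : k) - (m : k))⁻¹ • (contractEuler ℬ).restrict (fun _ hx => by
    obtain rfl : l = m - 1 := by omega
    exact contractEuler_mem hx)

theorem homotopyPiece_eq_zero {w : ℕ} {l m : ℤ} (h : l + 1 = m) (hw : (w : ℤ) = l)
    (x : piece ℬ (w + 1) m) : homotopyPiece ℬ w h x = 0 := by
  have h0 : ((w + 1 : ℕ) : k) - (m : k) = 0 := by
    rw [← h, ← hw]; push_cast; ring
  rw [homotopyPiece, h0, inv_zero, zero_smul, LinearMap.zero_apply]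

/-- Poincaré lemma: a closed form is exact, unless it has degree `0` in the fibre coordinates. -/
theorem d_homotopyPiece {w : ℕ} {l m : ℤ} (h : l + 1 = m) (x : piece ℬ (w + 1) m)
    (hx : d ℬ x = 0) (h0 : ((w + 1 : ℕ) : ℤ) = m → x = 0) :
    d ℬ (homotopyPiece ℬ w h x) = x := by
  by_cases hw : ((w + 1 : ℕ) : ℤ) = m
  · rw [h0 hw, map_zero]; exact map_zero _
  · have hne : ((w + 1 : ℕ) : k) - (m : k) ≠ 0 := by
      rw [sub_ne_zero]
      exact fun h => hw (by exact_mod_cast h)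
    have := d_contractEuler_add x.2
    rw [hx, map_zero, add_zero] at this
    change d ℬ ((((w + 1 : ℕ) : k) - (m : k))⁻¹ • contractEuler ℬ x) = x
    rw [map_smul, this, inv_smul_smul₀ hne]

/-- The kernel of the restriction to the zero section is acyclic for the twisted differential. The
equations `d (u w) = x (w + 1) - ω ∧ u (w - 1)` for a primitive `u` of `x` are solved
successively, weight by weight, and the product of all weights contains the solution. -/
theorem exists_twistedD_eq (ω : ClosedTwoForm ℬ) {l m n : ℤ} (h : l + 1 = m) (h' : m + 1 = n)
    (x : ∀ w : ℕ, piece ℬ w m) (hx : twistedD ω h' x = 0) (h0 : ∀ w : ℕ, (w : ℤ) = m → x w = 0) :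
    ∃ u : ∀ w : ℕ, piece ℬ w l, twistedD ω h u = x ∧ ∀ w : ℕ, (w : ℤ) = l → u w = 0 := by
  have hx1 : d ℬ (x 0) = 0 := (twistedD_one ω h' x).symm.trans (by rw [hx]; rfl)
  have hx2 : ∀ w, d ℬ (x (w + 1)) + ω.val * x w = 0 := fun w =>
    (twistedD_add_two ω h' x w).symm.trans (by rw [hx]; rfl)
  have hx0 : x 0 = 0 := by
    by_cases hm : ((0 : ℕ) : ℤ) = m
    · exact h0 0 hm
    · have := d_contractEuler_add (x 0).2
      rw [hx1, contractEuler_of_mem_zero (x 0).2, map_zero, map_zero, zero_add, eq_comm,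
        smul_eq_zero_iff_right] at this
      · exact Subtype.ext this
      · rw [sub_ne_zero]
        exact fun h => hm (by exact_mod_cast h)
  obtain ⟨u, hu0, hu1⟩ : ∃ u : ∀ w : ℕ, piece ℬ w l, u 0 = homotopyPiece ℬ 0 h (x 1) ∧
      ∀ w, u (w + 1) = homotopyPiece ℬ (w + 1) h (x (w + 2) - wedgePiece ω w h (u w)) :=
    ⟨fun w => Nat.rec (homotopyPiece ℬ 0 h (x 1))
      (fun w uw => homotopyPiece ℬ (w + 1) h (x (w + 2) - wedgePiece ω w h uw)) w, rfl,
      fun _ => rfl⟩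
  have hd0 : d ℬ (u 0) = x 1 := by
    rw [hu0]
    exact d_homotopyPiece h _
      (by have := hx2 0; rwa [hx0, Submodule.coe_zero, mul_zero, add_zero] at this) (h0 1)
  have hd1 : ∀ w, d ℬ (u (w + 1)) = x (w + 2) - ω.val * u w := by
    intro w
    have hωd : ω.val * d ℬ (u w) = ω.val * x (w + 1) := by
      induction w with
      | zero => rw [hd0]
      | succ w ih =>
        rw [hu1, d_homotopyPiece h]
        · change ω.val * (x (w + 2) - ω.val * u w) = _
          rw [mul_sub, ← mul_assoc, ω.mul_self, zero_mul, sub_zero]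
        · change d ℬ (x (w + 2) - ω.val * u w) = 0
          rw [map_sub, sub_eq_add_neg, neg_eq_of_add_eq_zero_right (d_wedge ω (u w)), ih, hx2]
        · intro hw
          have : u w = 0 := Subtype.ext
            (eq_zero_of_mem_piece_of_lt (u w).2 (by push_cast at hw; omega))
          rw [h0 _ hw, this, map_zero, sub_zero]
    rw [hu1, d_homotopyPiece h]
    · rfl
    · change d ℬ (x (w + 2) - ω.val * u w) = 0
      rw [map_sub, sub_eq_add_neg, neg_eq_of_add_eq_zero_right (d_wedge ω (u w)), hωd, hx2]
    · intro hw
      have : u w = 0 := Subtype.ext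
        (eq_zero_of_mem_piece_of_lt (u w).2 (by push_cast at hw; omega))
      rw [h0 _ hw, this, map_zero, sub_zero]
  refine ⟨u, ?_, ?_⟩
  · funext w
    apply Subtype.ext
    match w with
    | 0 => rw [twistedD_zero, hx0]; rfl
    | 1 => rw [twistedD_one, hd0]
    | w + 2 => rw [twistedD_add_two, hd1, sub_add_cancel]
  · intro w hw
    rcases w with _ | w
    · rw [hu0]; exact homotopyPiece_eq_zero h hw _
    · rw [hu1]; exact homotopyPiece_eq_zero h hw _

/-- On a form of degree `0` in the fibre coordinates, the restriction to the zero section has the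
inverse image along the projection as a left inverse. -/
theorem map_map_of_mem_diagonal (f : B →ₐ[k] A) (hf : ∀ i, ∀ b ∈ ℬ i, f b ∈ constGrading k A i)
    (s : A →ₐ[k] B) (hs : ∀ i, ∀ a ∈ constGrading k A i, s a ∈ ℬ i)
    (hsf : ∀ b ∈ ℬ 0, s (f b) = b) {w : ℕ} {m : ℤ} {x : DR ℬ} (hx : x ∈ piece ℬ w m)
    (h : (w : ℤ) = m) : map s hs (map f hf x) = x := by
  induction hx using piece_induction with
  | hf i b hb =>
    obtain rfl : i = 0 := by push_cast at h; omega
    rw [map_ofFun, map_ofFun, hsf b hb]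
  | hd w l x i b hx hb ih =>
    rcases lt_or_ge (w : ℤ) l with hl | hl
    · rw [eq_zero_of_mem_piece_of_lt hx hl]; simp
    · obtain rfl : i = 0 := by push_cast at h; omega
      rw [map_mul, map_mul, ih (by push_cast at h; omega), map_dFun, map_dFun, hsf b hb]
  | hadd w m x y _ _ hx hy => rw [map_add, map_add, hx h, hy h]
  | hsmul w m r x _ hx => rw [map_smul, map_smul, hx h]
  | hzero => simp

/-- The restriction of the twisted de Rham complex to the zero section is a
quasi-isomorphism. -/
theorem quasiIso_twistedMap (f : B →ₐ[k] A) (hf : ∀ i, ∀ b ∈ ℬ i, f b ∈ constGrading k A i)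
    (s : A →ₐ[k] B) (hs : ∀ i, ∀ a ∈ constGrading k A i, s a ∈ ℬ i)
    (hfs : f.comp s = AlgHom.id k A) (hsf : ∀ b ∈ ℬ 0, s (f b) = b) (ω : ClosedTwoForm ℬ)
    (hω : map f hf ω.val = (0 : ClosedTwoForm (constGrading k A)).val) :
    QuasiIso (twistedMap f hf ω 0 hω) := by
  refine quasiIso_of_coneExactAt _ fun l m n t hl hm hn => ?_
  intro x y hx hxy
  have hφ : ∀ {m n : ℤ} (z : (twistedComplex ω).X m),
      ((twistedMap f hf ω 0 hω).f n).hom (((twistedComplex ω).d m n).hom z) =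
        ((twistedComplex (0 : ClosedTwoForm (constGrading k A))).d m n).hom
          (((twistedMap f hf ω 0 hω).f m).hom z) := hom_d_comm _
  let x₀ : (twistedComplex ω).X m := fun w => ⟨map s hs (y w), map_mem s hs (y w).2⟩
  have hx₀ : ((twistedMap f hf ω 0 hω).f m).hom x₀ = y := by
    funext w
    apply Subtype.ext
    rw [twistedMap_f_apply]
    refine (map_map s hs f hf _).trans ?_
    have key : ∀ (e : A →ₐ[k] A) (he : ∀ i, ∀ b ∈ constGrading k A i, e b ∈ constGrading k A i),
        e = AlgHom.id k A → ∀ z, map e he z = z := by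
      rintro e he rfl z
      exact map_id z
    exact key _ _ hfs _
  let z := x - ((twistedComplex ω).d m n).hom x₀
  have hz : ((twistedComplex ω).d n t).hom z = 0 := by
    rw [map_sub, hx, d_d_apply, sub_zero]
  have hz' : ((twistedMap f hf ω 0 hω).f n).hom z = 0 := by
    rw [map_sub, hφ, hx₀, hxy, sub_self]
  have hz₀ : ∀ w : ℕ, (w : ℤ) = n → (z : ∀ w : ℕ, piece ℬ w n) w = 0 := by
    intro w hw
    apply Subtype.ext
    have h := map_map_of_mem_diagonal f hf s hs hsf (z w).2 hw
    rw [← twistedMap_f_apply f hf ω 0 hω n z w, hz'] at h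
    exact h.symm.trans (map_zero _)
  dsimp only [twistedComplex] at hz
  rw [dif_pos hn] at hz
  obtain ⟨v, hv, hv₀⟩ := exists_twistedD_eq ω hm hn z hz hz₀
  have hv' : ((twistedComplex ω).d m n).hom v = z := by
    dsimp only [twistedComplex]
    rw [dif_pos hm]
    exact hv
  refine ⟨x₀ + (show (twistedComplex ω).X m from v), 0, ?_, ?_⟩
  · rw [map_add, hv']; exact add_sub_cancel _ _
  · rw [map_add, hx₀, map_zero, add_zero]
    suffices h : ((twistedMap f hf ω 0 hω).f m).hom v = 0 by rw [h, add_zero]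
    funext w
    apply Subtype.ext
    change map f hf (v w : DR ℬ) = 0
    by_cases hw : (w : ℤ) = m
    · rw [hv₀ w hw]; exact map_zero _
    · exact eq_zero_of_mem_piece_constGrading (map_mem f hf (v w).2) hw

end ZeroSection

end DR

/-! ### Exterior algebras of modules with a dual family -/

section DualFamily

variable {A : Type*} [CommRing A] {M : Type*} [AddCommGroup M] [Module A M]

theorem contractLeft_ι_mul' (φ : Module.Dual A M) (a : M) (x : ExteriorAlgebra A M) :
    CliffordAlgebra.contractLeft φ (ExteriorAlgebra.ι A a * x) =
      φ a • x - ExteriorAlgebra.ι A a * CliffordAlgebra.contractLeft φ x :=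
  CliffordAlgebra.contractLeft_ι_mul φ a x

theorem contractLeft_algebraMap' (φ : Module.Dual A M) (a : A) :
    CliffordAlgebra.contractLeft φ (algebraMap A (ExteriorAlgebra A M) a) = 0 :=
  CliffordAlgebra.contractLeft_algebraMap _ φ a

theorem ι_mul_mem {i : ℕ} {x : ExteriorAlgebra A M} (m : M) (hx : x ∈ ⋀[A]^i M) :
    ExteriorAlgebra.ι A m * x ∈ ⋀[A]^(i + 1) M := by
  change _ ∈ LinearMap.range (ExteriorAlgebra.ι A : M →ₗ[A] _) ^ (i + 1)
  rw [pow_succ']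
  exact Submodule.mul_mem_mul (LinearMap.mem_range_self _ _) hx

theorem exists_algebraMap_eq_of_mem_zero {x : ExteriorAlgebra A M} (hx : x ∈ ⋀[A]^0 M) :
    ∃ a, algebraMap A (ExteriorAlgebra A M) a = x := by
  change x ∈ LinearMap.range (ExteriorAlgebra.ι A : M →ₗ[A] _) ^ 0 at hx
  rw [pow_zero] at hx
  exact Submodule.mem_one.1 hx

theorem contractLeft_of_mem_zero (φ : Module.Dual A M) {x : ExteriorAlgebra A M}
    (hx : x ∈ ⋀[A]^0 M) : CliffordAlgebra.contractLeft φ x = 0 := by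
  obtain ⟨a, rfl⟩ := exists_algebraMap_eq_of_mem_zero hx
  exact contractLeft_algebraMap' φ a

theorem contractLeft_mem (φ : Module.Dual A M) {i : ℕ} {x : ExteriorAlgebra A M}
    (hx : x ∈ ⋀[A]^(i + 1) M) : CliffordAlgebra.contractLeft φ x ∈ ⋀[A]^i M := by
  induction i generalizing x with
  | zero =>
    have hx' : x ∈ LinearMap.range (ExteriorAlgebra.ι A : M →ₗ[A] _) := by
      simpa only [zero_add, pow_one] using hx
    obtain ⟨m, rfl⟩ := hx'
    have := contractLeft_ι_mul' φ m 1
    rw [mul_one, ← map_one (algebraMap A (ExteriorAlgebra A M)), contractLeft_algebraMap', mul_zero,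
      sub_zero] at this
    rw [this]
    exact Submodule.smul_mem _ _ (Submodule.algebraMap_mem 1)
  | succ i ih =>
    have hx' : x ∈ LinearMap.range (ExteriorAlgebra.ι A : M →ₗ[A] _) * ⋀[A]^(i + 1) M := by
      rw [← pow_succ']; exact hx
    induction hx' using Submodule.mul_induction_on' with
    | mem_mul_mem a ha y hy =>
      obtain ⟨m, rfl⟩ := ha
      rw [contractLeft_ι_mul']
      exact sub_mem (Submodule.smul_mem _ _ hy) (ι_mul_mem m (ih hy))
    | add x hxx y hyy h h' =>
      rw [map_add]
      have key : ∀ z, z ∈ LinearMap.range (ExteriorAlgebra.ι A : M →ₗ[A] _) * ⋀[A]^(i + 1) M →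
          z ∈ ⋀[A]^(i + 1 + 1) M := fun z hz => by
        rw [← pow_succ'] at hz; exact hz
      exact add_mem (h (key x hxx)) (h' (key y hyy))

variable {r : ℕ} {e : Fin r → M} {φ : Fin r → Module.Dual A M}

/-- If `∑ j, φ j ⊗ e j` is the canonical element of `M^* ⊗ M`, then `∑ j, e j ∧ (φ j ⌋ -)` is the
operator which multiplies by the degree. -/
theorem sum_ι_mul_contractLeft (h : ∀ m, ∑ j, φ j m • e j = m) {q : ℕ}
    {y : ExteriorAlgebra A M} (hy : y ∈ ⋀[A]^q M) :
    ∑ j, ExteriorAlgebra.ι A (e j) * CliffordAlgebra.contractLeft (φ j) y = (q : A) • y := by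
  induction hy using Submodule.pow_induction_on_left' with
  | algebraMap a => simp
  | add x y i _ _ hx hy => simp only [map_add, mul_add, Finset.sum_add_distrib, hx, hy, smul_add]
  | mem_mul m hm i x _ hx =>
    obtain ⟨m, rfl⟩ := hm
    have h1 : ∀ j, ExteriorAlgebra.ι A (e j) *
        CliffordAlgebra.contractLeft (φ j) (ExteriorAlgebra.ι A m * x) =
        ExteriorAlgebra.ι A (φ j m • e j) * x + ExteriorAlgebra.ι A m *
          (ExteriorAlgebra.ι A (e j) * CliffordAlgebra.contractLeft (φ j) x) := fun j => by
      rw [contractLeft_ι_mul', mul_sub, map_smul, mul_smul_comm, smul_mul_assoc, ← mul_assoc,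
        ← mul_assoc, eq_neg_of_add_eq_zero_left (ExteriorAlgebra.ι_add_mul_swap (e j) m), neg_mul,
        sub_neg_eq_add]
    simp only [h1, Finset.sum_add_distrib, ← Finset.sum_mul, ← Finset.mul_sum, ← map_sum, h, hx,
      mul_smul_comm]
    rw [Nat.cast_succ, add_smul, one_smul, add_comm]

/-- The operator `∑ j, φ j ⌋ (e j ∧ -)` on `⋀^q M` is the multiplication by the rank of `M` minus
`q`. The rank of a projective module is the trace of its identity map. -/
theorem sum_contractLeft_ι_mul (h : ∀ m, ∑ j, φ j m • e j = m) {n : ℕ}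
    (hn : ∑ j, φ j (e j) = n) {q : ℕ} {y : ExteriorAlgebra A M} (hy : y ∈ ⋀[A]^q M) :
    ∑ j, CliffordAlgebra.contractLeft (φ j) (ExteriorAlgebra.ι A (e j) * y) =
      ((n : A) - q) • y := by
  simp only [contractLeft_ι_mul', Finset.sum_sub_distrib, ← Finset.sum_smul, hn,
    sum_ι_mul_contractLeft h hy, sub_smul]

theorem exteriorPower_eq_zero_of_gt (h : ∀ m, ∑ j, φ j m • e j = m) {q : ℕ} (hq : r < q)
    {y : ExteriorAlgebra A M} (hy : y ∈ ⋀[A]^q M) : y = 0 := by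
  have hs : Submodule.span A (Set.range e) = ⊤ := by
    rw [eq_top_iff]
    rintro m -
    rw [← h m]
    exact Submodule.sum_mem _ fun j _ =>
      Submodule.smul_mem _ _ (Submodule.subset_span (Set.mem_range_self j))
  rw [← exteriorPower.ιMulti_span_fixedDegree_of_span_eq_top A q M hs] at hy
  induction hy using Submodule.span_induction with
  | mem x hx =>
    obtain ⟨a, ha, rfl⟩ := hx
    obtain ⟨α, rfl⟩ := Set.range_subset_range_iff_exists_comp.1 ha
    obtain ⟨i, j, hij, hα⟩ := Fintype.exists_ne_map_eq_of_card_lt α (by simpa using hq)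
    exact (ExteriorAlgebra.ιMulti A q).map_eq_zero_of_eq (i := i) (j := j) _
      (congrArg e hα) hij
  | zero => rfl
  | add x y _ _ hx hy => rw [hx, hy, add_zero]
  | smul a x _ hx => rw [hx, smul_zero]

/-- The exterior powers of a module above its rank vanish. -/
theorem exteriorPower_eq_zero_of_rank_lt (k : Type*) [Field k] [CharZero k] [Algebra k A]
    (h : ∀ m, ∑ j, φ j m • e j = m) {n : ℕ}
    (hn : ∑ j, φ j (e j) = n) {q : ℕ} (hq : n < q) {y : ExteriorAlgebra A M}
    (hy : y ∈ ⋀[A]^q M) : y = 0 := by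
  -- Descending induction on `q`, since `e j ∧ y` vanishes and `n - q` is invertible.
  suffices H : ∀ s q, n < q → r < q + s → ∀ y : ExteriorAlgebra A M, y ∈ ⋀[A]^q M → y = 0 from
    H (r + 1) q hq (by omega) y hy
  intro s
  induction s with
  | zero => exact fun q _ hs y hy => exteriorPower_eq_zero_of_gt h hs hy
  | succ s ih =>
    intro q hq hs y hy
    have h1 := sum_contractLeft_ι_mul h hn hy
    rw [Finset.sum_eq_zero fun j _ => by
      rw [ih (q + 1) (by omega) (by omega) _ (ι_mul_mem (e j) hy), map_zero]] at h1
    have h2 : ((n : A) - q) = algebraMap k A (n - q) := by simp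
    have h3 : (n : k) - q ≠ 0 := by
      rw [sub_ne_zero]
      exact fun h => hq.ne (by exact_mod_cast h)
    have h4 : algebraMap k A ((n : k) - q)⁻¹ • ((n : A) - q) • y = 0 := by rw [← h1, smul_zero]
    rwa [h2, smul_smul, ← map_mul, inv_mul_cancel₀ h3, map_one, one_smul] at h4

end DualFamily

/-! ### Differential forms as an exterior algebra -/

section Forms

variable {k : Type*} [Field k] [CharZero k] {A : Type*} [CommRing A] [Algebra k A]

theorem ofFun_commute (a : A) (x : DR (constGrading k A)) :
    DR.ofFun _ a * x = x * DR.ofFun _ a := by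
  have ha := mem_constGrading_zero k A a
  induction x using DR.induction with
  | hf b => rw [← map_mul, ← map_mul, mul_comm]
  | hd b =>
    have := DR.dFun_mul_ofFun (mem_constGrading_zero k A b) ha
    rw [mul_zero, pow_zero, one_smul] at this
    exact this.symm
  | hadd x y hx hy => rw [mul_add, add_mul, hx, hy]
  | hmul x y hx hy => rw [← mul_assoc, hx, mul_assoc, hy, mul_assoc]

variable (k A) in
/-- The `A`-algebra structure of `DR A`. -/
@[reducible] noncomputable def drAlgebra : Algebra A (DR (constGrading k A)) :=
  (DR.ofFun (constGrading k A)).toRingHom.toAlgebra' ofFun_commute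

variable (k A) in
/-- The inclusion of the Kähler differentials into `DR A`. -/
noncomputable def oneFormToDR :
    letI := drAlgebra k A
    Ω[A⁄k] →ₗ[A] DR (constGrading k A) :=
  letI := drAlgebra k A
  haveI : IsScalarTower k A (DR (constGrading k A)) :=
    IsScalarTower.of_algebraMap_eq' (DR.ofFun (constGrading k A)).comp_algebraMap.symm
  (Derivation.mk' (DR.dFun (constGrading k A)) (fun a b => by
    have h1 := DR.dFun_mul (mem_constGrading_zero k A a) b
    rw [pow_zero, one_smul, ← ofFun_commute, add_comm] at h1
    exact h1)).liftKaehlerDifferential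

theorem oneFormToDR_D (b : A) :
    oneFormToDR k A (KaehlerDifferential.D k A b) = DR.dFun _ b :=
  letI := drAlgebra k A
  haveI : IsScalarTower k A (DR (constGrading k A)) :=
    IsScalarTower.of_algebraMap_eq' (DR.ofFun (constGrading k A)).comp_algebraMap.symm
  Derivation.liftKaehlerDifferential_comp_D _ b

theorem oneFormToDR_smul (a : A) (α : Ω[A⁄k]) :
    oneFormToDR k A (a • α) = DR.ofFun _ a * oneFormToDR k A α :=
  letI := drAlgebra k A
  (oneFormToDR k A).map_smul a α

theorem oneFormToDR_mem (α : Ω[A⁄k]) :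
    oneFormToDR k A α ∈ DR.piece (constGrading k A) 1 1 := by
  refine form_induction (p := fun α => oneFormToDR k A α ∈ DR.piece (constGrading k A) 1 1)
    (fun b => ?_) (fun x y hx hy => ?_) (fun a x hx => ?_) α
  · rw [oneFormToDR_D, ← DR.d_ofFun]
    simpa using DR.d_mem (DR.ofFun_mem (mem_constGrading_zero k A b))
  · rw [map_add]; exact add_mem hx hy
  · rw [oneFormToDR_smul, ofFun_commute]
    have := DR.mul_ofFun_mem hx (mem_constGrading_zero k A a)
    rwa [Nat.cast_zero, sub_zero] at this

theorem oneFormToDR_mul_self (α : Ω[A⁄k]) : oneFormToDR k A α * oneFormToDR k A α = 0 := by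
  have h := DR.mul_comm_of_mem (oneFormToDR_mem α) (oneFormToDR_mem α)
  rw [mul_one, DR.sg_one, neg_smul, one_smul, eq_neg_iff_add_eq_zero, ← two_smul k] at h
  exact (smul_eq_zero_iff_right (two_ne_zero (α := k))).1 h

variable (k A) in
/-- The canonical homomorphism from the exterior algebra of the Kähler differentials to `DR A`. -/
noncomputable def formsToDR : ExteriorAlgebra A Ω[A⁄k] →ₐ[k] DR (constGrading k A) :=
  letI := drAlgebra k A
  haveI : IsScalarTower k A (DR (constGrading k A)) :=
    IsScalarTower.of_algebraMap_eq' (DR.ofFun (constGrading k A)).comp_algebraMap.symm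
  (ExteriorAlgebra.lift A ⟨oneFormToDR k A, oneFormToDR_mul_self⟩).restrictScalars k

theorem formsToDR_algebraMap (a : A) :
    formsToDR k A (algebraMap A _ a) = DR.ofFun _ a :=
  letI := drAlgebra k A
  (ExteriorAlgebra.lift A ⟨oneFormToDR k A, oneFormToDR_mul_self⟩).commutes a

theorem formsToDR_ι (α : Ω[A⁄k]) :
    formsToDR k A (ExteriorAlgebra.ι A α) = oneFormToDR k A α :=
  letI := drAlgebra k A
  ExteriorAlgebra.lift_ι_apply A _ _ α

theorem formsToDR_ι_D (b : A) :
    formsToDR k A (ExteriorAlgebra.ι A (KaehlerDifferential.D k A b)) = DR.dFun _ b := by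
  rw [formsToDR_ι, oneFormToDR_D]

theorem formsToDR_smul (a : A) (y : ExteriorAlgebra A Ω[A⁄k]) :
    formsToDR k A (a • y) = DR.ofFun _ a * formsToDR k A y := by
  rw [Algebra.smul_def, map_mul, formsToDR_algebraMap]

theorem formsToDR_mem {q : ℕ} {y : ExteriorAlgebra A Ω[A⁄k]} (hy : y ∈ ⋀[A]^q Ω[A⁄k]) :
    formsToDR k A y ∈ DR.piece (constGrading k A) q q := by
  induction hy using Submodule.pow_induction_on_left' with
  | algebraMap a =>
    rw [formsToDR_algebraMap]
    simpa using DR.ofFun_mem (mem_constGrading_zero k A a)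
  | add x y i _ _ hx hy => rw [map_add]; exact add_mem hx hy
  | mem_mul m hm i x _ hx =>
    obtain ⟨m, rfl⟩ := hm
    rw [map_mul, formsToDR_ι]
    convert DR.mul_mem (oneFormToDR_mem m) hx using 2
    · exact Nat.succ_eq_one_add _
    · push_cast; ring

variable (k A) in
/-- The inverse of `formsToDR`, given by the universal property of `DR A`. -/
noncomputable def drToForms : DR (constGrading k A) →ₐ[k] ExteriorAlgebra A Ω[A⁄k] :=
  DR.lift (IsScalarTower.toAlgHom k A _)
    ((ExteriorAlgebra.ι A).restrictScalars k ∘ₗ (KaehlerDifferential.D k A).toLinearMap)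
    (fun i b hb c => by
      rcases eq_or_ne i 0 with rfl | hi
      · simp [Algebra.smul_def, ← Algebra.commutes]
        rw [add_comm]
      · rw [eq_zero_of_mem_constGrading k A hi hb]; simp)
    (fun i j b c hb hc => by
      rcases eq_or_ne j 0 with rfl | hj
      · simp [← Algebra.commutes]
      · rw [eq_zero_of_mem_constGrading k A hj hc]; simp)
    (fun i j b c hb hc => by
      rcases eq_or_ne i 0 with rfl | hi
      · rcases eq_or_ne j 0 with rfl | hj
        · simpa using eq_neg_of_add_eq_zero_left (ExteriorAlgebra.ι_add_mul_swap (R := A)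
            (KaehlerDifferential.D k A b) (KaehlerDifferential.D k A c))
        · rw [eq_zero_of_mem_constGrading k A hj hc]; simp
      · rw [eq_zero_of_mem_constGrading k A hi hb]; simp)

theorem drToForms_ofFun (a : A) : drToForms k A (DR.ofFun _ a) = algebraMap A _ a :=
  DR.lift_ofFun _ _ _ _ _ a

theorem drToForms_dFun (a : A) :
    drToForms k A (DR.dFun _ a) = ExteriorAlgebra.ι A (KaehlerDifferential.D k A a) :=
  DR.lift_dFun _ _ _ _ _ a

theorem drToForms_formsToDR (y : ExteriorAlgebra A Ω[A⁄k]) :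
    drToForms k A (formsToDR k A y) = y := by
  have h : (drToForms k A).comp (formsToDR k A) = AlgHom.id k _ := by
    apply exterior_algHom_ext
    · intro a
      rw [AlgHom.comp_apply, formsToDR_algebraMap, drToForms_ofFun, AlgHom.id_apply]
    · intro α
      rw [AlgHom.comp_apply, AlgHom.id_apply]
      refine form_induction (p := fun α => drToForms k A (formsToDR k A (ExteriorAlgebra.ι A α)) =
        ExteriorAlgebra.ι A α) (fun b => ?_) (fun x y hx hy => ?_) (fun a x hx => ?_) α
      · rw [formsToDR_ι_D, drToForms_dFun]
      · rw [map_add, map_add, map_add, hx, hy]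
      · rw [map_smul, formsToDR_smul, map_mul, drToForms_ofFun, hx, ← Algebra.smul_def]
  exact congrArg (fun f => f y) h

theorem formsToDR_drToForms (x : DR (constGrading k A)) :
    formsToDR k A (drToForms k A x) = x := by
  have h : (formsToDR k A).comp (drToForms k A) = AlgHom.id k _ := by
    apply DR.algHom_ext
    · intro a
      rw [AlgHom.comp_apply, drToForms_ofFun, formsToDR_algebraMap, AlgHom.id_apply]
    · intro a
      rw [AlgHom.comp_apply, drToForms_dFun, formsToDR_ι_D, AlgHom.id_apply]
  exact congrArg (fun f => f x) h

theorem drToForms_mem {w : ℕ} {m : ℤ} {x : DR (constGrading k A)}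
    (hx : x ∈ DR.piece (constGrading k A) w m) : drToForms k A x ∈ ⋀[A]^w Ω[A⁄k] := by
  induction hx using DR.piece_induction with
  | hf i b hb => rw [drToForms_ofFun]; exact Submodule.algebraMap_mem b
  | hd w l x i b hx hb ih =>
    rw [map_mul, drToForms_dFun]
    exact Submodule.mul_mem_mul ih (LinearMap.mem_range_self _ _)
  | hadd w m x y _ _ hx hy => rw [map_add]; exact add_mem hx hy
  | hsmul w m r x _ hx => rw [map_smul, ← algebraMap_smul A r]; exact Submodule.smul_mem _ _ hx
  | hzero => rw [map_zero]; exact zero_mem _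

theorem map_formsToDR {A' : Type*} [CommRing A'] [Algebra k A'] (φ : A →ₐ[k] A')
    (hφ : ∀ i, ∀ b ∈ constGrading k A i, φ b ∈ constGrading k A' i)
    (y : ExteriorAlgebra A Ω[A⁄k]) :
    DR.map φ hφ (formsToDR k A y) =
      formsToDR k A' (exteriorMap φ (formRes φ) (formRes_smul φ) y) := by
  have h : (DR.map φ hφ).comp (formsToDR k A) =
      (formsToDR k A').comp (exteriorMap φ (formRes φ) (formRes_smul φ)) := by
    apply exterior_algHom_ext
    · intro a
      simp [formsToDR_algebraMap]
    · intro α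
      rw [AlgHom.comp_apply, AlgHom.comp_apply]
      refine form_induction (p := fun α => DR.map φ hφ (formsToDR k A (ExteriorAlgebra.ι A α)) =
        formsToDR k A' (exteriorMap φ (formRes φ) (formRes_smul φ) (ExteriorAlgebra.ι A α)))
        (fun b => ?_) (fun x y hx hy => ?_) (fun a x hx => ?_) α
      · rw [formsToDR_ι_D, DR.map_dFun, exteriorMap_ι, formRes_D, formsToDR_ι_D]
      · simp only [map_add, hx, hy]
      · rw [map_smul, formsToDR_smul, map_mul, hx, DR.map_ofFun, exteriorMap_smul, formsToDR_smul]
  exact congrArg (fun f => f y) h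

end Forms

/-! ### Contraction of differential forms with polyvector fields -/

section Contraction

theorem exterior_left_induction {A M : Type*} [CommRing A] [AddCommGroup M] [Module A M]
    {p : ExteriorAlgebra A M → Prop} (algebraMap : ∀ a : A, p (algebraMap A _ a))
    (add : ∀ x y, p x → p y → p (x + y)) (ι_mul : ∀ x m, p x → p (ExteriorAlgebra.ι A m * x))
    (x : ExteriorAlgebra A M) : p x :=
  CliffordAlgebra.left_induction _ algebraMap add ι_mul x

variable {k : Type*} [Field k] [CharZero k] {A : Type*} [CommRing A] [Algebra k A]

variable (k A) in
/-- The contraction of differential forms with polyvector fields. A product of vector fields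
`D₁ D₂ ⋯` acts as the composition of the contractions with `D₁`, `D₂`, …, in this order. -/
noncomputable def interior : Polyvector k A →ₐ[A] Module.End A (ExteriorAlgebra A Ω[A⁄k]) :=
  ExteriorAlgebra.lift A
    ⟨CliffordAlgebra.contractLeft ∘ₗ
        (KaehlerDifferential.linearMapEquivDerivation k A (M := A)).symm.toLinearMap,
      fun _ => LinearMap.ext fun y => CliffordAlgebra.contractLeft_contractLeft _ y⟩

theorem interior_ι (D : Derivation k A A) (y : ExteriorAlgebra A Ω[A⁄k]) :
    interior k A (ExteriorAlgebra.ι A D) y =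
      CliffordAlgebra.contractLeft D.liftKaehlerDifferential y := by
  rw [interior, ExteriorAlgebra.lift_ι_apply]
  rfl

theorem interior_ι_mul (D : Derivation k A A) (P : Polyvector k A)
    (y : ExteriorAlgebra A Ω[A⁄k]) :
    interior k A (ExteriorAlgebra.ι A D * P) y =
      CliffordAlgebra.contractLeft D.liftKaehlerDifferential (interior k A P y) := by
  rw [map_mul, Module.End.mul_apply, interior_ι]

theorem interior_algebraMap (a : A) (y : ExteriorAlgebra A Ω[A⁄k]) :
    interior k A (algebraMap A _ a) y = a • y := by
  rw [AlgHom.commutes, Module.algebraMap_end_apply]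

theorem interior_mem {j : ℕ} {P : Polyvector k A} (hP : P ∈ ⋀[A]^j (Derivation k A A)) {q : ℕ}
    {y : ExteriorAlgebra A Ω[A⁄k]} (hy : y ∈ ⋀[A]^(q + j) Ω[A⁄k]) :
    interior k A P y ∈ ⋀[A]^q Ω[A⁄k] := by
  induction hP using Submodule.pow_induction_on_left' generalizing q with
  | algebraMap a => rw [interior_algebraMap]; exact Submodule.smul_mem _ _ hy
  | add x z i _ _ hx hz => rw [map_add]; exact add_mem (hx hy) (hz hy)
  | mem_mul m hm i x _ hx =>
    obtain ⟨m, rfl⟩ := hm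
    rw [interior_ι_mul]
    refine contractLeft_mem _ (hx ?_)
    rwa [show q + 1 + i = q + i.succ by omega]

theorem interior_eq_zero_of_lt {j : ℕ} {P : Polyvector k A}
    (hP : P ∈ ⋀[A]^j (Derivation k A A)) {q : ℕ} (hq : q < j) {y : ExteriorAlgebra A Ω[A⁄k]}
    (hy : y ∈ ⋀[A]^q Ω[A⁄k]) : interior k A P y = 0 := by
  induction hP using Submodule.pow_induction_on_left' with
  | algebraMap a => exact absurd hq (Nat.not_lt_zero q)
  | add x y i _ _ hx hy => rw [map_add, LinearMap.add_apply, hx hq, hy hq, add_zero]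
  | mem_mul m hm i x h hx =>
    obtain ⟨m, rfl⟩ := hm
    rw [interior_ι_mul]
    rcases Nat.lt_succ_iff_lt_or_eq.1 hq with hq | rfl
    · rw [hx hq, map_zero]
    · exact contractLeft_of_mem_zero _ (interior_mem h (by rwa [zero_add]))

/-- The evaluation of vector fields at a function `f`. -/
def evalAt (f : A) : Module.Dual A (Derivation k A A) where
  toFun D := D f
  map_add' _ _ := rfl
  map_smul' _ _ := rfl

theorem contract_eq (f : A) (P : Polyvector k A) :
    contract f P = CliffordAlgebra.contractLeft (evalAt f) P := rfl

/-- The exterior multiplication by `d f` and the contraction with `D` anticommute up to the scalar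
`D f`. On forms `y` with `d f ∧ y = 0` the exterior multiplication by `d f` therefore corresponds to
the odd derivative of polyvector fields. -/
theorem ι_D_mul_interior (f : A) {y : ExteriorAlgebra A Ω[A⁄k]}
    (hy : ExteriorAlgebra.ι A (KaehlerDifferential.D k A f) * y = 0) (P : Polyvector k A) :
    ExteriorAlgebra.ι A (KaehlerDifferential.D k A f) * interior k A P y =
      interior k A (contract f P) y := by
  induction P using exterior_left_induction with
  | algebraMap a =>
    rw [contract_eq, contractLeft_algebraMap', interior_algebraMap, mul_smul_comm, hy, smul_zero,
      map_zero, LinearMap.zero_apply]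
  | add P Q hP hQ => simp only [map_add, LinearMap.add_apply, mul_add, hP, hQ]
  | ι_mul P D hP =>
    have h1 := contractLeft_ι_mul' D.liftKaehlerDifferential (KaehlerDifferential.D k A f)
      (interior k A P y)
    rw [hP, Derivation.liftKaehlerDifferential_comp_D] at h1
    rw [contract_eq, contractLeft_ι_mul', ← contract_eq, map_sub, LinearMap.sub_apply,
      interior_ι_mul, interior_ι_mul, map_smul, LinearMap.smul_apply, h1]
    exact (sub_sub_cancel _ _).symm

variable {A' : Type*} [CommRing A'] [Algebra k A'] (φ : A →ₐ[k] A')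
  (hφ : φ.toRingHom.FormallyEtale)

theorem vectorRes_liftKaehlerDifferential (D : Derivation k A A) (α : Ω[A⁄k]) :
    (vectorRes φ hφ D).liftKaehlerDifferential (formRes φ α) =
      φ (D.liftKaehlerDifferential α) := by
  refine form_induction (p := fun α => (vectorRes φ hφ D).liftKaehlerDifferential (formRes φ α) =
      φ (D.liftKaehlerDifferential α)) (fun b => ?_) (fun x y hx hy => ?_) (fun a x hx => ?_) α
  · rw [formRes_D, Derivation.liftKaehlerDifferential_comp_D,
      Derivation.liftKaehlerDifferential_comp_D, vectorRes_apply]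
  · simp only [map_add, hx, hy]
  · rw [formRes_smul, map_smul, hx, map_smul, smul_eq_mul, smul_eq_mul, map_mul]

/-- The contraction with vector fields is compatible with restriction along étale maps. -/
theorem exteriorMap_contractLeft (D : Derivation k A A) (y : ExteriorAlgebra A Ω[A⁄k]) :
    exteriorMap φ (formRes φ) (formRes_smul φ)
        (CliffordAlgebra.contractLeft D.liftKaehlerDifferential y) =
      CliffordAlgebra.contractLeft (vectorRes φ hφ D).liftKaehlerDifferential
        (exteriorMap φ (formRes φ) (formRes_smul φ) y) := by
  induction y using exterior_left_induction with
  | algebraMap a =>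
    rw [contractLeft_algebraMap', exteriorMap_algebraMap, contractLeft_algebraMap', map_zero]
  | add x y hx hy => simp only [map_add, hx, hy]
  | ι_mul y α hy =>
    rw [contractLeft_ι_mul', map_sub, exteriorMap_smul, map_mul, map_mul, exteriorMap_ι, hy,
      contractLeft_ι_mul', vectorRes_liftKaehlerDifferential]

theorem exteriorMap_interior (P : Polyvector k A) (y : ExteriorAlgebra A Ω[A⁄k]) :
    exteriorMap φ (formRes φ) (formRes_smul φ) (interior k A P y) =
      interior k A' (polyRes φ hφ P) (exteriorMap φ (formRes φ) (formRes_smul φ) y) := by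
  induction P using exterior_left_induction with
  | algebraMap a =>
    rw [polyRes, exteriorMap_algebraMap, interior_algebraMap, interior_algebraMap,
      exteriorMap_smul]
  | add P Q hP hQ => simp only [map_add, LinearMap.add_apply, hP, hQ]
  | ι_mul P D hP =>
    have h : polyRes φ hφ (ExteriorAlgebra.ι A D) = ExteriorAlgebra.ι A' (vectorRes φ hφ D) :=
      exteriorMap_ι _ _ _ D
    rw [interior_ι_mul, exteriorMap_contractLeft φ hφ, hP, map_mul, h, interior_ι_mul]

end Contraction

/-! ### The rank of the Kähler differentials -/

section FrameTrace

variable {k : Type*} [CommRing k] {A : Type*} [CommRing A] [Algebra k A]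

theorem Frame.sum_smul_D_x (F : Frame k A) (α : Ω[A⁄k]) :
    ∑ j, (F.D j).liftKaehlerDifferential α • KaehlerDifferential.D k A (F.x j) = α := by
  refine form_induction (p := fun α => ∑ j, (F.D j).liftKaehlerDifferential α •
    KaehlerDifferential.D k A (F.x j) = α) (fun b => ?_) (fun x y hx hy => ?_)
    (fun a x hx => ?_) α
  · simp only [Derivation.liftKaehlerDifferential_comp_D]
    exact (F.spec b).symm
  · simp only [map_add, add_smul, Finset.sum_add_distrib, hx, hy]
  · simp only [map_smul, smul_assoc, ← Finset.smul_sum, hx]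

theorem Frame.sum_smul_D (F : Frame k A) (D : Derivation k A A) :
    ∑ j, D (F.x j) • F.D j = D := by
  ext f
  have h := congrArg D.liftKaehlerDifferential (F.spec f)
  simp only [map_sum, map_smul, Derivation.liftKaehlerDifferential_comp_D, smul_eq_mul] at h
  rw [h, derivation_sum_apply]
  exact Finset.sum_congr rfl fun j _ => by simp [mul_comm]

/-- The trace of the identity of `Ω_A`, that is, the rank of `Ω_A` as a function on `Spec A`. -/
def Frame.trace (F : Frame k A) : A := ∑ j, F.D j (F.x j)

/-- The trace does not depend on the frame. -/
theorem Frame.trace_eq (F G : Frame k A) : F.trace = G.trace := by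
  have h1 : F.trace = ∑ j, ∑ l, F.D j (G.x l) * G.D l (F.x j) := by
    refine Finset.sum_congr rfl fun j _ => ?_
    conv_lhs => rw [← G.sum_smul_D (F.D j), derivation_sum_apply]
    simp
  have h2 : G.trace = ∑ l, ∑ j, G.D l (F.x j) * F.D j (G.x l) := by
    refine Finset.sum_congr rfl fun l _ => ?_
    conv_lhs => rw [← F.sum_smul_D (G.D l), derivation_sum_apply]
    simp
  rw [h1, h2, Finset.sum_comm]
  simp only [mul_comm]

theorem Frame.trace_res {A' : Type*} [CommRing A'] [Algebra k A'] (F : Frame k A)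
    (φ : A →ₐ[k] A') (hφ : φ.toRingHom.FormallyEtale) : (F.res φ hφ).trace = φ F.trace := by
  rw [Frame.trace, Frame.trace, map_sum]
  exact Finset.sum_congr rfl fun j _ => vectorRes_apply φ hφ _ _

end FrameTrace

/-! ### Sections of the canonical bundle as differential forms -/

section DensityForms

variable {k : Type*} [Field k] [CharZero k] {A : Type*} [CommRing A] [Algebra k A] {n : ℕ}

variable (k A n) in
/-- The contraction `P ⊗ μ ↦ P ⌋ μ` of top forms with polyvector fields. -/
noncomputable def densityToForms : Density k A n →ₗ[A] ExteriorAlgebra A Ω[A⁄k] :=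
  TensorProduct.lift (LinearMap.lcomp A (ExteriorAlgebra A Ω[A⁄k]) (⋀[A]^n Ω[A⁄k]).subtype ∘ₗ
    (interior k A).toLinearMap)

theorem densityToForms_tmul (P : Polyvector k A) (μ : ⋀[A]^n Ω[A⁄k]) :
    densityToForms k A n (P ⊗ₜ μ) = interior k A P μ := rfl

/-- The exterior multiplication by a vector field on sections of `π^* K`. -/
noncomputable def mulDensity (D : Derivation k A A) : Density k A n →ₗ[A] Density k A n :=
  (LinearMap.mulLeft A (ExteriorAlgebra.ι A D)).rTensor _

theorem mulDensity_tmul (D : Derivation k A A) (P : Polyvector k A) (μ : ⋀[A]^n Ω[A⁄k]) :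
    mulDensity D (P ⊗ₜ[A] μ) = (ExteriorAlgebra.ι A D * P) ⊗ₜ[A] μ := rfl

/-- The contraction with `d f` on sections of `π^* K`. -/
noncomputable def contractDensity (f : A) : Density k A n →ₗ[A] Density k A n :=
  (contract f).rTensor _

theorem contractDensity_tmul (f : A) (P : Polyvector k A) (μ : ⋀[A]^n Ω[A⁄k]) :
    contractDensity f (P ⊗ₜ[A] μ) = contract f P ⊗ₜ[A] μ := rfl

/-- Under the contraction of top forms, the multiplication by the fibre coordinate `D` corresponds
to the contraction of forms with the vector field `D`. -/
theorem densityToForms_mulDensity (D : Derivation k A A) (z : Density k A n) :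
    densityToForms k A n (mulDensity D z) =
      CliffordAlgebra.contractLeft D.liftKaehlerDifferential (densityToForms k A n z) := by
  induction z using TensorProduct.induction_on with
  | zero => simp
  | add x y hx hy => simp only [map_add, hx, hy]
  | tmul P μ => rw [mulDensity_tmul, densityToForms_tmul, densityToForms_tmul, interior_ι_mul]

/-- Under the contraction of top forms, the odd derivative along `d f` corresponds to the exterior
multiplication by `d f`. -/
theorem ι_D_mul_densityToForms (F : Frame k A) (hF : F.trace = n) (f : A) (z : Density k A n) :
    ExteriorAlgebra.ι A (KaehlerDifferential.D k A f) * densityToForms k A n z =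
      densityToForms k A n (contractDensity f z) := by
  induction z using TensorProduct.induction_on with
  | zero => simp
  | add x y hx hy => simp only [map_add, mul_add, hx, hy]
  | tmul P μ =>
    refine ι_D_mul_interior f ?_ P
    refine exteriorPower_eq_zero_of_rank_lt (k := k) (n := n) F.sum_smul_D_x ?_ (Nat.lt_succ_self n)
      (ι_mul_mem _ μ.2)
    simpa only [Derivation.liftKaehlerDifferential_comp_D, Frame.trace] using hF

theorem densityToForms_mem {q : ℕ} {z : Density k A n} (hz : z ∈ densityPiece k A n q) :
    densityToForms k A n z ∈ ⋀[A]^q Ω[A⁄k] := by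
  induction hz using Submodule.span_induction with
  | mem z hz =>
    obtain ⟨j, P, μ, hP, hj, rfl⟩ := hz
    refine interior_mem hP ?_
    rw [← show n = q + j by omega]
    exact μ.2
  | zero => rw [map_zero]; exact zero_mem _
  | add x y _ _ hx hy => rw [map_add]; exact add_mem hx hy
  | smul r x _ hx =>
    rw [← algebraMap_smul A r, map_smul]; exact Submodule.smul_mem _ _ hx

theorem densityToForms_eq_zero {m : ℤ} (hm : m < 0) {z : Density k A n}
    (hz : z ∈ densityPiece k A n m) : densityToForms k A n z = 0 := by
  induction hz using Submodule.span_induction with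
  | mem z hz =>
    obtain ⟨j, P, μ, hP, hj, rfl⟩ := hz
    exact interior_eq_zero_of_lt hP (by omega) μ.2
  | zero => rw [map_zero]
  | add x y _ _ hx hy => rw [map_add, hx, hy, add_zero]
  | smul r x _ hx => rw [← algebraMap_smul A r, map_smul, hx, smul_zero]

theorem mulDensity_mem (D : Derivation k A A) {m : ℤ} {z : Density k A n}
    (hz : z ∈ densityPiece k A n (m + 1)) : mulDensity D z ∈ densityPiece k A n m := by
  induction hz using Submodule.span_induction with
  | mem z hz =>
    obtain ⟨j, P, μ, hP, hj, rfl⟩ := hz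
    exact Submodule.subset_span ⟨j + 1, _, μ, ι_mul_mem D hP, by push_cast; omega, rfl⟩
  | zero => rw [map_zero]; exact zero_mem _
  | add x y _ _ hx hy => rw [map_add]; exact add_mem hx hy
  | smul r x _ hx =>
    rw [← algebraMap_smul A r, map_smul, algebraMap_smul]; exact Submodule.smul_mem _ _ hx

theorem tmul_mem_densityPiece {j : ℕ} {P : Polyvector k A} (hP : P ∈ ⋀[A]^j (Derivation k A A))
    (μ : ⋀[A]^n Ω[A⁄k]) : P ⊗ₜ[A] μ ∈ densityPiece k A n (n - j) :=
  Submodule.subset_span ⟨j, P, μ, hP, rfl, rfl⟩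

theorem density_induction {p : Density k A n → Prop} (zero : p 0)
    (add : ∀ x y, p x → p y → p (x + y))
    (tmul : ∀ (j : ℕ) (P : Polyvector k A) (μ : ⋀[A]^n Ω[A⁄k]),
      P ∈ ⋀[A]^j (Derivation k A A) → p (P ⊗ₜ μ)) (z : Density k A n) : p z := by
  induction z using TensorProduct.induction_on with
  | zero => exact zero
  | add x y hx hy => exact add x y hx hy
  | tmul P μ =>
    induction P using DirectSum.Decomposition.inductionOn
      (fun j => ⋀[A]^j (Derivation k A A)) with
    | zero => rw [zero_tmul]; exact zero
    | add x y hx hy => rw [add_tmul]; exact add _ _ hx hy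
    | homogeneous P => exact tmul _ _ _ P.2

/-- Every form of degree `q` is the contraction of a top form with a polyvector field of exterior
degree `n - q`. -/
theorem exists_densityToForms_eq (F : Frame k A) (hF : F.trace = n) {q : ℕ}
    {y : ExteriorAlgebra A Ω[A⁄k]} (hy : y ∈ ⋀[A]^q Ω[A⁄k]) :
    ∃ z ∈ densityPiece k A n q, densityToForms k A n z = y := by
  have hF' : ∑ j, (F.D j).liftKaehlerDifferential (KaehlerDifferential.D k A (F.x j)) = (n : A) := by
    simpa only [Derivation.liftKaehlerDifferential_comp_D, Frame.trace] using hF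
  rcases lt_or_ge n q with hq | hq
  · refine ⟨0, zero_mem _, ?_⟩
    rw [map_zero, exteriorPower_eq_zero_of_rank_lt k F.sum_smul_D_x hF' hq hy]
  -- Descending induction on `q`: the form `(n - q) y` is the sum of the contractions of the forms
  -- `d x_j ∧ y` with the vector fields `D_j`.
  obtain ⟨s, hs⟩ := Nat.exists_eq_add_of_le hq
  clear hq
  induction s generalizing q y with
  | zero =>
    obtain rfl : q = n := by omega
    refine ⟨1 ⊗ₜ ⟨y, hy⟩, ?_, ?_⟩
    · simpa using tmul_mem_densityPiece (j := 0) (Submodule.algebraMap_mem (1 : A)) ⟨y, hy⟩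
    · rw [densityToForms_tmul, map_one]; rfl
  | succ s ih =>
    choose z hz hzy using fun j =>
      ih (ι_mul_mem (KaehlerDifferential.D k A (F.x j)) hy) (by omega : n = q + 1 + s)
    refine ⟨((s : k) + 1)⁻¹ • ∑ j, mulDensity (F.D j) (z j),
      Submodule.smul_mem _ _ (Submodule.sum_mem _ fun j _ => mulDensity_mem _ ?_), ?_⟩
    · exact_mod_cast hz j
    · rw [← algebraMap_smul A, map_smul, map_sum]
      simp only [densityToForms_mulDensity, hzy]
      rw [sum_contractLeft_ι_mul F.sum_smul_D_x hF' hy, smul_smul,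
        show (n : A) - q = algebraMap k A (s + 1) by rw [hs]; push_cast; simp, ← map_mul,
        inv_mul_cancel₀ (Nat.cast_add_one_ne_zero s), map_one, one_smul]

variable (k A n) in
/-- The sections of `π^* K` of polynomial degree at most `M` along the fibres. -/
noncomputable def densityFiltration (M : ℕ) : Submodule A (Density k A n) :=
  Submodule.span A {z | ∃ (j : ℕ) (P : Polyvector k A) (μ : ⋀[A]^n Ω[A⁄k]),
    P ∈ ⋀[A]^j (Derivation k A A) ∧ j ≤ M ∧ z = P ⊗ₜ[A] μ}

theorem tmul_mem_densityFiltration {j M : ℕ} {P : Polyvector k A}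
    (hP : P ∈ ⋀[A]^j (Derivation k A A)) (hj : j ≤ M) (μ : ⋀[A]^n Ω[A⁄k]) :
    P ⊗ₜ[A] μ ∈ densityFiltration k A n M :=
  Submodule.subset_span ⟨j, P, μ, hP, hj, rfl⟩

theorem densityFiltration_mono {M N : ℕ} (h : M ≤ N) :
    densityFiltration k A n M ≤ densityFiltration k A n N :=
  Submodule.span_mono fun _ ⟨j, P, μ, hP, hj, hz⟩ => ⟨j, P, μ, hP, hj.trans h, hz⟩

theorem exists_mem_densityFiltration (z : Density k A n) :
    ∃ M, z ∈ densityFiltration k A n M := by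
  induction z using density_induction with
  | zero => exact ⟨0, zero_mem _⟩
  | add x y hx hy =>
    obtain ⟨M, hM⟩ := hx
    obtain ⟨N, hN⟩ := hy
    exact ⟨max M N, add_mem (densityFiltration_mono (le_max_left M N) hM)
      (densityFiltration_mono (le_max_right M N) hN)⟩
  | tmul j P μ hP => exact ⟨j, tmul_mem_densityFiltration hP le_rfl μ⟩

theorem contractDensity_mem (f : A) {M : ℕ} {z : Density k A n}
    (hz : z ∈ densityFiltration k A n (M + 1)) :
    contractDensity f z ∈ densityFiltration k A n M := by
  induction hz using Submodule.span_induction with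
  | mem z hz =>
    obtain ⟨j, P, μ, hP, hj, rfl⟩ := hz
    rw [contractDensity_tmul, contract_eq]
    cases j with
    | zero => rw [contractLeft_of_mem_zero _ hP, zero_tmul]; exact zero_mem _
    | succ j =>
      exact tmul_mem_densityFiltration (contractLeft_mem _ hP) (Nat.le_of_succ_le_succ hj) μ
  | zero => rw [map_zero]; exact zero_mem _
  | add x y _ _ hx hy => rw [map_add]; exact add_mem hx hy
  | smul r x _ hx => rw [map_smul]; exact Submodule.smul_mem _ _ hx

/-- The Euler field of the fibres acts on sections of fibre degree at most `M + 1` as `M + 1`, up to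
sections of smaller degree. -/
theorem sum_mulDensity_contractDensity_sub_mem (F : Frame k A) {M : ℕ} {z : Density k A n}
    (hz : z ∈ densityFiltration k A n (M + 1)) :
    ∑ j, mulDensity (F.D j) (contractDensity (F.x j) z) - ((M + 1 : ℕ) : A) • z ∈
      densityFiltration k A n M := by
  induction hz using Submodule.span_induction with
  | mem z hz =>
    obtain ⟨j, P, μ, hP, hj, rfl⟩ := hz
    simp only [contractDensity_tmul, mulDensity_tmul, contract_eq]
    rw [← sum_tmul, sum_ι_mul_contractLeft (φ := fun j => evalAt (F.x j)) F.sum_smul_D hP,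
      ← smul_tmul']
    rcases hj.eq_or_lt with rfl | hj
    · rw [sub_self]; exact zero_mem _
    · have h := tmul_mem_densityFiltration hP (Nat.le_of_lt_succ hj) μ
      exact sub_mem (Submodule.smul_mem _ _ h) (Submodule.smul_mem _ _ h)
  | zero => simp
  | add x y _ _ hx hy =>
    simp only [map_add, Finset.sum_add_distrib, smul_add]
    rw [add_sub_add_comm]
    exact add_mem hx hy
  | smul r x _ hx =>
    simp only [map_smul, ← Finset.smul_sum]
    rw [smul_comm, ← smul_sub]
    exact Submodule.smul_mem _ _ hx

theorem exists_eq_one_tmul {z : Density k A n} (hz : z ∈ densityFiltration k A n 0) :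
    ∃ μ : ⋀[A]^n Ω[A⁄k], z = 1 ⊗ₜ μ := by
  induction hz using Submodule.span_induction with
  | mem z hz =>
    obtain ⟨j, P, μ, hP, hj, rfl⟩ := hz
    obtain rfl : j = 0 := by omega
    obtain ⟨a, rfl⟩ := exists_algebraMap_eq_of_mem_zero hP
    exact ⟨a • μ, by rw [Algebra.algebraMap_eq_smul_one, smul_tmul]⟩
  | zero => exact ⟨0, by rw [tmul_zero]⟩
  | add x y _ _ hx hy =>
    obtain ⟨μ, rfl⟩ := hx
    obtain ⟨ν, rfl⟩ := hy
    exact ⟨μ + ν, by rw [tmul_add]⟩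
  | smul r x _ hx =>
    obtain ⟨μ, rfl⟩ := hx
    exact ⟨r • μ, by rw [tmul_smul]⟩

theorem densityToForms_injective (F : Frame k A) (hF : F.trace = n) :
    Function.Injective (densityToForms k A n) := by
  rw [← LinearMap.ker_eq_bot, LinearMap.ker_eq_bot']
  intro z hz
  obtain ⟨M, hM⟩ := exists_mem_densityFiltration z
  -- A section `z` in the kernel of fibre degree at most `M + 1` has degree at most `M`, since its
  -- contractions vanish by induction and hence the Euler field of the fibres annihilates it.
  induction M generalizing z with
  | zero =>
    obtain ⟨μ, rfl⟩ := exists_eq_one_tmul hM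
    rw [densityToForms_tmul, map_one] at hz
    rw [show μ = 0 from Subtype.ext hz, tmul_zero]
  | succ M ih =>
    refine ih z hz ?_
    have h := sum_mulDensity_contractDensity_sub_mem F hM
    rw [Finset.sum_eq_zero fun j _ => by
      rw [ih (contractDensity (F.x j) z) (by rw [← ι_D_mul_densityToForms F hF, hz, mul_zero])
        (contractDensity_mem _ hM), map_zero], zero_sub] at h
    have h2 := Submodule.smul_mem _ (algebraMap k A ((M + 1 : ℕ) : k)⁻¹) (neg_mem h)
    rwa [neg_neg, ← map_natCast (algebraMap k A), smul_smul, ← map_mul,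
      inv_mul_cancel₀ (by exact_mod_cast M.succ_ne_zero), map_one, one_smul] at h2

theorem densityToForms_surjective (F : Frame k A) (hF : F.trace = n) :
    Function.Surjective (densityToForms k A n) := by
  intro y
  induction y using DirectSum.Decomposition.inductionOn (fun j => ⋀[A]^j Ω[A⁄k]) with
  | zero => exact ⟨0, map_zero _⟩
  | add x y hx hy =>
    obtain ⟨x, rfl⟩ := hx
    obtain ⟨y, rfl⟩ := hy
    exact ⟨x + y, map_add _ _ _⟩
  | homogeneous y =>
    obtain ⟨z, -, hz⟩ := exists_densityToForms_eq F hF y.2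
    exact ⟨z, hz⟩

theorem exteriorMap_densityToForms {A' : Type*} [CommRing A'] [Algebra k A'] (φ : A →ₐ[k] A')
    (hφ : φ.toRingHom.FormallyEtale) (z : Density k A n) :
    exteriorMap φ (formRes φ) (formRes_smul φ) (densityToForms k A n z) =
      densityToForms k A' n (densityRes φ hφ z) := by
  induction z using TensorProduct.induction_on with
  | zero => simp
  | add x y hx hy => simp only [map_add, hx, hy]
  | tmul P μ =>
    rw [densityToForms_tmul, exteriorMap_interior φ hφ, densityRes_tmul, densityToForms_tmul]
    rfl

end DensityForms

/-! ### The operator corresponding to the de Rham differential -/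

section Laplacian

variable {k : Type*} [Field k] [CharZero k] {A : Type*} [CommRing A] [Algebra k A] {n : ℕ}

variable (k A n) in
/-- The contraction of top forms with polyvector fields, as a map into `DR A`. It identifies
`π^* K [-n]` with the differential forms on `Spec A`. -/
noncomputable def densityForm : Density k A n →ₗ[k] DR (constGrading k A) :=
  (formsToDR k A).toLinearMap ∘ₗ (densityToForms k A n).restrictScalars k

theorem densityForm_apply (z : Density k A n) :
    densityForm k A n z = formsToDR k A (densityToForms k A n z) := rfl

theorem densityForm_bijective (F : Frame k A) (hF : F.trace = n) :
    Function.Bijective (densityForm k A n) := by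
  have h : Function.Bijective (formsToDR k A) :=
    ⟨fun x y hxy => by rw [← drToForms_formsToDR x, hxy, drToForms_formsToDR],
      fun x => ⟨_, formsToDR_drToForms x⟩⟩
  exact h.comp ⟨densityToForms_injective F hF, densityToForms_surjective F hF⟩

theorem densityForm_mem {q : ℕ} {z : Density k A n} (hz : z ∈ densityPiece k A n q) :
    densityForm k A n z ∈ DR.piece (constGrading k A) q q :=
  formsToDR_mem (densityToForms_mem hz)

theorem densityForm_eq_zero {m : ℤ} (hm : m < 0) {z : Density k A n}
    (hz : z ∈ densityPiece k A n m) : densityForm k A n z = 0 := by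
  rw [densityForm_apply, densityToForms_eq_zero hm hz, map_zero]

theorem exists_densityForm_eq (F : Frame k A) (hF : F.trace = n) {q : ℕ}
    {y : DR (constGrading k A)} (hy : y ∈ DR.piece (constGrading k A) q q) :
    ∃ z ∈ densityPiece k A n q, densityForm k A n z = y := by
  obtain ⟨z, hz, h⟩ := exists_densityToForms_eq F hF (drToForms_mem hy)
  exact ⟨z, hz, by rw [densityForm_apply, h, formsToDR_drToForms]⟩

theorem map_densityForm {A' : Type*} [CommRing A'] [Algebra k A'] (φ : A →ₐ[k] A')
    (hφ : φ.toRingHom.FormallyEtale)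
    (hφ' : ∀ i, ∀ b ∈ constGrading k A i, φ b ∈ constGrading k A' i) (z : Density k A n) :
    DR.map φ hφ' (densityForm k A n z) = densityForm k A' n (densityRes φ hφ z) := by
  rw [densityForm_apply, map_formsToDR, exteriorMap_densityToForms φ hφ, densityForm_apply]

/-- The operator on `π^* K [-n]` which corresponds to the de Rham differential under the
contraction of top forms with polyvector fields. -/
noncomputable def laplacian (h : Function.Bijective (densityForm k A n)) :
    Density k A n →ₗ[k] Density k A n :=
  (LinearEquiv.ofBijective _ h).symm.toLinearMap ∘ₗ DR.d (constGrading k A) ∘ₗ densityForm k A n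

theorem densityForm_laplacian (h : Function.Bijective (densityForm k A n)) (z : Density k A n) :
    densityForm k A n (laplacian h z) = DR.d _ (densityForm k A n z) :=
  (LinearEquiv.ofBijective _ h).apply_symm_apply _

theorem laplacian_laplacian (h : Function.Bijective (densityForm k A n)) (z : Density k A n) :
    laplacian h (laplacian h z) = 0 :=
  h.1 (by rw [densityForm_laplacian, densityForm_laplacian, DR.d_d, map_zero])

theorem laplacian_mem (F : Frame k A) (hF : F.trace = n)
    (h : Function.Bijective (densityForm k A n)) {m : ℤ} {z : Density k A n}
    (hz : z ∈ densityPiece k A n m) : laplacian h z ∈ densityPiece k A n (m + 1) := by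
  rcases lt_or_ge m 0 with hm | hm
  · rw [h.1 ((densityForm_eq_zero hm hz).trans (map_zero _).symm), map_zero]
    exact zero_mem _
  · lift m to ℕ using hm
    obtain ⟨y, hy, hyz⟩ := exists_densityForm_eq (n := n) F hF
      (q := m + 1) (by simpa using DR.d_mem (densityForm_mem hz))
    rw [← densityForm_laplacian h] at hyz
    rw [← h.1 hyz]
    exact_mod_cast hy

theorem laplacian_densityRes {A' : Type*} [CommRing A'] [Algebra k A']
    (h : Function.Bijective (densityForm k A n)) (h' : Function.Bijective (densityForm k A' n))
    (φ : A →ₐ[k] A') (hφ : φ.toRingHom.FormallyEtale)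
    (hφ' : ∀ i, ∀ b ∈ constGrading k A i, φ b ∈ constGrading k A' i) (z : Density k A n) :
    laplacian h' (densityRes φ hφ z) = densityRes φ hφ (laplacian h z) :=
  h'.1 (by rw [densityForm_laplacian, ← map_densityForm φ hφ hφ', ← map_densityForm φ hφ hφ',
    densityForm_laplacian, DR.map_d])

end Laplacian

/-! ### The coordinate formula -/

section Coordinates

variable {k : Type*} [Field k] [CharZero k] {A : Type*} [CommRing A] [Algebra k A] {n : ℕ}
  (c : EtaleCoordinates k A n)

/-- Étale coordinates, with the dual vector fields, form a frame. -/
def EtaleCoordinates.toFrame : Frame k A := ⟨n, c.x, c.del, c.spec⟩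

theorem EtaleCoordinates.trace_toFrame : c.toFrame.trace = n := by
  change ∑ j, c.del j (c.x j) = n
  simp [c.del_x]

/-- Restriction of étale coordinates. -/
noncomputable def EtaleCoordinates.res {A' : Type*} [CommRing A'] [Algebra k A'] (φ : A →ₐ[k] A')
    (hφ : φ.toRingHom.FormallyEtale) : EtaleCoordinates k A' n where
  x j := φ (c.x j)
  del j := vectorRes φ hφ (c.del j)
  del_x i j := by rw [vectorRes_apply, c.del_x]; split_ifs <;> simp
  spec := (c.toFrame.res φ hφ).spec

/-- The forms with constant coefficients in the coordinates `c`. -/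
noncomputable def EtaleCoordinates.flatForms : Submodule k (ExteriorAlgebra A Ω[A⁄k]) :=
  Submodule.span k (Set.range fun L : List (Fin n) =>
    (L.map fun i => ExteriorAlgebra.ι A (KaehlerDifferential.D k A (c.x i))).prod)

theorem EtaleCoordinates.ι_mul_mem_flatForms (i : Fin n) {y : ExteriorAlgebra A Ω[A⁄k]}
    (hy : y ∈ c.flatForms) :
    ExteriorAlgebra.ι A (KaehlerDifferential.D k A (c.x i)) * y ∈ c.flatForms := by
  induction hy using Submodule.span_induction with
  | mem y hy =>
    obtain ⟨L, rfl⟩ := hy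
    exact Submodule.subset_span ⟨i :: L, List.prod_cons⟩
  | zero => rw [mul_zero]; exact zero_mem _
  | add x y _ _ hx hy => rw [mul_add]; exact add_mem hx hy
  | smul r x _ hx => rw [mul_smul_comm]; exact Submodule.smul_mem _ _ hx

theorem EtaleCoordinates.contractLeft_mem_flatForms (i : Fin n) {y : ExteriorAlgebra A Ω[A⁄k]}
    (hy : y ∈ c.flatForms) :
    CliffordAlgebra.contractLeft (c.del i).liftKaehlerDifferential y ∈ c.flatForms := by
  induction hy using Submodule.span_induction with
  | mem y hy =>
    obtain ⟨L, rfl⟩ := hy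
    dsimp only
    induction L with
    | nil =>
      rw [List.map_nil, List.prod_nil, ← map_one (algebraMap A _), contractLeft_algebraMap']
      exact zero_mem _
    | cons j L ih =>
      rw [List.map_cons, List.prod_cons, contractLeft_ι_mul',
        Derivation.liftKaehlerDifferential_comp_D, c.del_x]
      refine sub_mem ?_ (c.ι_mul_mem_flatForms j ih)
      split_ifs
      · rw [one_smul]; exact Submodule.subset_span ⟨L, rfl⟩
      · rw [zero_smul]; exact zero_mem _
  | zero => rw [map_zero]; exact zero_mem _
  | add x y _ _ hx hy => rw [map_add]; exact add_mem hx hy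
  | smul r x _ hx =>
    rw [← algebraMap_smul A r, map_smul, algebraMap_smul]; exact Submodule.smul_mem _ _ hx

theorem EtaleCoordinates.vol_mem_flatForms :
    (c.vol : ExteriorAlgebra A Ω[A⁄k]) ∈ c.flatForms := by
  refine Submodule.subset_span ⟨List.finRange n, ?_⟩
  change _ = ExteriorAlgebra.ιMulti A n _
  rw [ExteriorAlgebra.ιMulti_apply, List.ofFn_eq_map]

theorem EtaleCoordinates.interior_monomial_mem_flatForms {j : ℕ} (I : Fin j → Fin n)
    {y : ExteriorAlgebra A Ω[A⁄k]} (hy : y ∈ c.flatForms) :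
    interior k A (c.monomial I) y ∈ c.flatForms := by
  have h : c.monomial I = ((List.ofFn I).map fun i => ExteriorAlgebra.ι A (c.del i)).prod := by
    rw [monomial, ExteriorAlgebra.ιMulti_apply, List.map_ofFn]
    rfl
  rw [h]
  induction List.ofFn I with
  | nil => rwa [List.map_nil, List.prod_nil, map_one]
  | cons i L ih =>
    rw [List.map_cons, List.prod_cons, interior_ι_mul]
    exact c.contractLeft_mem_flatForms i ih

theorem EtaleCoordinates.d_eq_zero_of_mem_flatForms {y : ExteriorAlgebra A Ω[A⁄k]}
    (hy : y ∈ c.flatForms) : DR.d _ (formsToDR k A y) = 0 := by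
  induction hy using Submodule.span_induction with
  | mem y hy =>
    obtain ⟨L, rfl⟩ := hy
    dsimp only
    induction L with
    | nil =>
      rw [List.map_nil, List.prod_nil, ← map_one (algebraMap A _), formsToDR_algebraMap,
        DR.d_ofFun, ← formsToDR_ι_D, Derivation.map_one_eq_zero, map_zero, map_zero]
    | cons j L ih =>
      rw [List.map_cons, List.prod_cons, map_mul, DR.d_mul, ih, formsToDR_ι_D, DR.d_dFun, zero_mul,
        mul_zero, add_zero]
  | zero => rw [map_zero, map_zero]
  | add x y _ _ hx hy => rw [map_add, map_add, hx, hy, add_zero]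
  | smul r x _ hx => rw [map_smul, map_smul, hx, smul_zero]

/-- The coordinate formula: for `y = p_I ⌋ vol`, a form with constant coefficients, one has
`d (a y) = d a ∧ y = ∑ i, (∂ a / ∂ x_i) d x_i ∧ y`, and `d x_i ∧ -` corresponds to `∂ / ∂ p_i`. -/
theorem isBVLaplacian_laplacian (h : Function.Bijective (densityForm k A n)) :
    IsBVLaplacian (laplacian h) := by
  intro c a j I
  apply h.1
  rw [densityForm_laplacian, densityForm_apply, densityForm_apply, ← smul_tmul', map_smul,
    formsToDR_smul, DR.d_mul, DR.d_ofFun, densityToForms_tmul,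
    c.d_eq_zero_of_mem_flatForms (c.interior_monomial_mem_flatForms I c.vol_mem_flatForms),
    mul_zero, add_zero, ← formsToDR_ι_D, ← map_mul, c.spec a, map_sum, map_sum, Finset.sum_mul]
  congr 1
  refine Finset.sum_congr rfl fun i _ => ?_
  rw [map_smul, smul_mul_assoc, ← densityToForms_tmul,
    ι_D_mul_densityToForms c.toFrame c.trace_toFrame, contractDensity_tmul, ← smul_tmul', map_smul]

theorem EtaleCoordinates.span_D_x :
    Submodule.span A (Set.range fun i => KaehlerDifferential.D k A (c.x i)) = ⊤ := by
  rw [eq_top_iff]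
  rintro α -
  rw [← c.toFrame.sum_smul_D_x α]
  exact Submodule.sum_mem _ fun i _ => Submodule.smul_mem _ _ (Submodule.subset_span ⟨i, rfl⟩)

theorem EtaleCoordinates.span_del : Submodule.span A (Set.range c.del) = ⊤ := by
  rw [eq_top_iff]
  rintro D -
  rw [← c.toFrame.sum_smul_D D]
  exact Submodule.sum_mem _ fun i _ => Submodule.smul_mem _ _ (Submodule.subset_span ⟨i, rfl⟩)

theorem EtaleCoordinates.exists_eq_smul_vol (μ : ⋀[A]^n Ω[A⁄k]) : ∃ b : A, μ = b • c.vol := by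
  suffices H : ∀ y ∈ ⋀[A]^n Ω[A⁄k], ∃ b : A, y = b • (c.vol : ExteriorAlgebra A Ω[A⁄k]) by
    obtain ⟨b, hb⟩ := H μ μ.2
    exact ⟨b, Subtype.ext hb⟩
  intro y hy
  rw [← exteriorPower.ιMulti_span_fixedDegree_of_span_eq_top A n _ c.span_D_x] at hy
  induction hy using Submodule.span_induction with
  | mem y hy =>
    obtain ⟨a, ha, rfl⟩ := hy
    obtain ⟨α, rfl⟩ := Set.range_subset_range_iff_exists_comp.1 ha
    by_cases hα : Function.Injective α
    · let σ : Equiv.Perm (Fin n) := Equiv.ofBijective α (Finite.injective_iff_bijective.1 hα)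
      refine ⟨((Equiv.Perm.sign σ : ℤ) : A), ?_⟩
      rw [Int.cast_smul_eq_zsmul]
      exact (ExteriorAlgebra.ιMulti A n).map_perm _ σ
    · obtain ⟨i, j, hij, hne⟩ : ∃ i j, α i = α j ∧ i ≠ j := by
        simpa [Function.Injective] using hα
      refine ⟨0, ?_⟩
      rw [zero_smul]
      exact (ExteriorAlgebra.ιMulti A n).map_eq_zero_of_eq _
        (congrArg (fun i => KaehlerDifferential.D k A (c.x i)) hij) hne
  | zero => exact ⟨0, by rw [zero_smul]⟩
  | add x y _ _ hx hy =>
    obtain ⟨a, rfl⟩ := hx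
    obtain ⟨b, rfl⟩ := hy
    exact ⟨a + b, by rw [add_smul]⟩
  | smul r x _ hx =>
    obtain ⟨a, rfl⟩ := hx
    exact ⟨r * a, by rw [mul_smul]⟩

/-- In the presence of étale coordinates the coordinate formula determines the operator. -/
theorem IsBVLaplacian.eq {Δ Δ' : Density k A n →ₗ[k] Density k A n} (h : IsBVLaplacian Δ)
    (h' : IsBVLaplacian Δ') (c : EtaleCoordinates k A n) (z : Density k A n) : Δ z = Δ' z := by
  induction z using density_induction with
  | zero => rw [map_zero, map_zero]
  | add x y hx hy => rw [map_add, map_add, hx, hy]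
  | tmul j P μ hP =>
    obtain ⟨b, rfl⟩ := c.exists_eq_smul_vol μ
    rw [← smul_tmul]
    generalize hQ : b • P = Q
    replace hP : Q ∈ ⋀[A]^j (Derivation k A A) := hQ ▸ Submodule.smul_mem _ b hP
    clear hQ
    rw [← exteriorPower.ιMulti_span_fixedDegree_of_span_eq_top A j _ c.span_del] at hP
    induction hP using Submodule.closure_induction with
    | zero => rw [zero_tmul, map_zero, map_zero]
    | add x y _ _ hx hy => rw [add_tmul, map_add, map_add, hx, hy]
    | smul_mem a x hx =>
      obtain ⟨v, hv, rfl⟩ := hx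
      obtain ⟨I, rfl⟩ := Set.range_subset_range_iff_exists_comp.1 hv
      exact (h c a j I).trans (h' c a j I).symm

end Coordinates

/-! ### Restriction of differential forms along jointly injective étale maps -/

/-- Differential forms vanish if their restrictions along a jointly injective family of formally
étale maps vanish. -/
theorem form_eq_zero_of_forall_exteriorMap {k : Type*} [Field k] [CharZero k] {A : Type*}
    [CommRing A] [Algebra k A] (F : Frame k A) {S : Type*} {B : S → Type*} [∀ s, CommRing (B s)]
    [∀ s, Algebra k (B s)] (φ : ∀ s, A →ₐ[k] B s) (hφ : ∀ s, (φ s).toRingHom.FormallyEtale)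
    (hinj : ∀ a, (∀ s, φ s a = 0) → a = 0) {q : ℕ} {y : ExteriorAlgebra A Ω[A⁄k]}
    (hy : y ∈ ⋀[A]^q Ω[A⁄k])
    (h : ∀ s, exteriorMap (φ s) (formRes (φ s)) (formRes_smul (φ s)) y = 0) : y = 0 := by
  -- The contractions of `y` with the vector fields of a frame vanish by induction, and `q y` is
  -- the sum of their products with the forms `d x_j`.
  induction q generalizing y with
  | zero =>
    obtain ⟨a, rfl⟩ := exists_algebraMap_eq_of_mem_zero hy
    rw [hinj a fun s => ?_, map_zero]
    have := h s
    rw [exteriorMap_algebraMap] at this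
    exact (ExteriorAlgebra.algebraMap_leftInverse Ω[B s⁄k]).injective
      (this.trans (map_zero _).symm)
  | succ q ih =>
    have h1 := sum_ι_mul_contractLeft F.sum_smul_D_x hy
    rw [Finset.sum_eq_zero fun j _ => by
      rw [ih (contractLeft_mem _ hy) fun s => by
        rw [exteriorMap_contractLeft (φ s) (hφ s), h s, map_zero], mul_zero]] at h1
    have h2 : algebraMap k A ((q + 1 : ℕ) : k)⁻¹ • ((q + 1 : ℕ) : A) • y = 0 := by
      rw [← h1, smul_zero]
    rwa [← map_natCast (algebraMap k A), smul_smul, ← map_mul,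
      inv_mul_cancel₀ (by exact_mod_cast q.succ_ne_zero), map_one, one_smul] at h2

/-! ### Restriction to the zero section -/

section ZeroSection

variable {k : Type*} [CommRing k] {A : Type*} [CommRing A] [Algebra k A]

variable (k A) in
/-- The restriction of functions on `T^*[-1] (Spec A)` to the zero section. -/
noncomputable def zeroSection : Polyvector k A →ₐ[k] A :=
  ExteriorAlgebra.algebraMapInv.restrictScalars k

theorem zeroSection_algebraMap (a : A) : zeroSection k A (algebraMap A _ a) = a :=
  ExteriorAlgebra.algebraMap_leftInverse _ a

theorem zeroSection_ι (D : Derivation k A A) : zeroSection k A (ExteriorAlgebra.ι A D) = 0 :=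
  ExteriorAlgebra.lift_ι_apply A _ _ D

theorem zeroSection_mem (i : ℕ) (P : Polyvector k A) (hP : P ∈ polyGrading k A i) :
    zeroSection k A P ∈ constGrading k A i := by
  cases i with
  | zero => exact mem_constGrading_zero k A _
  | succ i =>
    suffices h : zeroSection k A P = 0 by rw [h]; exact zero_mem _
    have hP' : P ∈ LinearMap.range (ExteriorAlgebra.ι A : Derivation k A A →ₗ[A] _) *
        ⋀[A]^i (Derivation k A A) := by
      rw [← pow_succ']; exact hP
    induction hP' using Submodule.mul_induction_on' with
    | mem_mul_mem x hx y _ =>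
      obtain ⟨D, rfl⟩ := hx
      rw [map_mul, zeroSection_ι, zero_mul]
    | add x hx y hy h h' =>
      have key : ∀ z, z ∈ LinearMap.range (ExteriorAlgebra.ι A : Derivation k A A →ₗ[A] _) *
          ⋀[A]^i (Derivation k A A) → z ∈ polyGrading k A (i + 1) := fun z hz => by
        rw [← pow_succ'] at hz; exact hz
      rw [map_add, h (key x hx), h' (key y hy), add_zero]

theorem zeroSection_polyRes {A' : Type*} [CommRing A'] [Algebra k A'] (φ : A →ₐ[k] A')
    (hφ : φ.toRingHom.FormallyEtale) :
    (zeroSection k A').comp (polyRes φ hφ) = φ.comp (zeroSection k A) := by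
  apply exterior_algHom_ext
  · intro a
    rw [AlgHom.comp_apply, AlgHom.comp_apply, polyRes, exteriorMap_algebraMap,
      zeroSection_algebraMap, zeroSection_algebraMap]
  · intro D
    rw [AlgHom.comp_apply, AlgHom.comp_apply, polyRes, exteriorMap_ι, zeroSection_ι, zeroSection_ι,
      map_zero]

theorem map_zeroSection_map_polyRes {A' : Type*} [CommRing A'] [Algebra k A'] (φ : A →ₐ[k] A')
    (hφ : φ.toRingHom.FormallyEtale)
    (hφ' : ∀ i, ∀ b ∈ constGrading k A i, φ b ∈ constGrading k A' i)
    (x : DR (polyGrading k A)) :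
    DR.map (zeroSection k A') zeroSection_mem (DR.map (polyRes φ hφ) (polyRes_mem φ hφ) x) =
      DR.map φ hφ' (DR.map (zeroSection k A) zeroSection_mem x) := by
  rw [DR.map_map, DR.map_map]
  simp only [zeroSection_polyRes]

end ZeroSection

/-- The symplectic form restricts to zero on the zero section, where the fibre coordinates
vanish. -/
theorem map_zeroSection_stdForm {k : Type u} [Field k] [CharZero k] {A : Type u} [CommRing A]
    [Algebra k A] [Algebra.Smooth k A] :
    DR.map (zeroSection k A) zeroSection_mem (stdForm k A).val =
      (0 : DR.ClosedTwoForm (constGrading k A)).val := by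
  obtain ⟨F⟩ := Frame.nonempty k A
  rw [stdForm_eq F, map_sum, DR.ClosedTwoForm.val_zero]
  refine Finset.sum_eq_zero fun j _ => ?_
  rw [map_mul, DR.map_dFun, zeroSection_ι, map_zero, zero_mul]

section Smooth

variable {k : Type u} [Field k] [CharZero k] {Y : Scheme.{u}} (f : Y ⟶ Spec (CommRingCat.of k))

/-- The restriction of twisted differential forms on `T^*[-1] Y` to the zero section. -/
noncomputable def twistedToDeRham [Smooth f] : twistedDeRham f ⟶ deRham f where
  app U := DR.twistedMap (zeroSection k (Sections f U.unop)) zeroSection_mem _ _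
    map_zeroSection_stdForm
  naturality U V i := by
    ext m x
    funext w
    apply Subtype.ext
    exact map_zeroSection_map_polyRes _ (res_etale f i.unop.le) _ (x w).1

theorem quasiIso_twistedToDeRham_app [Smooth f] (U : Y.affineOpensᵒᵖ) :
    QuasiIso ((twistedToDeRham f).app U) := by
  refine DR.quasiIso_twistedMap (zeroSection k (Sections f U.unop)) zeroSection_mem
    (IsScalarTower.toAlgHom k _ _) (fun i a ha => ?_) ?_ (fun b hb => ?_) _
    map_zeroSection_stdForm
  · rcases eq_or_ne i 0 with rfl | hi
    · exact algebraMap_mem a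
    · rw [eq_zero_of_mem_constGrading k _ hi ha, map_zero]; exact zero_mem _
  · ext a
    exact zeroSection_algebraMap a
  · obtain ⟨a, rfl⟩ := exists_algebraMap_eq_of_mem_zero hb
    rw [zeroSection_algebraMap]
    rfl

end Smooth

/-! ### Local étale coordinates on smooth schemes -/

section LocalCoordinates

/-- A standard smooth algebra of relative dimension `n` has étale coordinates. -/
theorem EtaleCoordinates.nonempty {k : Type*} [Field k] {A : Type*} [CommRing A] [Algebra k A]
    {n : ℕ} [Algebra.IsStandardSmoothOfRelativeDimension n k A] :
    Nonempty (EtaleCoordinates k A n) := by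
  classical
  obtain ⟨ι, σ, _, _, P, hP⟩ :=
    Algebra.IsStandardSmoothOfRelativeDimension.out (n := n) (R := k) (S := A)
  letI := Fintype.ofFinite ι
  letI := Fintype.ofFinite σ
  have hcard : Nat.card ((Set.range P.map)ᶜ : Set ι) = n := by
    rw [← hP, Algebra.Presentation.dimension, Nat.card_eq_fintype_card, Fintype.card_compl_set,
      Set.card_range_of_injective P.map_inj, Nat.card_eq_fintype_card, Nat.card_eq_fintype_card]
  let e := Finite.equivFinOfCardEq hcard
  let b := P.basisKaehler.reindex e
  have hb : ∀ i, b i = KaehlerDifferential.D k A (P.val (e.symm i)) := fun i => by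
    rw [Module.Basis.reindex_apply, Algebra.SubmersivePresentation.basisKaehler_apply]
  refine ⟨⟨fun i => P.val (e.symm i),
    fun i => (b.coord i).compDer (KaehlerDifferential.D k A), fun i j => ?_, fun f => ?_⟩⟩
  · change b.coord i (KaehlerDifferential.D k A (P.val (e.symm j))) = _
    rw [← hb, Module.Basis.coord_apply, Module.Basis.repr_self, Finsupp.single_apply]
    simp only [eq_comm]
  · conv_lhs => rw [← b.sum_repr (KaehlerDifferential.D k A f)]
    simp only [hb]
    rfl

variable {k : Type u} [Field k] {Y : Scheme.{u}} (f : Y ⟶ Spec (CommRingCat.of k)) {n : ℕ}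

/-- Every point of a smooth scheme of dimension `n` has arbitrarily small affine neighbourhoods
with étale coordinates. -/
theorem exists_etaleCoordinates [SmoothOfRelativeDimension n f] (U : Y.affineOpens) (x : Y)
    (hx : x ∈ U.1) :
    ∃ V : Y.affineOpens, V ≤ U ∧ x ∈ V.1 ∧ Nonempty (EtaleCoordinates k (Sections f V) n) := by
  obtain ⟨W, hW, V, hV, hxV, e, h⟩ :=
    SmoothOfRelativeDimension.exists_isStandardSmoothOfRelativeDimension (n := n) (f := f) x
  -- The affine scheme `Spec k` has only one point.
  obtain rfl : W = ⊤ := by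
    rw [eq_top_iff]
    intro y _
    have : y = f x := Subsingleton.elim (α := PrimeSpectrum k) y (f x)
    rw [this]
    exact e hxV
  have h2 : (structureMap f V).IsStandardSmoothOfRelativeDimension n :=
    h.comp (RingHom.IsStandardSmoothOfRelativeDimension.equiv
      (Scheme.ΓSpecIso (CommRingCat.of k)).symm.commRingCatIsoToRingEquiv)
  haveI : Algebra.IsStandardSmoothOfRelativeDimension n k (Sections f V) := h2
  obtain ⟨c⟩ := EtaleCoordinates.nonempty (k := k) (A := Sections f V) (n := n)
  obtain ⟨_, ⟨V', hV', rfl⟩, hxV', hV'V⟩ :=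
    Y.isBasis_affineOpens.exists_subset_of_mem_open (⟨hxV, hx⟩ : x ∈ V ⊓ U.1) (V ⊓ U.1).2
  have h3 : (⟨V', hV'⟩ : Y.affineOpens) ≤ ⟨V, hV⟩ := fun _ h => (hV'V h).1
  exact ⟨⟨V', hV'⟩, fun _ h => (hV'V h).2, hxV', ⟨c.res (res f h3) (res_etale f h3)⟩⟩

/-- Functions are determined by their restrictions to the affine open subsets with étale
coordinates. -/
theorem eq_zero_of_forall_res [SmoothOfRelativeDimension n f] (U : Y.affineOpens)
    (a : Sections f U) (h : ∀ (V : Y.affineOpens) (hV : V ≤ U),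
      Nonempty (EtaleCoordinates k (Sections f V) n) → res f hV a = 0) : a = 0 := by
  choose V hVU hxV hV using fun x : U.1 => exists_etaleCoordinates (n := n) f U x x.2
  refine Y.sheaf.eq_of_locally_eq' (fun x => (V x).1) U.1 (fun x => homOfLE (hVU x))
    (fun x hx => ?_) a 0 fun x => ?_
  · exact TopologicalSpace.Opens.mem_iSup.2 ⟨⟨x, hx⟩, hxV ⟨x, hx⟩⟩
  · exact (h (V x) (hVU x) (hV x)).trans (map_zero (res f (hVU x))).symm

/-- The rank of the Kähler differentials of a smooth scheme of dimension `n` is `n`. -/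
theorem Frame.trace_eq_natCast [CharZero k] [SmoothOfRelativeDimension n f] {U : Y.affineOpens}
    (F : Frame k (Sections f U)) : F.trace = n := by
  rw [← sub_eq_zero]
  refine eq_zero_of_forall_res (n := n) f U _ fun V hV ⟨c⟩ => ?_
  rw [map_sub, map_natCast, ← F.trace_res (BVQuantization.res f hV) (res_etale f hV),
    Frame.trace_eq _ c.toFrame, c.trace_toFrame, sub_self]

end LocalCoordinates

/-! ### Existence and uniqueness of the BV Laplacian -/

section BV

variable {k : Type u} [Field k] [CharZero k] {Y : Scheme.{u}} (f : Y ⟶ Spec (CommRingCat.of k))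
  [Smooth f] (n : ℕ) [SmoothOfRelativeDimension n f]

theorem densityForm_bijective_sections (U : Y.affineOpens) :
    Function.Bijective (densityForm k (Sections f U) n) := by
  obtain ⟨F⟩ := Frame.nonempty k (Sections f U)
  exact densityForm_bijective F (F.trace_eq_natCast f)

/-- The BV Laplacian of a smooth scheme of dimension `n`. -/
noncomputable def bvLaplacian : BVLaplacian f n where
  op U := laplacian (densityForm_bijective_sections f n U)
  degree U m z hz := by
    obtain ⟨F⟩ := Frame.nonempty k (Sections f U)
    exact laplacian_mem F (F.trace_eq_natCast f) _ hz
  natural h z := laplacian_densityRes _ _ _ _ (map_mem_constGrading _) z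
  formula U := isBVLaplacian_laplacian _

theorem bvLaplacian_isDifferential : (bvLaplacian f n).IsDifferential :=
  fun U => laplacian_laplacian (densityForm_bijective_sections f n U)

/-- Uniqueness: two BV Laplacians agree on the affine open subsets with étale coordinates, by the
coordinate formula, hence everywhere, as they are compatible with restriction and sections of
`π^* K [-n]` of a fixed degree, being differential forms, are determined locally. -/
theorem BVLaplacian.op_eq (Δ Δ' : BVLaplacian f n) (U : Y.affineOpens)
    (z : Density k (Sections f U) n) : Δ.op U z = Δ'.op U z := by
  induction z using density_induction with
  | zero => rw [map_zero, map_zero]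
  | add x y hx hy => rw [map_add, map_add, hx, hy]
  | tmul j P μ hP =>
    have hz := tmul_mem_densityPiece hP μ
    generalize P ⊗ₜ[Sections f U] μ = z at hz
    generalize (n : ℤ) - j = m at hz
    obtain ⟨F⟩ := Frame.nonempty k (Sections f U)
    have hF : F.trace = n := F.trace_eq_natCast f
    have hw := sub_mem (Δ.degree U m z hz) (Δ'.degree U m z hz)
    rw [← sub_eq_zero]
    apply densityToForms_injective F hF
    rw [map_zero]
    rcases lt_or_ge (m + 1) 0 with hm | hm
    · exact densityToForms_eq_zero hm hw
    · lift m + 1 to ℕ using hm with q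
      refine form_eq_zero_of_forall_exteriorMap F
        (S := {V : Y.affineOpens // V ≤ U ∧ Nonempty (EtaleCoordinates k (Sections f V) n)})
        (fun V => res f V.2.1) (fun V => res_etale f V.2.1)
        (fun a ha => eq_zero_of_forall_res (n := n) f U a fun V hV hc => ha ⟨V, hV, hc⟩)
        (densityToForms_mem hw) fun V => ?_
      obtain ⟨V, hV, ⟨c⟩⟩ := V
      rw [exteriorMap_densityToForms _ (res_etale f hV), map_sub, ← Δ.natural, ← Δ'.natural,
        (Δ.formula V).eq (Δ'.formula V) c, sub_self, map_zero]

theorem BVLaplacian.eq (Δ Δ' : BVLaplacian f n) : Δ = Δ' := by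
  have h : Δ.op = Δ'.op := funext fun U => LinearMap.ext (BVLaplacian.op_eq f n Δ Δ' U)
  cases Δ
  cases Δ'
  cases h
  rfl

end BV

/-! ### Comparison of the BV complex with the de Rham complex -/

section Comparison

variable {k : Type u} [Field k] [CharZero k] {A : Type u} [CommRing A] [Algebra k A] {n : ℕ}

variable (k A n) in
/-- The contraction of top forms with polyvector fields, as a map from the component of degree `m`
of `π^* K [-n]` to the component of degree `m` of the de Rham complex. -/
noncomputable def densityFormPiece (m : ℤ) :
    densityPiece k A n m →ₗ[k] (∀ w : ℕ, DR.piece (constGrading k A) w m) :=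
  LinearMap.pi fun w => if h : (w : ℤ) = m then
    (densityForm k A n).restrict (fun z hz => by subst h; exact densityForm_mem hz) else 0

theorem densityFormPiece_of_eq {m : ℤ} {w : ℕ} (h : (w : ℤ) = m) (z : densityPiece k A n m) :
    (densityFormPiece k A n m z w : DR (constGrading k A)) = densityForm k A n z := by
  rw [densityFormPiece, LinearMap.pi_apply, dif_pos h]
  rfl

theorem densityFormPiece_of_ne {m : ℤ} {w : ℕ} (h : (w : ℤ) ≠ m) (z : densityPiece k A n m) :
    densityFormPiece k A n m z w = 0 := by
  rw [densityFormPiece, LinearMap.pi_apply, dif_neg h]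
  rfl

theorem densityFormPiece_bijective (F : Frame k A) (hF : F.trace = n) (m : ℤ) :
    Function.Bijective (densityFormPiece k A n m) := by
  constructor
  · refine (injective_iff_map_eq_zero _).2 fun z hz => ?_
    refine Subtype.ext ((densityForm_bijective F hF).1 ?_)
    rw [ZeroMemClass.coe_zero, map_zero]
    rcases lt_or_ge m 0 with hm | hm
    · exact densityForm_eq_zero hm z.2
    · lift m to ℕ using hm
      rw [← densityFormPiece_of_eq rfl, hz]
      rfl
  · intro x
    have hx : ∀ w : ℕ, (w : ℤ) ≠ m → x w = 0 := fun w hw =>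
      Subtype.ext (DR.eq_zero_of_mem_piece_constGrading (x w).2 hw)
    rcases lt_or_ge m 0 with hm | hm
    · exact ⟨0, funext fun w => by rw [hx w (by omega), map_zero, Pi.zero_apply]⟩
    · lift m to ℕ using hm
      obtain ⟨z, hz, h⟩ := exists_densityForm_eq F hF (x m).2
      refine ⟨⟨z, hz⟩, funext fun w => ?_⟩
      by_cases hw : w = m
      · subst hw
        exact Subtype.ext ((densityFormPiece_of_eq rfl _).trans h)
      · have hw' : (w : ℤ) ≠ m := by exact_mod_cast hw
        rw [hx w hw', densityFormPiece_of_ne hw']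

/-- The contraction of top forms is compatible with the differentials. The component of weight `w`
of `densityFormPiece` is nonzero only in degree `w`. -/
theorem densityFormPiece_laplacian (h : Function.Bijective (densityForm k A n)) {m m' : ℤ}
    (hm : m + 1 = m') (z : densityPiece k A n m) (hz : laplacian h z ∈ densityPiece k A n m') :
    densityFormPiece k A n m' ⟨laplacian h z, hz⟩ =
      DR.twistedD (0 : DR.ClosedTwoForm (constGrading k A)) hm (densityFormPiece k A n m z) := by
  funext w
  apply Subtype.ext
  match w with
  | 0 =>
    rw [DR.twistedD_zero]
    by_cases h0 : ((0 : ℕ) : ℤ) = m'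
    · rw [densityFormPiece_of_eq h0, densityForm_laplacian,
        densityForm_eq_zero (by omega) z.2, map_zero]
    · rw [densityFormPiece_of_ne h0]; rfl
  | 1 =>
    rw [DR.twistedD_one]
    by_cases h0 : ((1 : ℕ) : ℤ) = m'
    · rw [densityFormPiece_of_eq h0, densityFormPiece_of_eq (by omega), densityForm_laplacian]
    · rw [densityFormPiece_of_ne h0, densityFormPiece_of_ne (by omega)]
      exact (map_zero _).symm
  | w + 2 =>
    rw [DR.twistedD_add_two, DR.ClosedTwoForm.val_zero, zero_mul, add_zero]
    by_cases h0 : ((w + 2 : ℕ) : ℤ) = m'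
    · rw [densityFormPiece_of_eq h0, densityFormPiece_of_eq (by push_cast at h0 ⊢; omega),
        densityForm_laplacian]
    · rw [densityFormPiece_of_ne h0, densityFormPiece_of_ne (by push_cast at h0 ⊢; omega)]
      exact (map_zero _).symm

theorem map_densityFormPiece {A' : Type u} [CommRing A'] [Algebra k A'] (φ : A →ₐ[k] A')
    (hφ : φ.toRingHom.FormallyEtale)
    (hφ' : ∀ i, ∀ b ∈ constGrading k A i, φ b ∈ constGrading k A' i) (m : ℤ)
    (z : densityPiece k A n m) (w : ℕ) :
    (densityFormPiece k A' n m (densityResPiece φ hφ m z) w : DR (constGrading k A')) =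
      DR.map φ hφ' (densityFormPiece k A n m z w) := by
  by_cases h : (w : ℤ) = m
  · rw [densityFormPiece_of_eq h, densityFormPiece_of_eq h, map_densityForm φ hφ]
    rfl
  · rw [densityFormPiece_of_ne h, densityFormPiece_of_ne h]
    exact (map_zero _).symm

end Comparison

section BVComparison

variable {k : Type u} [Field k] [CharZero k] {Y : Scheme.{u}} (f : Y ⟶ Spec (CommRingCat.of k))
  [Smooth f] (n : ℕ) [SmoothOfRelativeDimension n f]

/-- The contraction of top forms with polyvector fields, as a morphism of complexes. -/
noncomputable def bvToDeRham :
    (bvLaplacian f n).complex (bvLaplacian_isDifferential f n) ⟶ deRham f where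
  app U :=
    { f := fun m => ModuleCat.ofHom (densityFormPiece k (Sections f U.unop) n m)
      comm' := fun m m' h => by
        have h : m + 1 = m' := h
        dsimp only [deRham, BVLaplacian.complex, BVLaplacian.complexOn, DR.twistedComplex]
        rw [dif_pos h, dif_pos h]
        ext z : 2
        exact (densityFormPiece_laplacian (densityForm_bijective_sections f n U.unop) h z _).symm }
  naturality U V i := by
    ext m z
    funext w
    exact Subtype.ext (map_densityFormPiece _ _ _ m z w)

theorem quasiIso_bvToDeRham_app (U : Y.affineOpensᵒᵖ) : QuasiIso ((bvToDeRham f n).app U) := by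
  obtain ⟨F⟩ := Frame.nonempty k (Sections f U.unop)
  haveI : ∀ m, IsIso (((bvToDeRham f n).app U).f m) := fun m =>
    (ConcreteCategory.isIso_iff_bijective _).2
      (densityFormPiece_bijective F (F.trace_eq_natCast f) m)
  haveI := HomologicalComplex.Hom.isIso_of_components ((bvToDeRham f n).app U)
  infer_instance

end BVComparison

end BVQuantization

theorem mainTheorem5 {k : Type u} [Field k] [CharZero k] (Y : Scheme.{u})
    (f : Y ⟶ Spec (CommRingCat.of k)) [Smooth f] :
    (∃ φ : twistedDeRham f ⟶ deRham f,
      (∀ U, QuasiIso (φ.app U)) ∧ QuasiIso ((RΓ k Y.affineOpens).map φ)) ∧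
    ∀ (n : ℕ) [SmoothOfRelativeDimension n f], ∃ Δ : BVLaplacian f n,
      (∀ Δ' : BVLaplacian f n, Δ' = Δ) ∧ ∃ hΔ : Δ.IsDifferential,
        ∃ ψ : Δ.complex hΔ ⟶ deRham f,
          (∀ U, QuasiIso (ψ.app U)) ∧ QuasiIso ((RΓ k Y.affineOpens).map ψ) := by
  refine ⟨⟨twistedToDeRham f, quasiIso_twistedToDeRham_app f,
    quasiIso_RΓ_map _ (quasiIso_twistedToDeRham_app f)⟩, fun n _ => ⟨bvLaplacian f n,
    fun Δ' => BVLaplacian.eq f n Δ' _, bvLaplacian_isDifferential f n, bvToDeRham f n,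
    quasiIso_bvToDeRham_app f n, quasiIso_RΓ_map _ (quasiIso_bvToDeRham_app f n)⟩⟩
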